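/- **Notation.** For complex $p$ with $|p|<1$ put $\theta_p(x)=\prod_{k\ge0}(1-p^kx)(1-p^{k+1}/x)$ and $\theta_p(x;q)_m=\prod_{0\le i<m}\theta_p(q^ix)$; several arguments before the semicolon denote a product, e.g. $\theta_p(x_1,\dots,x_r;q)_m=\prod_s\theta_p(x_s;q)_m$. **Model.** Let $N\ge 0$, $0\le S\le T$ be integers. Let $\Omega(N,S,T)$ be the set of families of $N$ non-intersecting lattice paths from $(0,0),\dots,(0,N-1)$ to $(T,S),\dots,(T,S+N-1)$ with steps $(1,0)$ and $(1,1)$; these encode the lozenge tilings of the hexagon with side lengths $N,\,T-S,\,S$. For $0\le t\le T$ let $X(t)=(x_1<\dots<x_N)$ be the positions of the paths (particles) on the vertical line $t$; they lie in $\{x\in\mathbb Z:\max(0,t+S-T)\le x\le\min(t,S)+N-1\}$. Let $\mathcal X_t$ be the set of increasing $N$-tuples from this set. The sites of this set not occupied by particles are the holes; a hole $x$ on the line $t$ is a horizontal lozenge, whose top vertex is $(i,j)=(t,\,x+1-t/2)$. Let $q,v_1,v_2\in\mathbb C^*$, with fixed square roots $\sqrt q,\sqrt{v_1},\sqrt{v_2}$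 used consistently below (so $\sqrt{v_1v_2}=\sqrt{v_1}\sqrt{v_2}$, $\sqrt{v_2/v_1}=\sqrt{v_2}/\sqrt{v_1}$, etc.). The horizontal lozenge with top vertex $(i,j)$ has weight $$w(i,j)=\frac{(v_1v_2)^{1/2}q^{j-S/2-1/2}\,\theta_p(q^{2j-S-1}v_1v_2)}{\theta_p(q^{j-3i/2-S-1}v_1,\;q^{j-3i/2-S}v_1,\;q^{j+3i/2-1}v_2,\;q^{j+3i/2}v_2)},$$ the weight of a tiling is the product of the weights of its horizontal lozenges, $Z$ is the sum of the weights of all tilings, and $\mathrm{Prob}$ is the (in general complex) measure on $\Omega(N,S,T)$ giving a tiling the mass $\text{weight}/Z$ (a probability measure when these masses are nonnegative). Assume that the parameters are non-degenerate: $Z\neq0$ and $\theta_p(q^k)\ne0$ for $1\le k\le N+T-1$, $\theta_p(q^kv_1)\neq0$ for $1-2T\le k\le N-S-1$, $\theta_p(q^kv_2)\ne0$ for $1\le k\le N+S+T-1$, $\theta_p(q^kv_1v_2)\neq0$ for $1-T\le k\le 2N-1$. Fix $0\le t\le T$, put $\varphi_{t,S}(x,y)=q^{-x}\theta_p(q^{x-y},q^{x+y+1-t-S}v_1v_2)$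 and $$A=q^{\frac t2+\frac S2-T+\frac12}\sqrt{v_1v_2},\quad B=q^{\frac t2+\frac S2+T+\frac12}\sqrt{v_2/v_1},\quad C=\frac{q^{\frac t2-\frac S2-N+\frac12}}{\sqrt{v_1v_2}},$$ $$D=\frac{q^{-\frac t2+\frac S2-N+\frac12}}{\sqrt{v_1v_2}},\quad E=q^{-\frac t2-\frac S2+\frac12}\sqrt{v_1/v_2},\quad F=q^{-\frac t2-\frac S2+\frac12}\sqrt{v_1v_2}.$$ **Theorem.** Below, $const$ is the normalizing constant: one over the sum of the remaining factor over $\mathcal X_t$, a sum which is non-zero. $X(t)$ always lies in $\mathcal X_t$, so $\mathrm{Prob}(X(t)=x)=0$ for $x\notin\mathcal X_t$. (1) If $t+S\le T$, then for all $(x_1,\dots,x_N)\in\mathcal X_t$ $$\mathrm{Prob}(X(t)=(x_1,\dots,x_N))=const\cdot\prod_{k<l}\varphi_{t,S}(x_k,x_l)^2\prod_{k=1}^N q^{(2N-1)x_k}\theta_p(q^{2x_k+1-t-S}v_1v_2)$$ $$\times\prod_{k=1}^N\frac{\theta_p(q^{1-N-t},q^{1-N-S},q^{1-t-S}v_1,q^{1+T}v_2,q^{1-T}v_1v_2,q^{1-t-S}v_1v_2;q)_{x_k}}{\theta_p(q,q^{1-S-t+T},q^{1-t-T-S}v_1,qv_2,q^{1+N-S}v_1v_2,q^{1+N-t}v_1v_2;q)_{x_k}}$$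 $$=const\cdot\prod_{k<l}\varphi_{t,S}(x_k,x_l)^2\prod_{k=1}^N q^{(2N-1)x_k}\theta_p(q^{2x_k}F^2)\frac{\theta_p(AF,BF,CF,DF,EF,F^2;q)_{x_k}}{\theta_p(q,q\frac FA,q\frac FB,q\frac FC,q\frac FD,q\frac FE;q)_{x_k}}.$$ If moreover $p\ne0$, then $\mathrm{Prob}(X(t)=(x_1,\dots,x_N))$ is also equal to $$const\cdot\Delta_\lambda(q^{2N-2}F^2\,|\,q^N,q^{N-1}AF,q^{N-1}(pB)F,q^{N-1}CF,q^{N-1}DF,q^{N-1}EF;q),$$ where $\lambda_i+N-i=x_{N+1-i}$ for $1\le i\le N$, $\lambda_i=0$ for $i>N$. (2) If $t+S\ge T$, put $m=t+S-T$. Then the last two formulas of (1) hold with $A$ and $F$ interchanged (that is, with $A,F$ replaced by $q^{-m}A,\ q^{m}F$) and with $x_k$ replaced by $x_k-m$, except in $\varphi_{t,S}(x_k,x_l)$, which is unchanged: for $(x_1,\dots,x_N)\in\mathcal X_t$ $$\mathrm{Prob}(X(t)=(x_1,\dots,x_N))=const\cdot\prod_{k<l}\varphi_{t,S}(x_k,x_l)^2\prod_{k=1}^N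 q^{(2N-1)(x_k-m)}\theta_p(q^{2(x_k-m)}A^2)\frac{\theta_p(FA,BA,CA,DA,EA,A^2;q)_{x_k-m}}{\theta_p(q,q\frac AF,q\frac AB,q\frac AC,q\frac AD,q\frac AE;q)_{x_k-m}},$$ and, if $p\ne0$, it is equal to $$const\cdot\Delta_\lambda(q^{2N-2}A^2\,|\,q^N,q^{N-1}FA,q^{N-1}(pB)A,q^{N-1}CA,q^{N-1}DA,q^{N-1}EA;q)$$ with $\lambda_i+N-i=x_{N+1-i}-m$ for $1\le i\le N$, $\lambda_i=0$ for $i>N$. Here, for a partition $\lambda$ with at most $N$ parts, $$\Delta_\lambda(a|\dots b_s\dots;q)=\prod_s\frac{C^0_\lambda(b_s)}{C^0_\lambda(pqa/b_s)}\cdot\frac{C^0_{2\lambda^2}(pqa)}{C^-_\lambda(pq)\,C^-_\lambda(q)\,C^+_\lambda(pa)\,C^+_\lambda(a)},$$ $$C^0_\lambda(x)=\prod_{i}\theta_p(q^{1-i}x;q)_{\lambda_i},\qquad C^0_{2\lambda^2}(x)=\prod_i\theta_p(q^{1-2i}x,q^{2-2i}x;q)_{2\lambda_i},$$ $$C^+_\lambda(x)=\prod_{i\le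 j}\frac{\theta_p(q^{2-i-j}x;q)_{\lambda_i+\lambda_j}}{\theta_p(q^{2-i-j}x;q)_{\lambda_i+\lambda_{j+1}}},\qquad C^-_\lambda(x)=\prod_{i\le j}\frac{\theta_p(q^{j-i}x;q)_{\lambda_i-\lambda_{j+1}}}{\theta_p(q^{j-i}x;q)_{\lambda_i-\lambda_j}},$$ with $1\le i\le j\le N$. -/

import Mathlib

open Finset

noncomputable section

namespace EllipticTilings

/-! ### Theta functions -/

/-- The theta function `θ_p(x) = ∏_{k ≥ 0} (1 - p^k x) (1 - p^{k+1} / x)`. -/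
def theta (p x : ℂ) : ℂ :=
  ∏' k : ℕ, (1 - p ^ k * x) * (1 - p ^ (k + 1) / x)

/-- The theta-Pochhammer symbol `θ_p(x; q)_m = ∏_{0 ≤ i < m} θ_p(q^i x)`. -/
def thetaPoch (p q x : ℂ) (m : ℕ) : ℂ :=
  ∏ i ∈ range m, theta p (q ^ i * x)

/-- `θ_p(x₁, …, x_r; q)_m = ∏_s θ_p(x_s; q)_m`. -/
def thetaPochs (p q : ℂ) (xs : List ℂ) (m : ℕ) : ℂ :=
  (xs.map fun x => thetaPoch p q x m).prod

/-! ### Delta symbols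

A partition with at most `n` parts is given by its parts `lam 1 ≥ lam 2 ≥ …`, with `lam i = 0` for
`i > n`.  All factors of the products below in which an index exceeds `n` are equal to `1`. -/

/-- `C⁰_λ(x; q) = ∏_i θ_p(q^{1-i} x; q)_{λ_i}`. -/
def symbolC0 (p q : ℂ) (n : ℕ) (lam : ℕ → ℕ) (x : ℂ) : ℂ :=
  ∏ i ∈ Icc 1 n, thetaPoch p q (q ^ (1 - (i : ℤ)) * x) (lam i)

/-- `C⁰_{2λ²}(x; q) = ∏_i θ_p(q^{1-2i} x, q^{2-2i} x; q)_{2 λ_i}`. -/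
def symbolC0Double (p q : ℂ) (n : ℕ) (lam : ℕ → ℕ) (x : ℂ) : ℂ :=
  ∏ i ∈ Icc 1 n,
    thetaPochs p q [q ^ (1 - 2 * (i : ℤ)) * x, q ^ (2 - 2 * (i : ℤ)) * x] (2 * lam i)

/-- `C⁺_λ(x; q) = ∏_{i ≤ j} θ_p(q^{2-i-j} x; q)_{λ_i + λ_j} / θ_p(q^{2-i-j} x; q)_{λ_i + λ_{j+1}}`. -/
def symbolCPlus (p q : ℂ) (n : ℕ) (lam : ℕ → ℕ) (x : ℂ) : ℂ :=
  ∏ i ∈ Icc 1 n, ∏ j ∈ Icc i n,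
    thetaPoch p q (q ^ (2 - (i : ℤ) - (j : ℤ)) * x) (lam i + lam j) /
      thetaPoch p q (q ^ (2 - (i : ℤ) - (j : ℤ)) * x) (lam i + lam (j + 1))

/-- `C⁻_λ(x; q) = ∏_{i ≤ j} θ_p(q^{j-i} x; q)_{λ_i - λ_{j+1}} / θ_p(q^{j-i} x; q)_{λ_i - λ_j}`. -/
def symbolCMinus (p q : ℂ) (n : ℕ) (lam : ℕ → ℕ) (x : ℂ) : ℂ :=
  ∏ i ∈ Icc 1 n, ∏ j ∈ Icc i n,
    thetaPoch p q (q ^ ((j : ℤ) - (i : ℤ)) * x) (lam i - lam (j + 1)) /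
      thetaPoch p q (q ^ ((j : ℤ) - (i : ℤ)) * x) (lam i - lam j)

/-- The symbol `Δ_λ(a | …, b_s, …; q)` (for `t = q`), equal to
`∏_s C⁰_λ(b_s) / C⁰_λ(pqa / b_s) · C⁰_{2λ²}(pqa) / (C⁻_λ(pq, q) C⁺_λ(pa, a))`. -/
def deltaSymbol (p q : ℂ) (n : ℕ) (lam : ℕ → ℕ) (a : ℂ) (bs : List ℂ) : ℂ :=
  (bs.map fun b => symbolC0 p q n lam b / symbolC0 p q n lam (p * q * a / b)).prod *
    (symbolC0Double p q n lam (p * q * a) /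
      ((symbolCMinus p q n lam (p * q) * symbolCMinus p q n lam q) *
        (symbolCPlus p q n lam (p * a) * symbolCPlus p q n lam a)))

/-! ### The tiling model

In the coordinates `(t, x)` the hexagon has vertical lines `0 ≤ t ≤ T`.  A site `x` on the line `t`
stands for the vertical unit edge joining the lattice vertices `x` and `x + 1` of that line; in
Cartesian coordinates `(i, j) = (t, x - t/2)` its top end is `(t, x + 1 - t/2)`.  The site is
either visited by one of the `N` paths (a particle) or is the short diagonal of a horizontal
lozenge (a hole). -/

/-- The sites `x` on the line `t`: `max(0, t+S-T) ≤ x ≤ min(t+N-1, S+N-1)`. -/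
def sites (N S T t : ℕ) : Finset (Fin (S + N)) :=
  univ.filter fun x => t + S ≤ (x : ℕ) + T ∧ (x : ℕ) < t + N

open scoped Classical in
/-- The possible positions `x_1 < … < x_N` of the `N` particles on the line `t`. -/
def lineConfigs (N S T t : ℕ) : Finset (Fin N → Fin (S + N)) :=
  univ.filter fun x => StrictMono x ∧ ∀ k, x k ∈ sites N S T t

/-- `X t k` is the height at time `t` of the `k`-th path: the paths start at
`(0,0), …, (0,N-1)`, end at `(T,S), …, (T,S+N-1)`, have steps of slope `0` or `1`, and do not
intersect.  (Such paths never leave the heights `0, …, S+N-1`.) -/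
def IsPathFamily (N S T : ℕ) (X : Fin (T + 1) → Fin N → Fin (S + N)) : Prop :=
  (∀ k, (X 0 k : ℕ) = k) ∧
  (∀ k, (X (Fin.last T) k : ℕ) = S + k) ∧
  (∀ t, StrictMono (X t)) ∧
  ∀ (t : Fin T) (k : Fin N),
    (X t.succ k : ℕ) = X t.castSucc k ∨ (X t.succ k : ℕ) = X t.castSucc k + 1

open scoped Classical in
/-- The set `Ω(N, S, T)` of families of non-intersecting paths, that is, of lozenge tilings of the
hexagon. -/
def pathFamilies (N S T : ℕ) : Finset (Fin (T + 1) → Fin N → Fin (S + N)) :=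
  univ.filter fun X => IsPathFamily N S T X

/-- The elliptic weight of the horizontal lozenge with top vertex `(i, j)`, where `J = 2j`:
`(v₁v₂)^{1/2} q^{j-S/2-1/2} θ_p(q^{2j-S-1} v₁v₂)` divided by
`θ_p(q^{j-3i/2-S-1} v₁, q^{j-3i/2-S} v₁, q^{j+3i/2-1} v₂, q^{j+3i/2} v₂)`.
Here `sq, r₁, r₂` are square roots of `q, v₁, v₂`. -/
def lozengeWeight (p sq r₁ r₂ : ℂ) (S i J : ℤ) : ℂ :=
  r₁ * r₂ * sq ^ (J - S - 1) * theta p (sq ^ (2 * (J - S - 1)) * (r₁ ^ 2 * r₂ ^ 2)) /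
    (theta p (sq ^ (J - 3 * i - 2 * S - 2) * r₁ ^ 2) *
      theta p (sq ^ (J - 3 * i - 2 * S) * r₁ ^ 2) *
      theta p (sq ^ (J + 3 * i - 2) * r₂ ^ 2) *
      theta p (sq ^ (J + 3 * i) * r₂ ^ 2))

/-- The weight of a tiling: the product of the weights of its horizontal lozenges (holes). -/
def tilingWeight (N S T : ℕ) (p sq r₁ r₂ : ℂ) (X : Fin (T + 1) → Fin N → Fin (S + N)) : ℂ :=
  ∏ t : Fin (T + 1), ∏ x ∈ (sites N S T t).filter (fun x => ∀ k, X t k ≠ x),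
    lozengeWeight p sq r₁ r₂ S (t : ℕ) (2 * ((x : ℕ) : ℤ) + 2 - (t : ℕ))

/-- The sum of the weights of all tilings. -/
def partitionFunction (N S T : ℕ) (p sq r₁ r₂ : ℂ) : ℂ :=
  ∑ X ∈ pathFamilies N S T, tilingWeight N S T p sq r₁ r₂ X

/-- `Prob(X(t) = (x_1, …, x_N))`. -/
def lineProb (N S T : ℕ) (p sq r₁ r₂ : ℂ) (t : Fin (T + 1)) (x : Fin N → Fin (S + N)) : ℂ :=
  (∑ X ∈ (pathFamilies N S T).filter (fun X => X t = x), tilingWeight N S T p sq r₁ r₂ X) /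
    partitionFunction N S T p sq r₁ r₂

/-! ### The densities -/

/-- `φ_{t,S}(x, y) = q^{-x} θ_p(q^{x-y}, q^{x+y+1-t-S} v₁v₂)`. -/
def phi (p q v₁ v₂ : ℂ) (t S x y : ℤ) : ℂ :=
  q ^ (-x) * (theta p (q ^ (x - y)) * theta p (q ^ (x + y + 1 - t - S) * (v₁ * v₂)))

/-- `∏_{k<l} φ_{t,S}(x_k, x_l)²`. -/
def vandermondeSq {N M : ℕ} (p q v₁ v₂ : ℂ) (t S : ℤ) (x : Fin N → Fin M) : ℂ :=
  ∏ k, ∏ l ∈ Ioi k, phi p q v₁ v₂ t S (x k : ℕ) (x l : ℕ) ^ 2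

/-- The density on the line `t` in terms of `q, v₁, v₂`. -/
def lineDensity {M : ℕ} (N S T t : ℕ) (p q v₁ v₂ : ℂ) (x : Fin N → Fin M) : ℂ :=
  vandermondeSq p q v₁ v₂ t S x *
    (∏ k, q ^ ((2 * (N : ℤ) - 1) * (x k : ℕ)) *
      theta p (q ^ (2 * ((x k : ℕ) : ℤ) + 1 - t - S) * (v₁ * v₂))) *
    ∏ k,
      thetaPochs p q
          [q ^ (1 - (N : ℤ) - t), q ^ (1 - (N : ℤ) - S), q ^ (1 - (t : ℤ) - S) * v₁,
            q ^ (1 + (T : ℤ)) * v₂, q ^ (1 - (T : ℤ)) * (v₁ * v₂),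
            q ^ (1 - (t : ℤ) - S) * (v₁ * v₂)] (x k) /
        thetaPochs p q
          [q, q ^ (1 - (S : ℤ) - t + T), q ^ (1 - (t : ℤ) - T - S) * v₁, q * v₂,
            q ^ (1 + (N : ℤ) - S) * (v₁ * v₂), q ^ (1 + (N : ℤ) - t) * (v₁ * v₂)] (x k)

/-- The univariate weight
`q^{(2N-1)x} θ_p(q^{2x} F²) θ_p(AF, BF, CF, DF, EF, F²; q)_x /
θ_p(q, qF/A, qF/B, qF/C, qF/D, qF/E; q)_x`. -/
def selbergWeight (N : ℕ) (p q A B C D E F : ℂ) (x : ℕ) : ℂ :=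
  q ^ ((2 * (N : ℤ) - 1) * x) * theta p (q ^ (2 * x) * F ^ 2) *
    (thetaPochs p q [A * F, B * F, C * F, D * F, E * F, F ^ 2] x /
      thetaPochs p q [q, q * F / A, q * F / B, q * F / C, q * F / D, q * F / E] x)

/-- The discrete elliptic Selberg density on the line `t`; the univariate weight is evaluated at the
positions counted from the site `m` (which is not above any particle). -/
def selbergDensity {M : ℕ} (N S t m : ℕ) (p q v₁ v₂ A B C D E F : ℂ) (x : Fin N → Fin M) : ℂ :=
  vandermondeSq p q v₁ v₂ t S x * ∏ k, selbergWeight N p q A B C D E F ((x k : ℕ) - m)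

/-- The partition `λ` with `λ_i + N - i = x_{N+1-i} - m` for `1 ≤ i ≤ N`. (The entry `x_k` is
`x ⟨k - 1, _⟩`. When `m ≤ x_1 < … < x_N`, no subtraction below is truncated.) -/
def partitionOf {N M : ℕ} (m : ℕ) (x : Fin N → Fin M) (i : ℕ) : ℕ :=
  if h : 1 ≤ i ∧ i ≤ N then (x ⟨N - i, by omega⟩ : ℕ) - m - (N - i) else 0

/-- `Δ_λ(q^{2N-2} F² | q^N, q^{N-1} AF, q^{N-1} (pB)F, q^{N-1} CF, q^{N-1} DF, q^{N-1} EF; q)` for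
the partition `λ` of the positions counted from the site `m`. -/
def selbergDelta {M : ℕ} (N m : ℕ) (p q A B C D E F : ℂ) (x : Fin N → Fin M) : ℂ :=
  deltaSymbol p q N (partitionOf m x) (q ^ (2 * (N : ℤ) - 2) * F ^ 2)
    [q ^ N, q ^ ((N : ℤ) - 1) * (A * F), q ^ ((N : ℤ) - 1) * ((p * B) * F),
      q ^ ((N : ℤ) - 1) * (C * F), q ^ ((N : ℤ) - 1) * (D * F), q ^ ((N : ℤ) - 1) * (E * F)]

/-- `P` vanishes outside `s` and is the normalization of `d` on `s`. -/
def IsNormalization {ι : Type*} (s : Finset ι) (d P : ι → ℂ) : Prop :=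
  ∑ y ∈ s, d y ≠ 0 ∧ (∀ x ∈ s, P x = d x / ∑ y ∈ s, d y) ∧ ∀ x, x ∉ s → P x = 0

/-! ### The six parameters, for square roots `sq, r₁, r₂` of `q, v₁, v₂` -/

/-- `A = q^{t/2+S/2-T+1/2} √(v₁v₂)` -/
def parA (S T t : ℤ) (sq r₁ r₂ : ℂ) : ℂ := sq ^ (t + S - 2 * T + 1) * (r₁ * r₂)

/-- `B = q^{t/2+S/2+T+1/2} √(v₂/v₁)` -/
def parB (S T t : ℤ) (sq r₁ r₂ : ℂ) : ℂ := sq ^ (t + S + 2 * T + 1) * (r₂ / r₁)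

/-- `C = q^{t/2-S/2-N+1/2} / √(v₁v₂)` -/
def parC (N S t : ℤ) (sq r₁ r₂ : ℂ) : ℂ := sq ^ (t - S - 2 * N + 1) * (1 / (r₁ * r₂))

/-- `D = q^{-t/2+S/2-N+1/2} / √(v₁v₂)` -/
def parD (N S t : ℤ) (sq r₁ r₂ : ℂ) : ℂ := sq ^ (-t + S - 2 * N + 1) * (1 / (r₁ * r₂))

/-- `E = q^{-t/2-S/2+1/2} √(v₁/v₂)` -/
def parE (S t : ℤ) (sq r₁ r₂ : ℂ) : ℂ := sq ^ (-t - S + 1) * (r₁ / r₂)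

/-- `F = q^{-t/2-S/2+1/2} √(v₁v₂)` -/
def parF (S t : ℤ) (sq r₁ r₂ : ℂ) : ℂ := sq ^ (-t - S + 1) * (r₁ * r₂)

end EllipticTilings

end

/-! A tiling is a sequence of particle configurations, one on each vertical line, and its weight is
a product over the lines. So the mass of the tilings with X(t) = x is a sum over left parts times a
sum over right parts. Each sum turns out to be a univariate product times an elliptic Vandermonde
product, because one transfer step reproduces this form.

The elliptic input is the kernel K(x, y) = x⁻¹ θ(xy) θ(x/y). By the Jacobi triple product it has
rank two: K(x, y) = α(x)β(y) - β(x)α(y) (`exists_thetaKernel_eq`). Hence Weierstrass' addition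
formula is a Plücker relation, and ∏_{k<l} K(z_k, z_l) is a Vandermonde determinant in the binary
forms of degree N - 1 in α, β. Consider the operator sending f to (φ(z) f(sz) - φ(z⁻¹) f(s⁻¹z)) /
(z⁻¹ θ(z²)), where φ(z) = z⁻² ∏ θ(t_r z) has four parameters. If t₁t₂t₃t₄ s^{2(N-1)} = 1 and t₁, t₂
are generic, it preserves these forms (`exists_operator_eq`): on products of linear forms with zeros
adapted to t₁ and t₂ everything telescopes to one instance of the addition formula. Applying it to
every row of the determinant gives `exists_transfer_eq`: the weighted sum of the Vandermonde product
over all 2^N shifts z_k ↦ s^{±1} z_k is a constant times a univariate product times the Vandermonde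
product.

The site x of line t sits at s^{2x+1-t-S} √(v₁v₂) with s = √q, so going to an adjacent line
multiplies by s or s⁻¹, which are the two possible steps of a particle. Forbidden moves cost
nothing: a collision kills the Vandermonde product, and leaving the hexagon kills a univariate
weight. Induction from both ends (`forwardSum_eq`, `backwardSum_eq`) and multiplication give the
marginal with a squared Vandermonde product (`exists_marginal_eq`). The constants are never
computed: Z ≠ 0 makes them nonzero and normalization removes them.

It remains to identify the weights. The marginal weight and the Selberg weight have equal ratios at
consecutive sites (`selbergWeight_succ_mul_marginalWeight`), uniformly in the two cases m = 0 and m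
= t + S - T. For the Delta symbol (`deltaSymbol_eq`) put ξ_i = λ_i + N - i: the C⁰ become Pochhammer
symbols of length ξ_i, and the C^± telescope to univariate and pair factors. The quasi-periodicity
θ(px) = -x⁻¹ θ(x) then turns the pair factors into squares and, with the balancing condition ABCDEF
q^{2N} = q³, produces the power q^{(2N-1)ξ}. -/

noncomputable section

namespace EllipticTilings

open Filter Topology

/-! ### The Jacobi triple product -/

/-- `p^{j(j-1)/2} x^j` -/
def gaussTerm (p x : ℂ) (j : ℤ) : ℂ := p ^ (j * (j - 1) / 2) * x ^ j

lemma two_mul_triangular (j : ℤ) : 2 * (j * (j - 1) / 2) = j * (j - 1) := by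
  apply Int.mul_ediv_cancel'
  rcases Int.even_or_odd j with h | h
  · exact (h.two_dvd).mul_right _
  · exact ((h.sub_odd odd_one).two_dvd).mul_left _

lemma gaussTerm_succ {p x : ℂ} (hp : p ≠ 0) (hx : x ≠ 0) (j : ℤ) :
    gaussTerm p x (j + 1) = p ^ j * x * gaussTerm p x j := by
  have h1 := two_mul_triangular j
  have h2 := two_mul_triangular (j + 1)
  have h : (j + 1) * (j + 1 - 1) / 2 = j + j * (j - 1) / 2 := by
    have : (j + 1) * (j + 1 - 1) = j * (j - 1) + 2 * j := by ring
    omega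
  rw [gaussTerm, gaussTerm, h, zpow_add₀ hp, zpow_add_one₀ hx]
  ring

lemma gaussTerm_ne_zero {p x : ℂ} (hp : p ≠ 0) (hx : x ≠ 0) (j : ℤ) : gaussTerm p x j ≠ 0 :=
  mul_ne_zero (zpow_ne_zero _ hp) (zpow_ne_zero _ hx)

lemma summable_gaussTerm {p x : ℂ} (hp1 : ‖p‖ < 1) (hp : p ≠ 0) (hx : x ≠ 0) :
    Summable (gaussTerm p x) := by
  have key : ∀ c : ℂ, Tendsto (fun n : ℕ => ‖p ^ n * c‖) atTop (𝓝 0) := by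
    intro c
    have := (tendsto_pow_atTop_nhds_zero_of_norm_lt_one hp1).mul_const c
    simpa using this.norm
  apply Summable.of_nat_of_neg
  · refine summable_of_ratio_test_tendsto_lt_one zero_lt_one
      (Eventually.of_forall fun n => gaussTerm_ne_zero hp hx _) ?_
    refine (key x).congr fun n => ?_
    rw [Nat.cast_succ, gaussTerm_succ hp hx, ← norm_div,
      mul_div_cancel_right₀ _ (gaussTerm_ne_zero hp hx _), zpow_natCast]
  · refine summable_of_ratio_test_tendsto_lt_one zero_lt_one
      (Eventually.of_forall fun n => gaussTerm_ne_zero hp hx _) ?_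
    refine (key (p / x)).congr fun n => ?_
    have h := gaussTerm_succ hp hx (-((n + 1 : ℕ) : ℤ))
    have e : -((n + 1 : ℕ) : ℤ) + 1 = -(n : ℤ) := by push_cast; ring
    rw [e] at h
    have h0 := gaussTerm_ne_zero hp hx (-((n + 1 : ℕ) : ℤ))
    rw [← norm_div, h]
    congr 1
    rw [zpow_neg, zpow_natCast]
    field_simp
    rw [pow_succ]

/-- `∏_{1 ≤ i ≤ n} (1 - p^i)` -/
def eulerProd (p : ℂ) (n : ℕ) : ℂ := ∏ i ∈ range n, (1 - p ^ (i + 1))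

/-- `∏_{i ≥ 1} (1 - p^i)` -/
def eulerProdInf (p : ℂ) : ℂ := ∏' i : ℕ, (1 - p ^ (i + 1))

lemma one_sub_pow_ne_zero {p : ℂ} (hp : ‖p‖ < 1) (i : ℕ) : 1 - p ^ (i + 1) ≠ 0 := by
  intro h
  have h1 : p ^ (i + 1) = 1 := (sub_eq_zero.mp h).symm
  have h2 : ‖p‖ ^ (i + 1) = 1 := by rw [← norm_pow, h1, norm_one]
  exact absurd h2 (pow_lt_one₀ (norm_nonneg _) hp (Nat.succ_ne_zero i)).ne

lemma eulerProd_ne_zero {p : ℂ} (hp : ‖p‖ < 1) (n : ℕ) : eulerProd p n ≠ 0 :=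
  prod_ne_zero_iff.mpr fun i _ => one_sub_pow_ne_zero hp i

lemma summable_norm_pow_succ {p : ℂ} (hp : ‖p‖ < 1) : Summable fun i : ℕ => ‖-p ^ (i + 1)‖ := by
  have := (summable_geometric_of_lt_one (norm_nonneg p) hp).mul_left ‖p‖
  refine this.congr fun i => ?_
  rw [norm_neg, norm_pow, pow_succ']

lemma eulerProdInf_ne_zero {p : ℂ} (hp : ‖p‖ < 1) : eulerProdInf p ≠ 0 := by
  have := tprod_one_add_ne_zero_of_summable (f := fun i : ℕ => -p ^ (i + 1))
    (fun i => by simpa [← sub_eq_add_neg] using one_sub_pow_ne_zero hp i)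
    (summable_norm_pow_succ hp)
  simp only [← sub_eq_add_neg] at this
  exact this

lemma tendsto_eulerProd {p : ℂ} (hp : ‖p‖ < 1) :
    Tendsto (eulerProd p) atTop (𝓝 (eulerProdInf p)) := by
  have : Multipliable fun i : ℕ => 1 + -p ^ (i + 1) :=
    Complex.multipliable_one_add_of_summable (summable_norm_pow_succ hp).of_norm
  simp only [← sub_eq_add_neg] at this
  exact this.tendsto_prod_tprod_nat

/-- `1 / ∏_{1 ≤ i ≤ k} (1 - p^i)`, zero for negative `k` -/
def recEuler (p : ℂ) (k : ℤ) : ℂ := if 0 ≤ k then (eulerProd p k.toNat)⁻¹ else 0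

/-- Extending by zero to negative integers makes the recursion valid for every integer, since the
factor 1 - p^k vanishes at k = 0. No boundary cases are then needed in the finite triple product. -/
lemma recEuler_pred {p : ℂ} (hp : ‖p‖ < 1) (k : ℤ) :
    recEuler p (k - 1) = (1 - p ^ k) * recEuler p k := by
  rcases lt_trichotomy k 0 with h | h | h
  · simp [recEuler, not_le.mpr h, show ¬ (1 ≤ k) by omega]
  · subst h; simp [recEuler]
  · obtain ⟨n, rfl⟩ : ∃ n : ℕ, k = n + 1 := ⟨(k - 1).toNat, by omega⟩
    have e : ((n : ℤ) + 1).toNat = n + 1 := by omega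
    have h0 := one_sub_pow_ne_zero hp n
    have h1 := eulerProd_ne_zero hp n
    simp only [recEuler, add_sub_cancel_right, Int.natCast_nonneg, if_true, Int.toNat_natCast, e,
      show (0 : ℤ) ≤ n + 1 by omega]
    rw [eulerProd, eulerProd, prod_range_succ]
    rw [eulerProd] at h1
    have : p ^ ((n : ℤ) + 1) = p ^ (n + 1) := by exact_mod_cast zpow_natCast p (n + 1)
    rw [this]
    field_simp

/-- The inverses of the partial Euler products converge, the limit of the products being nonzero.
This bound feeds the dominated convergence argument. -/
lemma recEuler_bound {p : ℂ} (hp : ‖p‖ < 1) : ∃ M : ℝ, 0 ≤ M ∧ ∀ k, ‖recEuler p k‖ ≤ M := by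
  have h := ((tendsto_eulerProd hp).inv₀ (eulerProdInf_ne_zero hp)).norm
  obtain ⟨M, hM⟩ := h.bddAbove_range
  have hM' : ∀ n, ‖(eulerProd p n)⁻¹‖ ≤ M := fun n => hM ⟨n, rfl⟩
  refine ⟨M, (norm_nonneg _).trans (hM' 0), fun k => ?_⟩
  unfold recEuler
  split_ifs
  · exact hM' _
  · simpa using (norm_nonneg _).trans (hM' 0)

lemma tendsto_recEuler {p : ℂ} (hp : ‖p‖ < 1) {u : ℕ → ℤ} (hu : Tendsto u atTop atTop) :
    Tendsto (fun n => recEuler p (u n)) atTop (𝓝 (eulerProdInf p)⁻¹) := by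
  have hu' : Tendsto (fun n => (u n).toNat) atTop atTop := by
    refine tendsto_atTop.mpr fun b => ?_
    filter_upwards [hu.eventually_ge_atTop (b : ℤ)] with n hn
    omega
  have h := ((tendsto_eulerProd hp).inv₀ (eulerProdInf_ne_zero hp)).comp hu'
  refine h.congr' ?_
  filter_upwards [hu.eventually_ge_atTop 0] with n hn
  simp [recEuler, hn]

/-- The partial products of `theta`. -/
def thetaPartial (p x : ℂ) (n : ℕ) : ℂ :=
  ∏ k ∈ range n, ((1 - p ^ k * x) * (1 - p ^ (k + 1) / x))

lemma multipliable_theta {p : ℂ} (hp : ‖p‖ < 1) (x : ℂ) :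
    Multipliable fun k : ℕ => (1 - p ^ k * x) * (1 - p ^ (k + 1) / x) := by
  have hg := summable_geometric_of_lt_one (norm_nonneg p) hp
  have h1 : Multipliable fun k : ℕ => 1 + -(p ^ k * x) := by
    refine Complex.multipliable_one_add_of_summable (Summable.of_norm ?_)
    refine (hg.mul_right ‖x‖).congr fun k => ?_
    simp
  have h2 : Multipliable fun k : ℕ => 1 + -(p ^ (k + 1) / x) := by
    refine Complex.multipliable_one_add_of_summable (Summable.of_norm ?_)
    refine (hg.mul_right (‖p‖ / ‖x‖)).congr fun k => ?_
    simp [pow_succ]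
    ring
  simpa only [← sub_eq_add_neg] using h1.mul h2

lemma tendsto_thetaPartial {p : ℂ} (hp : ‖p‖ < 1) (x : ℂ) :
    Tendsto (thetaPartial p x) atTop (𝓝 (theta p x)) :=
  (multipliable_theta hp x).tendsto_prod_tprod_nat

/-- The coefficients are Gaussian binomials of 2n over n + j, supported on |j| ≤ n. Writing the
finite expansion as a sum over all of ℤ allows free index shifts in the induction and a termwise
limit afterwards. -/
lemma finite_triple_product {p x : ℂ} (hp1 : ‖p‖ < 1) (hp : p ≠ 0) (hx : x ≠ 0) (n : ℕ) :
    HasSum (fun j : ℤ => eulerProd p (2 * n) * (recEuler p (n - j) * recEuler p (n + j)) *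
      gaussTerm p (-x) j) (thetaPartial p x n) := by
  have hx' : -x ≠ 0 := neg_ne_zero.mpr hx
  induction n with
  | zero =>
    have : thetaPartial p x 0 = eulerProd p (2 * 0) *
        (recEuler p ((0 : ℕ) - 0) * recEuler p ((0 : ℕ) + 0)) * gaussTerm p (-x) 0 := by
      simp [thetaPartial, eulerProd, recEuler, gaussTerm]
    rw [this]
    refine hasSum_single 0 fun j hj => ?_
    rcases lt_or_gt_of_ne hj with h | h
    · simp [recEuler, not_le.mpr h]
    · simp [recEuler, not_le.mpr h]
  | succ n ih =>
    set c : ℤ → ℂ := fun j => eulerProd p (2 * n) * (recEuler p (n - j) * recEuler p (n + j))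
      with hc
    -- The new factor is 1 + p^{2n+1} - p^n x - p^{n+1}/x. Multiplication by x or 1/x is absorbed by
    -- shifting j, so the induction step reduces to a three-term identity between coefficients.
    have ihR := ((Equiv.subRight (1 : ℤ)).hasSum_iff).mpr ih
    have ihL := ((Equiv.addRight (1 : ℤ)).hasSum_iff).mpr ih
    have h := ((ih.mul_left (1 + p ^ (2 * n + 1))).add (ihR.mul_left (-p ^ n * x))).add
      (ihL.mul_left (-p ^ (n + 1) / x))
    have e : thetaPartial p x (n + 1) = (1 + p ^ (2 * n + 1)) * thetaPartial p x n +
        -p ^ n * x * thetaPartial p x n + -p ^ (n + 1) / x * thetaPartial p x n := by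
      rw [thetaPartial, prod_range_succ, ← thetaPartial]
      field_simp
      ring
    rw [e]
    refine h.congr_fun fun j => ?_
    simp only [Function.comp_apply, Equiv.subRight_apply, Equiv.coe_addRight]
    have g1 : gaussTerm p (-x) j = p ^ (j - 1) * (-x) * gaussTerm p (-x) (j - 1) := by
      have := gaussTerm_succ hp hx' (j - 1)
      rwa [sub_add_cancel] at this
    have g2 := gaussTerm_succ hp hx' j
    have g3 : -p ^ n * x * gaussTerm p (-x) (j - 1) =
        p ^ n * p / p ^ j * gaussTerm p (-x) j := by
      rw [g1, zpow_sub_one₀ hp]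
      have := zpow_ne_zero j hp
      field_simp
    have g4 : -p ^ (n + 1) / x * gaussTerm p (-x) (j + 1) =
        p ^ n * p * p ^ j * gaussTerm p (-x) j := by
      rw [g2]
      field_simp
      ring
    set R := recEuler p (n + 1 - j)
    set R' := recEuler p (n + 1 + j)
    have r1 : recEuler p (n - j) = (1 - p ^ n * p / p ^ j) * R := by
      have := recEuler_pred hp1 (n + 1 - j)
      rw [show (n : ℤ) + 1 - j - 1 = n - j by ring, zpow_sub₀ hp, zpow_add_one₀ hp,
        zpow_natCast] at this
      exact this
    have r2 : recEuler p (n + j) = (1 - p ^ n * p * p ^ j) * R' := by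
      have := recEuler_pred hp1 (n + 1 + j)
      rw [show (n : ℤ) + 1 + j - 1 = n + j by ring, zpow_add₀ hp, zpow_add_one₀ hp,
        zpow_natCast] at this
      exact this
    have r3 : recEuler p (n + (j - 1)) = (1 - p ^ n * p ^ j) * recEuler p (n + j) := by
      have := recEuler_pred hp1 (n + j)
      rw [show (n : ℤ) + j - 1 = n + (j - 1) by ring, zpow_add₀ hp, zpow_natCast] at this
      exact this
    have r4 : recEuler p (n - (j + 1)) = (1 - p ^ n / p ^ j) * recEuler p (n - j) := by
      have := recEuler_pred hp1 (n - j)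
      rw [show (n : ℤ) - j - 1 = n - (j + 1) by ring, zpow_sub₀ hp, zpow_natCast] at this
      exact this
    have r5 : recEuler p (n - (j - 1)) = R := by rw [show (n : ℤ) - (j - 1) = n + 1 - j by ring]
    have r6 : recEuler p (n + (j + 1)) = R' := by rw [show (n : ℤ) + (j + 1) = n + 1 + j by ring]
    have r7 : eulerProd p (2 * (n + 1)) =
        eulerProd p (2 * n) * (1 - p ^ n * p ^ n * p) * (1 - p ^ n * p ^ n * p * p) := by
      rw [show 2 * (n + 1) = 2 * n + 1 + 1 by ring, eulerProd, prod_range_succ, prod_range_succ,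
        ← eulerProd]
      ring
    have r8 : ∀ a b d : ℂ, a * (b * d) = b * (a * d) := fun a b d => by ring
    rw [r8 (-p ^ n * x), r8 (-p ^ (n + 1) / x), g3, g4, r3, r4, r5, r6, r1, r2, r7, Nat.cast_succ]
    have := zpow_ne_zero j hp
    generalize p ^ j = w at *
    field_simp
    ring

/-- The Jacobi triple product identity. -/
lemma hasSum_triple_product {p x : ℂ} (hp1 : ‖p‖ < 1) (hp : p ≠ 0) (hx : x ≠ 0) :
    HasSum (gaussTerm p (-x)) (eulerProdInf p * theta p x) := by
  have hs := summable_gaussTerm hp1 hp (neg_ne_zero.mpr hx)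
  have hE := eulerProdInf_ne_zero hp1
  obtain ⟨M, hM0, hM⟩ := recEuler_bound hp1
  obtain ⟨M', hM'⟩ := (tendsto_eulerProd hp1).norm.bddAbove_range
  have hM'n : ∀ n, ‖eulerProd p n‖ ≤ M' := fun n => hM' ⟨n, rfl⟩
  -- Termwise limit of the finite identity: both Euler factors are bounded uniformly in n and j, so
  -- a multiple of the summable Gaussian series dominates.
  have hlim := tendsto_tsum_of_dominated_convergence (𝓕 := atTop)
    (f := fun (n : ℕ) (j : ℤ) => eulerProd p (2 * n) * (recEuler p (n - j) * recEuler p (n + j)) *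
      gaussTerm p (-x) j)
    (g := fun j => (eulerProdInf p)⁻¹ * gaussTerm p (-x) j)
    (bound := fun j => M' * (M * M) * ‖gaussTerm p (-x) j‖) (hs.norm.mul_left _)
    (fun j => by
      have t1 : Tendsto (fun n : ℕ => (n : ℤ) - j) atTop atTop :=
        tendsto_atTop_add_const_right _ (-j) tendsto_natCast_atTop_atTop
      have t2 : Tendsto (fun n : ℕ => (n : ℤ) + j) atTop atTop :=
        tendsto_atTop_add_const_right _ j tendsto_natCast_atTop_atTop
      have t3 : Tendsto (fun n : ℕ => 2 * n) atTop atTop :=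
        tendsto_id.const_mul_atTop' two_pos
      have := (((tendsto_eulerProd hp1).comp t3).mul
        ((tendsto_recEuler hp1 t1).mul (tendsto_recEuler hp1 t2))).mul_const (gaussTerm p (-x) j)
      rw [mul_inv_cancel_left₀ hE] at this
      exact this)
    (Eventually.of_forall fun n j => by
      rw [norm_mul, norm_mul, norm_mul]
      have h0 : 0 ≤ M' := (norm_nonneg _).trans (hM'n 0)
      gcongr
      · exact hM'n _
      · exact hM _
      · exact hM _)
  simp only [(finite_triple_product hp1 hp hx _).tsum_eq] at hlim
  have := tendsto_nhds_unique hlim (tendsto_thetaPartial hp1 x)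
  rw [tsum_mul_left, inv_mul_eq_iff_eq_mul₀ hE] at this
  rw [← this]
  exact hs.hasSum

/-! ### The addition formula -/

/-- `x⁻¹ θ_p(xy) θ_p(x/y)` -/
def thetaKernel (p x y : ℂ) : ℂ := x⁻¹ * (theta p (x * y) * theta p (x / y))

/-- `(a, b) ↦ (a + b, a - b)` and `(a, b) ↦ (a + b + 1, a - b)` together parametrize `ℤ × ℤ`. -/
def parityEquiv : (ℤ × ℤ) ⊕ (ℤ × ℤ) ≃ ℤ × ℤ :=
  Equiv.ofBijective
    (Sum.elim (fun u => (u.1 + u.2, u.1 - u.2)) (fun u => (u.1 + u.2 + 1, u.1 - u.2))) (by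
    constructor
    · rintro (⟨a, b⟩ | ⟨a, b⟩) (⟨c, d⟩ | ⟨c, d⟩) h <;>
        simp only [Sum.elim_inl, Sum.elim_inr, Prod.mk.injEq] at h
      · have h1 : a = c := by omega
        have h2 : b = d := by omega
        rw [h1, h2]
      · omega
      · omega
      · have h1 : a = c := by omega
        have h2 : b = d := by omega
        rw [h1, h2]
    · rintro ⟨m, n⟩
      rcases Int.emod_two_eq_zero_or_one (m + n) with h | h
      · refine ⟨Sum.inl ((m + n) / 2, (m - n) / 2), ?_⟩
        simp only [Sum.elim_inl, Prod.mk.injEq]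
        omega
      · refine ⟨Sum.inr ((m + n - 1) / 2, (m - n - 1) / 2), ?_⟩
        simp only [Sum.elim_inr, Prod.mk.injEq]
        omega)

lemma parityEquiv_inl (u : ℤ × ℤ) : parityEquiv (Sum.inl u) = (u.1 + u.2, u.1 - u.2) := rfl

lemma parityEquiv_inr (u : ℤ × ℤ) : parityEquiv (Sum.inr u) = (u.1 + u.2 + 1, u.1 - u.2) := rfl

lemma gaussTerm_mul_even {p x z : ℂ} (hp : p ≠ 0) (hx : x ≠ 0) (hz : z ≠ 0) (a b : ℤ) :
    gaussTerm p (-(x * z)) (a + b) * gaussTerm p (-(x / z)) (a - b) =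
      gaussTerm (p ^ 2) (x ^ 2) a * gaussTerm (p ^ 2) (p * z ^ 2) b := by
  have h1 := two_mul_triangular (a + b)
  have h2 := two_mul_triangular (a - b)
  have h3 := two_mul_triangular a
  have h4 := two_mul_triangular b
  have hm : (-1 : ℂ) ≠ 0 := by norm_num
  simp only [gaussTerm]
  rw [neg_eq_neg_one_mul (x * z), neg_eq_neg_one_mul (x / z)]
  simp only [mul_zpow, div_zpow, ← zpow_natCast, ← zpow_mul]
  have e1 : (-1 : ℂ) ^ (a + b) * (-1) ^ (a - b) = 1 := by
    rw [← zpow_add₀ hm, show a + b + (a - b) = 2 * a by ring, zpow_mul]; norm_num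
  have e2 : p ^ ((a + b) * (a + b - 1) / 2) * p ^ ((a - b) * (a - b - 1) / 2) =
      p ^ (((2 : ℕ) : ℤ) * (a * (a - 1) / 2)) * (p ^ (((2 : ℕ) : ℤ) * (b * (b - 1) / 2)) * p ^ b) := by
    rw [← zpow_add₀ hp, ← zpow_add₀ hp, ← zpow_add₀ hp]
    congr 1
    have : (a + b) * (a + b - 1) + (a - b) * (a - b - 1) = 2 * (a * (a - 1)) + 2 * (b * (b - 1))
      + 2 * b := by ring
    push_cast
    omega
  have e3 : x ^ (a + b) * x ^ (a - b) = x ^ (((2 : ℕ) : ℤ) * a) := by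
    rw [← zpow_add₀ hx]; congr 1; push_cast; ring
  have e4 : z ^ (a + b) / z ^ (a - b) = z ^ (((2 : ℕ) : ℤ) * b) := by
    rw [← zpow_sub₀ hz]; congr 1; push_cast; ring
  rw [← e3, ← e4]
  calc _ = ((-1 : ℂ) ^ (a + b) * (-1) ^ (a - b)) *
        (p ^ ((a + b) * (a + b - 1) / 2) * p ^ ((a - b) * (a - b - 1) / 2)) *
        (x ^ (a + b) * x ^ (a - b)) * (z ^ (a + b) / z ^ (a - b)) := by ring
    _ = _ := by rw [e1, e2]; ring

lemma gaussTerm_mul_odd {p x z : ℂ} (hp : p ≠ 0) (hx : x ≠ 0) (hz : z ≠ 0) (a b : ℤ) :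
    gaussTerm p (-(x * z)) (a + b + 1) * gaussTerm p (-(x / z)) (a - b) =
      -x * z⁻¹ * (gaussTerm (p ^ 2) (p * x ^ 2) a * gaussTerm (p ^ 2) (z ^ 2) (b + 1)) := by
  have hxz : -(x * z) ≠ 0 := neg_ne_zero.mpr (mul_ne_zero hx hz)
  rw [gaussTerm_succ hp hxz, gaussTerm_succ (pow_ne_zero 2 hp) (pow_ne_zero 2 hz), mul_assoc,
    gaussTerm_mul_even hp hx hz]
  simp only [gaussTerm, mul_zpow, zpow_add₀ hp, pow_two]
  field_simp

/-- Multiply the Jacobi series of θ(xz) and θ(x/z), which involve x^{m+n} z^{m-n}, and split ℤ × ℤ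
by the parity of m + n. On each class the double series factors into a function of x times a
function of z, and the two classes carry the same two functions with exchanged roles and opposite
sign. -/
lemma thetaKernel_eq_of_ne_zero {p : ℂ} (hp1 : ‖p‖ < 1) (hp : p ≠ 0) :
    ∃ α β : ℂ → ℂ, ∀ x z : ℂ, x ≠ 0 → z ≠ 0 →
      thetaKernel p x z = α x * β z - β x * α z := by
  have hE := eulerProdInf_ne_zero hp1
  have hp2 : p ^ 2 ≠ 0 := pow_ne_zero 2 hp
  have hp21 : ‖p ^ 2‖ < 1 := by
    rw [norm_pow]; exact pow_lt_one₀ (norm_nonneg _) hp1 two_ne_zero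
  refine ⟨fun x => (eulerProdInf p)⁻¹ * (x⁻¹ * ∑' a, gaussTerm (p ^ 2) (x ^ 2) a),
    fun x => (eulerProdInf p)⁻¹ * ∑' a, gaussTerm (p ^ 2) (p * x ^ 2) a, fun x z hx hz => ?_⟩
  have s1 : ∀ y : ℂ, y ≠ 0 → Summable (gaussTerm (p ^ 2) (y ^ 2)) := fun y hy =>
    summable_gaussTerm hp21 hp2 (pow_ne_zero 2 hy)
  have s2 : ∀ y : ℂ, y ≠ 0 → Summable (gaussTerm (p ^ 2) (p * y ^ 2)) := fun y hy =>
    summable_gaussTerm hp21 hp2 (mul_ne_zero hp (pow_ne_zero 2 hy))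
  have hxz := hasSum_triple_product hp1 hp (mul_ne_zero hx hz)
  have hxz' := hasSum_triple_product hp1 hp (div_ne_zero hx hz)
  have hprod := tsum_mul_tsum_of_summable_norm hxz.summable.norm hxz'.summable.norm
  rw [hxz.tsum_eq, hxz'.tsum_eq] at hprod
  rw [← parityEquiv.tsum_eq] at hprod
  have hsm : Summable fun u : ℤ × ℤ =>
      gaussTerm p (-(x * z)) u.1 * gaussTerm p (-(x / z)) u.2 :=
    summable_mul_of_summable_norm hxz.summable.norm hxz'.summable.norm
  have hsm' : Summable fun c => gaussTerm p (-(x * z)) (parityEquiv c).1 *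
      gaussTerm p (-(x / z)) (parityEquiv c).2 := parityEquiv.summable_iff.mpr hsm
  rw [Summable.tsum_sum (hsm'.comp_injective Sum.inl_injective)
    (hsm'.comp_injective Sum.inr_injective)] at hprod
  have t1 : ∑' u : ℤ × ℤ, gaussTerm p (-(x * z)) (parityEquiv (Sum.inl u)).1 *
      gaussTerm p (-(x / z)) (parityEquiv (Sum.inl u)).2 =
      (∑' a, gaussTerm (p ^ 2) (x ^ 2) a) * ∑' b, gaussTerm (p ^ 2) (p * z ^ 2) b := by
    rw [tsum_mul_tsum_of_summable_norm (s1 x hx).norm (s2 z hz).norm]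
    refine tsum_congr fun u => ?_
    rw [parityEquiv_inl]
    exact gaussTerm_mul_even hp hx hz u.1 u.2
  have t2 : ∑' u : ℤ × ℤ, gaussTerm p (-(x * z)) (parityEquiv (Sum.inr u)).1 *
      gaussTerm p (-(x / z)) (parityEquiv (Sum.inr u)).2 =
      -x * z⁻¹ * ((∑' a, gaussTerm (p ^ 2) (p * x ^ 2) a) * ∑' b, gaussTerm (p ^ 2) (z ^ 2) b) := by
    have hs : Summable fun b => gaussTerm (p ^ 2) (z ^ 2) (b + 1) :=
      (s1 z hz).comp_injective (add_left_injective (1 : ℤ))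
    have hsum : ∑' b, gaussTerm (p ^ 2) (z ^ 2) b = ∑' b, gaussTerm (p ^ 2) (z ^ 2) (b + 1) :=
      ((Equiv.addRight (1 : ℤ)).tsum_eq (gaussTerm (p ^ 2) (z ^ 2))).symm
    rw [hsum, tsum_mul_tsum_of_summable_norm (s2 x hx).norm hs.norm, ← tsum_mul_left]
    refine tsum_congr fun u => ?_
    have := gaussTerm_mul_odd hp hx hz u.1 u.2
    rw [parityEquiv_inr]
    simpa only using this
  rw [t1, t2] at hprod
  rw [thetaKernel]
  have : theta p (x * z) * theta p (x / z) = (eulerProdInf p)⁻¹ * (eulerProdInf p)⁻¹ *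
      (eulerProdInf p * theta p (x * z) * (eulerProdInf p * theta p (x / z))) := by
    field_simp
  rw [this, hprod]
  field_simp
  ring

lemma theta_zero_left (x : ℂ) : theta 0 x = 1 - x := by
  rw [theta, tprod_eq_mulSingle 0]
  · simp
  · intro k hk; simp [hk]

/-- For p = 0 the Laurent series argument is unavailable, but there K(x, z) = (x + x⁻¹) - (z + z⁻¹)
has rank two by inspection. -/
lemma exists_thetaKernel_eq {p : ℂ} (hp1 : ‖p‖ < 1) :
    ∃ α β : ℂ → ℂ, ∀ x z : ℂ, x ≠ 0 → z ≠ 0 →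
      thetaKernel p x z = α x * β z - β x * α z := by
  by_cases hp : p = 0
  · subst hp
    refine ⟨fun x => x + x⁻¹, fun _ => 1, fun x z hx hz => ?_⟩
    simp only [thetaKernel, theta_zero_left]
    field_simp
    ring
  · exact thetaKernel_eq_of_ne_zero hp1 hp

lemma theta_one {p : ℂ} (hp1 : ‖p‖ < 1) : theta p 1 = 0 := by
  refine tendsto_nhds_unique (tendsto_thetaPartial hp1 1) ?_
  refine tendsto_const_nhds.congr' ?_
  filter_upwards [eventually_ge_atTop 1] with n hn
  exact (prod_eq_zero (mem_range.mpr hn) (by simp)).symm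

/-- The partial products at x and x⁻¹ differ only in their two extreme factors. In the limit this
leaves (1 - x) θ(x⁻¹) = (1 - x⁻¹) θ(x), and the point x = 1, where nothing can be cancelled, is a
zero of θ. -/
lemma theta_inv {p x : ℂ} (hp1 : ‖p‖ < 1) (hx : x ≠ 0) : theta p x⁻¹ = -x⁻¹ * theta p x := by
  by_cases h1 : x = 1
  · subst h1; simp [theta_one hp1]
  have key : ∀ n, thetaPartial p x⁻¹ n * ((1 - x) * (1 - p ^ n / x)) =
      thetaPartial p x n * ((1 - x⁻¹) * (1 - p ^ n * x)) := by
    intro n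
    induction n with
    | zero => simp [thetaPartial]; ring
    | succ n ih =>
      simp only [thetaPartial, prod_range_succ, div_inv_eq_mul, ← div_eq_mul_inv] at ih ⊢
      linear_combination (1 - p ^ (n + 1) * x) * (1 - p ^ (n + 1) / x) * ih
  have hpow := tendsto_pow_atTop_nhds_zero_of_norm_lt_one hp1
  have l1 := (tendsto_thetaPartial hp1 x⁻¹).mul
    ((tendsto_const_nhds (x := 1 - x)).mul ((tendsto_const_nhds (x := (1 : ℂ))).sub
      (hpow.div_const x)))
  have l2 := (tendsto_thetaPartial hp1 x).mul
    ((tendsto_const_nhds (x := 1 - x⁻¹)).mul ((tendsto_const_nhds (x := (1 : ℂ))).sub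
      (hpow.mul_const x)))
  have := tendsto_nhds_unique (l1.congr key) l2
  have hx1 : 1 - x ≠ 0 := sub_ne_zero.mpr (Ne.symm h1)
  simp only [zero_div, zero_mul, sub_zero, mul_one] at this
  apply mul_right_cancel₀ hx1
  rw [this]
  field_simp
  ring

/-- The k-th factor of θ(px) is that of θ(x⁻¹) with its two halves exchanged. -/
lemma theta_p_mul {p x : ℂ} (hp1 : ‖p‖ < 1) (hp : p ≠ 0) (hx : x ≠ 0) :
    theta p (p * x) = -x⁻¹ * theta p x := by
  rw [← theta_inv hp1 hx, theta, theta]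
  refine tprod_congr fun k => ?_
  rw [div_inv_eq_mul, mul_comm, pow_succ, mul_assoc]
  congr 2
  field_simp

end EllipticTilings

/-! ### The addition formula and its four-parameter consequence -/

namespace EllipticTilings

/-- `x⁻¹ θ_p(x²)`, an odd function for the multiplicative structure -/
def oddTheta (p x : ℂ) : ℂ := x⁻¹ * theta p (x ^ 2)

lemma oddTheta_inv {p x : ℂ} (hp1 : ‖p‖ < 1) (hx : x ≠ 0) :
    oddTheta p x⁻¹ = -oddTheta p x := by
  rw [oddTheta, oddTheta, inv_pow, theta_inv hp1 (pow_ne_zero 2 hx)]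
  field_simp

lemma theta_div_comm {p x y : ℂ} (hp1 : ‖p‖ < 1) (hx : x ≠ 0) (hy : y ≠ 0) :
    theta p (x / y) = -(x / y) * theta p (y / x) := by
  rw [← inv_div y x, theta_inv hp1 (div_ne_zero hy hx)]

/-- This evenness lets every computation with the shift z ↦ s⁻¹z be deduced from the one with z ↦ sz
by inverting z. -/
lemma thetaKernel_inv_left {p x y : ℂ} (hp1 : ‖p‖ < 1) (hx : x ≠ 0) (hy : y ≠ 0) :
    thetaKernel p x⁻¹ y = thetaKernel p x y := by
  rw [thetaKernel, thetaKernel, inv_inv, show x⁻¹ * y = y / x by field_simp,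
    show x⁻¹ / y = (x * y)⁻¹ by field_simp, theta_inv hp1 (mul_ne_zero hx hy),
    theta_div_comm hp1 hy hx]
  field_simp

/-- Weierstrass' addition formula. -/
lemma thetaKernel_addition {p : ℂ} (hp1 : ‖p‖ < 1) {x y u v : ℂ} (hx : x ≠ 0) (hy : y ≠ 0)
    (hu : u ≠ 0) (hv : v ≠ 0) :
    thetaKernel p x y * thetaKernel p u v - thetaKernel p x u * thetaKernel p y v +
      thetaKernel p x v * thetaKernel p y u = 0 := by
  obtain ⟨α, β, h⟩ := exists_thetaKernel_eq hp1
  -- With the rank-two form of the kernel this is the Plücker relation between the minors of a 2 × 4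
  -- matrix.
  rw [h x y hx hy, h u v hu hv, h x u hx hu, h y v hy hv, h x v hx hv, h y u hy hu]
  ring

/-- `z⁻² ∏_r θ_p(t_r z)` for four parameters `t_r` -/
def fourTheta (p a b c d z : ℂ) : ℂ :=
  (z ^ 2)⁻¹ * (theta p (a * z) * theta p (b * z) * theta p (c * z) * theta p (d * z))

/-- This is the addition formula at the points rz, a/r, z/r, cr with r² = ab. When abcd = 1 its
three terms are the four-theta product at z, the one at z⁻¹, and the odd function of z times the
constant r⁻¹ θ(ab) K(a/r, cr). -/
lemma exists_fourTheta_sub {p a b c d : ℂ} (hp1 : ‖p‖ < 1) (ha : a ≠ 0) (hb : b ≠ 0) (hc : c ≠ 0)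
    (hd : d ≠ 0) (h : a * b * c * d = 1) :
    ∃ κ : ℂ, ∀ z : ℂ, z ≠ 0 →
      fourTheta p a b c d z - fourTheta p a b c d z⁻¹ = κ * oddTheta p z := by
  obtain ⟨r, hr⟩ := IsAlgClosed.exists_pow_nat_eq (a * b) two_pos
  have hr0 : r ≠ 0 := by
    rintro rfl
    exact mul_ne_zero ha hb (by simpa using hr.symm)
  have hdd : d = (a * b * c)⁻¹ := eq_inv_of_mul_eq_one_right h
  refine ⟨r⁻¹ * theta p (a * b) * thetaKernel p (a / r) (c * r), fun z hz => ?_⟩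
  have key := thetaKernel_addition hp1 (mul_ne_zero hr0 hz) (div_ne_zero ha hr0)
    (div_ne_zero hz hr0) (mul_ne_zero hc hr0)
  have k1 : thetaKernel p (r * z) (a / r) = (r * z)⁻¹ * (theta p (a * z) * theta p (b * z)) := by
    rw [thetaKernel, show r * z * (a / r) = a * z by field_simp,
      show r * z / (a / r) = b * z by field_simp; rw [hr]]
  have k2 : thetaKernel p (z / r) (c * r) = r / z * (theta p (c * z) * theta p (d * z)) := by
    rw [thetaKernel, show z / r * (c * r) = c * z by field_simp,
      show z / r / (c * r) = d * z by rw [hdd, ← hr]; field_simp, inv_div]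
  have k3 : thetaKernel p (r * z) (z / r) = r⁻¹ * theta p (a * b) * oddTheta p z := by
    rw [thetaKernel, oddTheta, show r * z * (z / r) = z ^ 2 by field_simp,
      show r * z / (z / r) = a * b by rw [← hr]; field_simp]
    field_simp
  have k4 : thetaKernel p (r * z) (c * r) = (r * z)⁻¹ *
      ((-(z / d) * theta p (d / z)) * (-(z / c) * theta p (c / z))) := by
    rw [thetaKernel, show r * z * (c * r) = z / d by rw [hdd, ← hr]; field_simp,
      show r * z / (c * r) = z / c by field_simp, theta_div_comm hp1 hz hd,
      theta_div_comm hp1 hz hc]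
  have k5 : thetaKernel p (a / r) (z / r) = r / a *
      ((-(z / b) * theta p (b / z)) * theta p (a / z)) := by
    rw [thetaKernel, show a / r * (z / r) = z / b by field_simp; rw [hr],
      show a / r / (z / r) = a / z by field_simp, theta_div_comm hp1 hz hb, inv_div]
  rw [k1, k2, k3, k4, k5] at key
  have e : ∀ x : ℂ, x * z⁻¹ = x / z := fun x => rfl
  simp only [fourTheta, e, inv_pow, inv_inv]
  have h4 : (r * z)⁻¹ * (-(z / d) * theta p (d / z) * (-(z / c) * theta p (c / z))) *
      (r / a * (-(z / b) * theta p (b / z) * theta p (a / z))) =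
      -(z ^ 2 * (theta p (a / z) * theta p (b / z) * theta p (c / z) * theta p (d / z))) *
        (a * b * c * d)⁻¹ := by
    field_simp
  have h5 : (r * z)⁻¹ * (theta p (a * z) * theta p (b * z)) *
      (r / z * (theta p (c * z) * theta p (d * z))) =
      (z ^ 2)⁻¹ * (theta p (a * z) * theta p (b * z) * theta p (c * z) * theta p (d * z)) := by
    field_simp
  rw [h4, h5, h, inv_one, mul_one] at key
  linear_combination key

/-! ### Binary forms in two functions -/

section Forms

variable (α β : ℂ → ℂ)

/-- The monomials of degree `n - 1` in the functions `α, β`. -/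
def formMonomial (n : ℕ) (m : Fin n) : ℂ → ℂ := fun z => β z ^ (m : ℕ) * α z ^ (m.rev : ℕ)

/-- The space of forms of degree `n - 1` in the functions `α, β`. -/
def formSpace (n : ℕ) : Submodule ℂ (ℂ → ℂ) := Submodule.span ℂ (Set.range (formMonomial α β n))

/-- The linear form in `α, β` vanishing at `c`. -/
def linForm (c : ℂ) : ℂ → ℂ := fun z => α z * β c - β z * α c

variable {α β}

lemma mul_left_mem_formSpace {n : ℕ} {f : ℂ → ℂ} (hf : f ∈ formSpace α β n) :
    α * f ∈ formSpace α β (n + 1) := by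
  induction hf using Submodule.span_induction with
  | mem f hf =>
    obtain ⟨m, rfl⟩ := hf
    refine Submodule.subset_span ⟨m.castSucc, ?_⟩
    funext z
    simp only [formMonomial, Pi.mul_apply, Fin.val_castSucc, Fin.rev_castSucc, Fin.val_succ]
    ring
  | zero => simp
  | add f g _ _ hf hg => rw [mul_add]; exact add_mem hf hg
  | smul c f _ hf => rw [mul_smul_comm]; exact Submodule.smul_mem _ _ hf

lemma mul_right_mem_formSpace {n : ℕ} {f : ℂ → ℂ} (hf : f ∈ formSpace α β n) :
    β * f ∈ formSpace α β (n + 1) := by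
  induction hf using Submodule.span_induction with
  | mem f hf =>
    obtain ⟨m, rfl⟩ := hf
    refine Submodule.subset_span ⟨m.succ, ?_⟩
    funext z
    simp only [formMonomial, Pi.mul_apply, Fin.val_castSucc, Fin.rev_succ, Fin.val_succ]
    ring
  | zero => simp
  | add f g _ _ hf hg => rw [mul_add]; exact add_mem hf hg
  | smul c f _ hf => rw [mul_smul_comm]; exact Submodule.smul_mem _ _ hf

lemma linForm_eq (c : ℂ) : linForm α β c = β c • α - α c • β := by
  funext z
  simp only [linForm, Pi.sub_apply, Pi.smul_apply, smul_eq_mul]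
  ring

lemma linForm_mul_mem_formSpace {n : ℕ} {f : ℂ → ℂ} (hf : f ∈ formSpace α β n) (c : ℂ) :
    linForm α β c * f ∈ formSpace α β (n + 1) := by
  rw [linForm_eq, sub_mul, smul_mul_assoc, smul_mul_assoc]
  exact sub_mem (Submodule.smul_mem _ _ (mul_left_mem_formSpace hf))
    (Submodule.smul_mem _ _ (mul_right_mem_formSpace hf))

lemma one_mem_formSpace : (1 : ℂ → ℂ) ∈ formSpace α β 1 :=
  Submodule.subset_span ⟨0, by funext z; simp [formMonomial]⟩

lemma prod_linForm_mul_mem_formSpace (u : ℕ → ℂ) {n : ℕ} {f : ℂ → ℂ} (hf : f ∈ formSpace α β n)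
    (j : ℕ) : (∏ i ∈ range j, linForm α β (u i)) * f ∈ formSpace α β (n + j) := by
  induction j with
  | zero => simpa using hf
  | succ j ih =>
    rw [prod_range_succ, mul_comm (∏ i ∈ range j, _), mul_assoc]
    exact linForm_mul_mem_formSpace ih _

variable (α β) in
/-- `∏_{i<j} ℓ(u_i) ∏_{i<n-j} ℓ(w_i)` -/
def mixedForm (u w : ℕ → ℂ) (n j : ℕ) : ℂ → ℂ :=
  (∏ i ∈ range j, linForm α β (u i)) * ∏ i ∈ range (n - j), linForm α β (w i)

lemma mixedForm_mem_formSpace (u w : ℕ → ℂ) {n j : ℕ} (hj : j ≤ n) :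
    mixedForm α β u w n j ∈ formSpace α β (n + 1) := by
  have h := prod_linForm_mul_mem_formSpace w (one_mem_formSpace (α := α) (β := β)) (n - j)
  have h' := prod_linForm_mul_mem_formSpace u h j
  rw [mul_one] at h'
  rwa [show 1 + (n - j) + j = n + 1 by omega] at h'

/-- Multiplying the j-th mixed form of degree n by the linear form at u_j or at w_{n-j} gives a
mixed form of degree n + 1. If the two linear forms are independent, α and β are combinations of
them, so α and β times every mixed form lie in the new span. Only pairs with i + j below the degree
are ever compared. -/
lemma formSpace_le_span_mixedForm (u w : ℕ → ℂ) (n : ℕ)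
    (h : ∀ i j, i + j < n → α (u i) * β (w j) - β (u i) * α (w j) ≠ 0) :
    formSpace α β (n + 1) ≤ Submodule.span ℂ {f | ∃ j ≤ n, f = mixedForm α β u w n j} := by
  induction n with
  | zero =>
    refine Submodule.span_le.mpr ?_
    rintro _ ⟨m, rfl⟩
    refine Submodule.subset_span ⟨0, le_rfl, ?_⟩
    funext z
    simp [formMonomial, mixedForm]
  | succ n ih =>
    have ih' := ih fun i j hij => h i j (by omega)
    set W := Submodule.span ℂ {f | ∃ j ≤ n + 1, f = mixedForm α β u w (n + 1) j} with hW
    have key : ∀ f ∈ formSpace α β (n + 1), α * f ∈ W ∧ β * f ∈ W := by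
      intro f hf
      have hf' := ih' hf
      clear hf
      induction hf' using Submodule.span_induction with
      | mem f hf =>
        obtain ⟨j, hj, rfl⟩ := hf
        -- This is the determinant of the linear forms at u_j and w_{n-j}. Its inverse expresses α
        -- and β through them by Cramer's rule.
        have hne := h j (n - j) (by omega)
        set κ := α (u j) * β (w (n - j)) - β (u j) * α (w (n - j)) with hκ
        have e1 : mixedForm α β u w (n + 1) (j + 1) = linForm α β (u j) * mixedForm α β u w n j := by
          rw [mixedForm, mixedForm, prod_range_succ, show n + 1 - (j + 1) = n - j by omega]
          ring
        have e2 : mixedForm α β u w (n + 1) j =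
            linForm α β (w (n - j)) * mixedForm α β u w n j := by
          rw [mixedForm, mixedForm, show n + 1 - j = n - j + 1 by omega, prod_range_succ]
          ring
        have m1 : linForm α β (u j) * mixedForm α β u w n j ∈ W :=
          e1 ▸ Submodule.subset_span ⟨j + 1, by omega, rfl⟩
        have m2 : linForm α β (w (n - j)) * mixedForm α β u w n j ∈ W :=
          e2 ▸ Submodule.subset_span ⟨j, by omega, rfl⟩
        constructor
        · have : α * mixedForm α β u w n j = κ⁻¹ •
              (α (u j) • (linForm α β (w (n - j)) * mixedForm α β u w n j) -
                α (w (n - j)) • (linForm α β (u j) * mixedForm α β u w n j)) := by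
            rw [eq_inv_smul_iff₀ hne]
            funext z
            simp only [linForm, Pi.sub_apply, Pi.smul_apply, smul_eq_mul, Pi.mul_apply, hκ]
            ring
          rw [this]
          exact Submodule.smul_mem _ _ (sub_mem (Submodule.smul_mem _ _ m2)
            (Submodule.smul_mem _ _ m1))
        · have : β * mixedForm α β u w n j = κ⁻¹ •
              (β (u j) • (linForm α β (w (n - j)) * mixedForm α β u w n j) -
                β (w (n - j)) • (linForm α β (u j) * mixedForm α β u w n j)) := by
            rw [eq_inv_smul_iff₀ hne]
            funext z
            simp only [linForm, Pi.sub_apply, Pi.smul_apply, smul_eq_mul, Pi.mul_apply, hκ]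
            ring
          rw [this]
          exact Submodule.smul_mem _ _ (sub_mem (Submodule.smul_mem _ _ m2)
            (Submodule.smul_mem _ _ m1))
      | zero => simp
      | add f g _ _ hf hg =>
        rw [mul_add, mul_add]
        exact ⟨add_mem hf.1 hg.1, add_mem hf.2 hg.2⟩
      | smul c f _ hf =>
        rw [mul_smul_comm, mul_smul_comm]
        exact ⟨Submodule.smul_mem _ _ hf.1, Submodule.smul_mem _ _ hf.2⟩
    refine Submodule.span_le.mpr ?_
    rintro _ ⟨m, rfl⟩
    refine Fin.cases ?_ (fun m => ?_) m
    · have := (key _ (Submodule.subset_span ⟨0, rfl⟩)).1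
      rw [SetLike.mem_coe]
      convert this using 1
      funext z
      simp [formMonomial, pow_succ']
    · have := (key _ (Submodule.subset_span ⟨m, rfl⟩)).2
      rw [SetLike.mem_coe]
      convert this using 1
      funext z
      simp [formMonomial, pow_succ', mul_assoc]

end Forms

/-! ### The difference operator -/

section Operator

variable {p s : ℂ}

/-- With nodes s t s^{2i}, the shift z ↦ sz leaves every θ(z/·) factor of the kernels in place and
moves every θ(z·) factor one node further. The prefactor θ(tz) fills the gap at the start, and θ(t
s^{2j} z) is left over at the end. -/
lemma theta_mul_prod_thetaKernel (hs : s ≠ 0) (t : ℂ) {z : ℂ} (hz : z ≠ 0) (ht : t ≠ 0) (j : ℕ) :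
    theta p (t * z) * ∏ i ∈ range j, thetaKernel p (s * z) (s * t * (s ^ 2) ^ i) =
      (s⁻¹) ^ j * theta p (t * (s ^ 2) ^ j * z) * ∏ i ∈ range j, thetaKernel p z (t * (s ^ 2) ^ i) := by
  induction j with
  | zero => simp
  | succ j ih =>
    rw [prod_range_succ, ← mul_assoc, ih, prod_range_succ]
    have : thetaKernel p (s * z) (s * t * (s ^ 2) ^ j) * theta p (t * (s ^ 2) ^ j * z) =
        s⁻¹ * theta p (t * (s ^ 2) ^ (j + 1) * z) * thetaKernel p z (t * (s ^ 2) ^ j) := by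
      rw [thetaKernel, thetaKernel,
        show s * z * (s * t * (s ^ 2) ^ j) = t * (s ^ 2) ^ (j + 1) * z by ring,
        show s * z / (s * t * (s ^ 2) ^ j) = z / (t * (s ^ 2) ^ j) by field_simp,
        show z * (t * (s ^ 2) ^ j) = t * (s ^ 2) ^ j * z by ring]
      field_simp
    rw [pow_succ (s⁻¹)]
    linear_combination ((s⁻¹) ^ j * ∏ i ∈ range j, thetaKernel p z (t * (s ^ 2) ^ i)) * this

lemma theta_inv_mul_prod_thetaKernel (hp1 : ‖p‖ < 1) (hs : s ≠ 0) (t : ℂ) {z : ℂ} (hz : z ≠ 0)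
    (ht : t ≠ 0) (j : ℕ) :
    theta p (t * z⁻¹) * ∏ i ∈ range j, thetaKernel p (s⁻¹ * z) (s * t * (s ^ 2) ^ i) =
      (s⁻¹) ^ j * theta p (t * (s ^ 2) ^ j * z⁻¹) *
        ∏ i ∈ range j, thetaKernel p z (t * (s ^ 2) ^ i) := by
  have h := theta_mul_prod_thetaKernel (p := p) hs t (inv_ne_zero hz) ht j
  have e1 : ∀ i, thetaKernel p (s * z⁻¹) (s * t * (s ^ 2) ^ i) =
      thetaKernel p (s⁻¹ * z) (s * t * (s ^ 2) ^ i) := fun i => by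
    rw [← thetaKernel_inv_left hp1 (mul_ne_zero (inv_ne_zero hs) hz) (by positivity),
      mul_inv, inv_inv]
  have e2 : ∀ i, thetaKernel p z⁻¹ (t * (s ^ 2) ^ i) = thetaKernel p z (t * (s ^ 2) ^ i) := fun i =>
    thetaKernel_inv_left hp1 hz (by positivity)
  simpa only [e1, e2] using h

/-- It suffices to treat the mixed forms with nodes s t₁ s^{2i} and s t₂ s^{2i}. There the
telescoping replaces t₁, t₂ by t₁ s^{2j}, t₂ s^{2(n-j)}, and the balancing condition is exactly what
`exists_fourTheta_sub` needs for the new parameters. The result is stated without dividing by the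
odd theta function, which may vanish. -/
lemma exists_operator_eq (hp1 : ‖p‖ < 1) (hs : s ≠ 0) {α β : ℂ → ℂ}
    (hK : ∀ x z : ℂ, x ≠ 0 → z ≠ 0 → thetaKernel p x z = α x * β z - β x * α z)
    {t₁ t₂ t₃ t₄ : ℂ} (h1 : t₁ ≠ 0) (h2 : t₂ ≠ 0) (h3 : t₃ ≠ 0) (h4 : t₄ ≠ 0) (n : ℕ)
    (hbal : t₁ * t₂ * t₃ * t₄ * (s ^ 2) ^ n = 1)
    (hgen : ∀ i j, i + j < n → thetaKernel p (s * t₁ * (s ^ 2) ^ i) (s * t₂ * (s ^ 2) ^ j) ≠ 0)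
    {f : ℂ → ℂ} (hf : f ∈ formSpace α β (n + 1)) :
    ∃ g ∈ formSpace α β (n + 1), ∀ z : ℂ, z ≠ 0 →
      fourTheta p t₁ t₂ t₃ t₄ z * f (s * z) - fourTheta p t₁ t₂ t₃ t₄ z⁻¹ * f (s⁻¹ * z) =
        oddTheta p z * g z := by
  have hsp := formSpace_le_span_mixedForm (α := α) (β := β) (fun i => s * t₁ * (s ^ 2) ^ i)
    (fun i => s * t₂ * (s ^ 2) ^ i) n
    (fun i j hij => by
      rw [← hK _ _ (by positivity) (by positivity)]
      exact hgen i j hij) hf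
  clear hf
  induction hsp using Submodule.span_induction with
  | mem f hf =>
    obtain ⟨j, hj, rfl⟩ := hf
    obtain ⟨κ, hκ⟩ := exists_fourTheta_sub (a := t₁ * (s ^ 2) ^ j) (b := t₂ * (s ^ 2) ^ (n - j))
      (c := t₃) (d := t₄) hp1 (by positivity) (by positivity) h3 h4 (by
        rw [← hbal, ← Nat.add_sub_cancel' hj, pow_add, Nat.add_sub_cancel_left]
        ring)
    -- The image of a mixed form is a multiple of the mixed form with nodes divided by s. The powers
    -- of s⁻¹ come from the two telescoping products.
    refine ⟨((s⁻¹) ^ j * (s⁻¹) ^ (n - j) * κ) •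
      mixedForm α β (fun i => t₁ * (s ^ 2) ^ i) (fun i => t₂ * (s ^ 2) ^ i) n j,
      Submodule.smul_mem _ _ (mixedForm_mem_formSpace _ _ hj), fun z hz => ?_⟩
    have eval : ∀ (x a b : ℂ), x ≠ 0 → a ≠ 0 → b ≠ 0 →
        mixedForm α β (fun i => a * (s ^ 2) ^ i) (fun i => b * (s ^ 2) ^ i) n j x =
        (∏ i ∈ range j, thetaKernel p x (a * (s ^ 2) ^ i)) *
          ∏ i ∈ range (n - j), thetaKernel p x (b * (s ^ 2) ^ i) := by
      intro x a b hx ha hb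
      simp only [mixedForm, Pi.mul_apply, Finset.prod_apply, linForm]
      congr 1 <;> exact prod_congr rfl fun i _ => (hK _ _ hx (by positivity)).symm
    rw [eval _ _ _ (mul_ne_zero hs hz) (mul_ne_zero hs h1) (mul_ne_zero hs h2),
      eval _ _ _ (mul_ne_zero (inv_ne_zero hs) hz) (mul_ne_zero hs h1) (mul_ne_zero hs h2),
      Pi.smul_apply, eval _ _ _ hz h1 h2, smul_eq_mul]
    have a1 := theta_mul_prod_thetaKernel (p := p) hs t₁ hz h1 j
    have a2 := theta_mul_prod_thetaKernel (p := p) hs t₂ hz h2 (n - j)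
    have b1 := theta_inv_mul_prod_thetaKernel hp1 hs t₁ hz h1 j
    have b2 := theta_inv_mul_prod_thetaKernel hp1 hs t₂ hz h2 (n - j)
    have hk := hκ z hz
    simp only [fourTheta] at hk ⊢
    set Q₁ := ∏ i ∈ range j, thetaKernel p z (t₁ * (s ^ 2) ^ i)
    set Q₂ := ∏ i ∈ range (n - j), thetaKernel p z (t₂ * (s ^ 2) ^ i)
    set R₁ := ∏ i ∈ range j, thetaKernel p (s * z) (s * t₁ * (s ^ 2) ^ i)
    set R₂ := ∏ i ∈ range (n - j), thetaKernel p (s * z) (s * t₂ * (s ^ 2) ^ i)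
    set S₁ := ∏ i ∈ range j, thetaKernel p (s⁻¹ * z) (s * t₁ * (s ^ 2) ^ i)
    set S₂ := ∏ i ∈ range (n - j), thetaKernel p (s⁻¹ * z) (s * t₂ * (s ^ 2) ^ i)
    calc _ = (z ^ 2)⁻¹ * ((theta p (t₁ * z) * R₁) * (theta p (t₂ * z) * R₂) *
            theta p (t₃ * z) * theta p (t₄ * z)) -
          (z⁻¹ ^ 2)⁻¹ * ((theta p (t₁ * z⁻¹) * S₁) * (theta p (t₂ * z⁻¹) * S₂) *
            theta p (t₃ * z⁻¹) * theta p (t₄ * z⁻¹)) := by ring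
      _ = _ := by
        rw [a1, a2, b1, b2]
        linear_combination ((s⁻¹) ^ j * (s⁻¹) ^ (n - j) * Q₁ * Q₂) * hk
  | zero => exact ⟨0, zero_mem _, fun z _ => by simp⟩
  | add f f' _ _ hf hf' =>
    obtain ⟨g, hg, e⟩ := hf
    obtain ⟨g', hg', e'⟩ := hf'
    refine ⟨g + g', add_mem hg hg', fun z hz => ?_⟩
    simp only [Pi.add_apply]
    linear_combination e z hz + e' z hz
  | smul c f _ hf =>
    obtain ⟨g, hg, e⟩ := hf
    refine ⟨c • g, Submodule.smul_mem _ _ hg, fun z hz => ?_⟩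
    simp only [Pi.smul_apply, smul_eq_mul]
    linear_combination c * e z hz

lemma det_sum_rows {N : ℕ} {κ : Type*} [Fintype κ] [DecidableEq κ] (h : Fin N → κ → ℂ)
    (M : Fin N → κ → Fin N → ℂ) :
    (Matrix.of fun k m => ∑ b, h k b * M k b m).det =
      ∑ e : Fin N → κ, (∏ k, h k (e k)) * (Matrix.of fun k m => M k (e k) m).det := by
  have h1 : (Matrix.of fun k m => ∑ b, h k b * M k b m).det =
      Matrix.detRowAlternating (n := Fin N) (R := ℂ) fun k => ∑ b, h k b • M k b := by
    change Matrix.det _ = Matrix.det _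
    congr 1
    funext k m
    simp
  rw [h1]
  have h2 := (Matrix.detRowAlternating (n := Fin N) (R := ℂ)).toMultilinearMap.map_sum
    (fun k b => h k b • M k b)
  refine h2.trans (sum_congr rfl fun e _ => ?_)
  exact (Matrix.detRowAlternating (n := Fin N) (R := ℂ)).toMultilinearMap.map_smul_univ
    (fun k => h k (e k)) (fun k => M k (e k))

/-- `s z` or `s⁻¹ z` -/
def shiftBy (s : ℂ) (b : Bool) (z : ℂ) : ℂ := if b then s⁻¹ * z else s * z

lemma shiftBy_ne_zero (hs : s ≠ 0) (b : Bool) {z : ℂ} (hz : z ≠ 0) : shiftBy s b z ≠ 0 := by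
  cases b <;> simp [shiftBy, hs, hz]

/-- The elliptic Vandermonde product. -/
def kernelVandermonde (p : ℂ) {N : ℕ} (z : Fin N → ℂ) : ℂ :=
  ∏ k, ∏ l ∈ Ioi k, thetaKernel p (z k) (z l)

/-- The Vandermonde product is a determinant in the monomial forms. By multilinearity the sum over
all shifts is the determinant whose k-th row is the operator applied at z_k, and invariance of the
form space factors the matrix as (diagonal) × (Vandermonde) × (matrix of the operator). The constant
c is the last determinant, possibly zero but independent of the points z_k and the factors U_k. -/
lemma exists_transfer_eq (hp1 : ‖p‖ < 1) (hs : s ≠ 0) {t₁ t₂ t₃ t₄ : ℂ} (h1 : t₁ ≠ 0)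
    (h2 : t₂ ≠ 0) (h3 : t₃ ≠ 0) (h4 : t₄ ≠ 0) (N : ℕ)
    (hbal : t₁ * t₂ * t₃ * t₄ * (s ^ 2) ^ ((N : ℤ) - 1) = 1)
    (hgen : ∀ i j, i + j + 2 ≤ N →
      thetaKernel p (s * t₁ * (s ^ 2) ^ i) (s * t₂ * (s ^ 2) ^ j) ≠ 0) :
    ∃ c : ℂ, ∀ (z U : Fin N → ℂ) (h : Fin N → Bool → ℂ), (∀ k, z k ≠ 0) →
      (∀ k, h k false = U k * fourTheta p t₁ t₂ t₃ t₄ (z k)) →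
      (∀ k, h k true = -(U k * fourTheta p t₁ t₂ t₃ t₄ (z k)⁻¹)) →
      ∑ e : Fin N → Bool, (∏ k, h k (e k)) * kernelVandermonde p (fun k => shiftBy s (e k) (z k)) =
        c * ((∏ k, U k * oddTheta p (z k)) * kernelVandermonde p z) := by
  obtain ⟨α, β, hK⟩ := exists_thetaKernel_eq hp1
  rcases Nat.eq_zero_or_pos N with rfl | hN
  · refine ⟨1, fun z U h _ _ _ => ?_⟩
    simp [kernelVandermonde]
  obtain ⟨n, rfl⟩ : ∃ n, N = n + 1 := ⟨N - 1, by omega⟩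
  have hdet : ∀ z : Fin (n + 1) → ℂ, (∀ k, z k ≠ 0) → kernelVandermonde p z =
      (Matrix.of fun k m => formMonomial α β (n + 1) m (z k)).det := by
    intro z hz
    have := Matrix.det_projVandermonde (fun k => β (z k)) (fun k => α (z k))
    have e : Matrix.projVandermonde (fun k => β (z k)) (fun k => α (z k)) =
        Matrix.of fun k m => formMonomial α β (n + 1) m (z k) := rfl
    rw [← e, this, kernelVandermonde]
    refine prod_congr rfl fun k _ => prod_congr rfl fun l _ => ?_
    rw [hK _ _ (hz k) (hz l)]
    ring
  -- The coefficients c give the matrix of the operator on the monomials.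
  have hop : ∀ m : Fin (n + 1), ∃ c : Fin (n + 1) → ℂ, ∀ z : ℂ, z ≠ 0 →
      fourTheta p t₁ t₂ t₃ t₄ z * formMonomial α β (n + 1) m (s * z) -
        fourTheta p t₁ t₂ t₃ t₄ z⁻¹ * formMonomial α β (n + 1) m (s⁻¹ * z) =
        oddTheta p z * ∑ m', formMonomial α β (n + 1) m' z * c m' := by
    intro m
    obtain ⟨g, hg, hgz⟩ := exists_operator_eq hp1 hs hK h1 h2 h3 h4 n
      (by
        rw [← hbal, Nat.cast_succ, add_sub_cancel_right, zpow_natCast])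
      (fun i j hij => hgen i j (by omega)) (Submodule.subset_span ⟨m, rfl⟩ :
        formMonomial α β (n + 1) m ∈ formSpace α β (n + 1))
    obtain ⟨c, rfl⟩ := (Submodule.mem_span_range_iff_exists_fun ℂ).mp hg
    refine ⟨c, fun z hz => ?_⟩
    rw [hgz z hz, Finset.sum_apply]
    congr 1
    refine sum_congr rfl fun m' _ => ?_
    rw [Pi.smul_apply, smul_eq_mul, mul_comm]
  choose c hc using hop
  refine ⟨(Matrix.of fun m' m => c m m').det, fun z U h hz hf ht => ?_⟩
  have e1 : ∀ e : Fin (n + 1) → Bool, kernelVandermonde p (fun k => shiftBy s (e k) (z k)) =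
      (Matrix.of fun k m => formMonomial α β (n + 1) m (shiftBy s (e k) (z k))).det := fun e =>
    hdet _ fun k => shiftBy_ne_zero hs _ (hz k)
  simp only [e1]
  rw [← det_sum_rows h fun k b m => formMonomial α β (n + 1) m (shiftBy s b (z k)), hdet z hz]
  have e2 : (Matrix.of fun k m => ∑ b, h k b * formMonomial α β (n + 1) m (shiftBy s b (z k))) =
      Matrix.diagonal (fun k => U k * oddTheta p (z k)) *
        ((Matrix.of fun k m => formMonomial α β (n + 1) m (z k)) *
          (Matrix.of fun m' m => c m m')) := by
    ext k m
    rw [Matrix.diagonal_mul, Matrix.mul_apply]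
    simp only [Matrix.of_apply, Fintype.sum_bool, shiftBy, if_true, Bool.false_eq_true, if_false,
      hf, ht]
    linear_combination U k * hc m (z k) (hz k)
  rw [e2, Matrix.det_mul, Matrix.det_mul, Matrix.det_diagonal]
  ring

end Operator

end EllipticTilings

namespace EllipticTilings

/-! ### Odd theta functions on the lattices of the model -/

/-- The odd theta function at `s^k x`. -/
def br (p s x : ℂ) (k : ℤ) : ℂ := oddTheta p (s ^ k * x)

/-- `∏_{lo ≤ i ≤ n}` of odd theta functions -/
def brProd (p s x : ℂ) (lo n : ℤ) : ℂ := ∏ i ∈ Icc lo n, br p s x i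

/-- A fixed lower limit makes `brProd` a discrete antiderivative. The limits 1 - T, 1 - 2T and 1
used in the weights are the lower ends of the ranges in which non-vanishing is assumed. -/
lemma brProd_succ (p s x : ℂ) {lo n : ℤ} (h : lo ≤ n) :
    brProd p s x lo n = brProd p s x lo (n - 1) * br p s x n := by
  have : Icc lo n = insert n (Icc lo (n - 1)) := by ext i; simp only [mem_Icc, mem_insert]; omega
  rw [brProd, this, prod_insert (by simp), mul_comm, brProd]

lemma brProd_ne_zero {p s x : ℂ} {lo n : ℤ} (h : ∀ k, lo ≤ k → k ≤ n → br p s x k ≠ 0) :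
    brProd p s x lo n ≠ 0 :=
  prod_ne_zero_iff.mpr fun k hk => h k (mem_Icc.mp hk).1 (mem_Icc.mp hk).2

lemma theta_sq {p x : ℂ} (hx : x ≠ 0) : theta p (x ^ 2) = x * oddTheta p x := by
  rw [oddTheta, mul_inv_cancel_left₀ hx]

lemma br_one_zero {p : ℂ} (hp1 : ‖p‖ < 1) (s : ℂ) : br p s 1 0 = 0 := by
  simp [br, oddTheta, theta_one hp1]

lemma br_inv {p s x : ℂ} (hp1 : ‖p‖ < 1) (hs : s ≠ 0) (hx : x ≠ 0) (k : ℤ) :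
    oddTheta p (s ^ (-k) * x⁻¹) = -br p s x k := by
  rw [br, ← oddTheta_inv hp1 (by positivity), mul_inv, zpow_neg]

lemma br_one_neg {p s : ℂ} (hp1 : ‖p‖ < 1) (hs : s ≠ 0) (k : ℤ) :
    br p s 1 (-k) = -br p s 1 k := by
  rw [← br_inv hp1 hs one_ne_zero, inv_one, br]

/-- The reciprocal of the factorial `∏_{1 ≤ i ≤ n}` of odd theta functions, zero for negative `n`. -/
def brRec (p s : ℂ) (n : ℤ) : ℂ := if 0 ≤ n then (brProd p s 1 1 n)⁻¹ else 0

/-- The odd theta function vanishes at 0, which matches the value zero of `brRec` on negative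
integers. These zeros later kill the moves that leave the hexagon. -/
lemma brRec_pred {p s : ℂ} (hp1 : ‖p‖ < 1) {n : ℤ} (h : 0 < n → br p s 1 n ≠ 0) :
    brRec p s (n - 1) = br p s 1 n * brRec p s n := by
  rcases lt_trichotomy n 0 with hn | rfl | hn
  · simp [brRec, not_le.mpr hn, show ¬ (1 ≤ n) by omega]
  · simp [brRec, br_one_zero hp1]
  · have h1 := h hn
    rw [brRec, brRec, if_pos (by omega), if_pos (by omega), brProd_succ (n := n) _ _ _ (by omega)]
    field_simp

lemma brRec_ne_zero {p s : ℂ} {n : ℤ} (hn : 0 ≤ n) (h : ∀ k, 1 ≤ k → k ≤ n → br p s 1 k ≠ 0) :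
    brRec p s n ≠ 0 := by
  rw [brRec, if_pos hn]
  exact inv_ne_zero (brProd_ne_zero h)

/-- The non-degeneracy conditions on the parameters. -/
structure Nondegenerate (N S T : ℤ) (p s r₁ r₂ : ℂ) : Prop where
  norm_lt : ‖p‖ < 1
  s_ne : s ≠ 0
  r₁_ne : r₁ ≠ 0
  r₂_ne : r₂ ≠ 0
  S_nonneg : 0 ≤ S
  S_le : S ≤ T
  e_ne : ∀ k, 1 ≤ k → k ≤ N + T - 1 → br p s 1 k ≠ 0
  a_ne : ∀ k, 1 - 2 * T ≤ k → k ≤ N - S - 1 → br p s r₁ k ≠ 0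
  b_ne : ∀ k, 1 ≤ k → k ≤ N + S + T - 1 → br p s r₂ k ≠ 0
  c_ne : ∀ k, 1 - T ≤ k → k ≤ 2 * N - 1 → br p s (r₁ * r₂) k ≠ 0

/-- `x` is a site on the line `t`. -/
def IsSite (N S T t x : ℤ) : Prop := 0 ≤ x ∧ t + S - T ≤ x ∧ x ≤ t + N - 1 ∧ x ≤ S + N - 1

/-- The multiplicative position of the site `x` on the line `t`. -/
def sitePos (S : ℤ) (s r₁ r₂ : ℂ) (t x : ℤ) : ℂ := s ^ (2 * x + 1 - t - S) * (r₁ * r₂)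

section Weights

variable (N S T : ℤ) (p s r₁ r₂ : ℂ)

/-- The weight of a hole. -/
def holeWeight (t x : ℤ) : ℂ :=
  br p s (r₁ * r₂) (2 * x + 1 - t - S) /
    (br p s r₁ (x - 2 * t - S) * br p s r₁ (x - 2 * t - S + 1) *
      (br p s r₂ (x + t) * br p s r₂ (x + t + 1)))

/-- The univariate weight of the left part of a tiling, with the particles of the line `t`. -/
def leftWeight (t x : ℤ) : ℂ :=
  brRec p s x * brRec p s (N + t - 1 - x) *
    (brProd p s (r₁ * r₂) (1 - T) (x - t - S) / brProd p s (r₁ * r₂) (1 - T) (x + N - S)) *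
    (brProd p s r₁ (1 - 2 * T) (x - t - S) / brProd p s r₁ (1 - 2 * T) (x - 1 - 2 * t - S)) *
    (brProd p s r₂ 1 (x + t + 1) / brProd p s r₂ 1 x)

/-- The univariate weight of the left part of a tiling up to the line `t + 1`, without the particles
of that line and up to an elementary factor. -/
def leftStep (t y : ℤ) : ℂ :=
  brRec p s y * brRec p s (N + t - y) *
    (brProd p s (r₁ * r₂) (1 - T) (y - t - S - 1) / brProd p s (r₁ * r₂) (1 - T) (y + N - S)) *
    (brProd p s r₁ (1 - 2 * T) (y - t - S - 1) / brProd p s r₁ (1 - 2 * T) (y - 1 - 2 * t - S)) *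
    (brProd p s r₂ 1 (y + t) / brProd p s r₂ 1 y)

/-- The univariate weight of the right part of a tiling, with the particles of the line `t`. -/
def rightWeight (t x : ℤ) : ℂ :=
  brRec p s (x - t - S + T) * brRec p s (S + N - 1 - x) *
    (brProd p s (r₁ * r₂) (1 - T) (x - T) / brProd p s (r₁ * r₂) (1 - T) (x + N - t)) *
    (brProd p s r₂ 1 (x + T) / brProd p s r₁ (1 - 2 * T) (x - t - T - S)) *
    (brProd p s r₁ (1 - 2 * T) (x + 1 - 2 * t - S) / brProd p s r₂ 1 (x + t - 1))

/-- The univariate weight of the right part of a tiling, without the particles of the line `t` and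
up to an elementary factor. -/
def rightStep (t x : ℤ) : ℂ :=
  brRec p s (x - t - S + T) * brRec p s (S + N - 1 - x) *
    (brProd p s (r₁ * r₂) (1 - T) (x - T) / brProd p s (r₁ * r₂) (1 - T) (x + N - t)) *
    (brProd p s r₂ 1 (x + T) / brProd p s r₁ (1 - 2 * T) (x - t - T - S)) *
    (brProd p s r₁ (1 - 2 * T) (x - 1 - 2 * t - S) / brProd p s r₂ 1 (x + t + 1))

variable {N S T p s r₁ r₂} (nd : Nondegenerate N S T p s r₁ r₂)
include nd

/-- A particle at y on line t + 1 comes from y or from y - 1 on line t. Both weights share the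
factor `leftStep`; the four remaining theta factors, here and in `leftWeight_pred_eq`, are to be the
four-theta product at z and at z⁻¹. -/
lemma leftWeight_eq {t y : ℤ} (ht : 0 ≤ t) (htT : t < T) (hy : IsSite N S T (t + 1) y) :
    leftWeight N S T p s r₁ r₂ t y = leftStep N S T p s r₁ r₂ t y *
      (br p s (r₁ * r₂) (y - t - S) * br p s 1 (N + t - y) * br p s r₁ (y - t - S) *
        br p s r₂ (y + t + 1)) := by
  obtain ⟨h0, h1, h2, h3⟩ := hy
  have k1 := brRec_pred (s := s) nd.norm_lt (n := N + t - y) fun h => nd.e_ne _ (by omega) (by omega)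
  have k2 := brProd_succ p s (r₁ * r₂) (lo := 1 - T) (n := y - t - S) (by omega)
  have k3 := brProd_succ p s r₁ (lo := 1 - 2 * T) (n := y - t - S) (by omega)
  have k4 := brProd_succ p s r₂ (lo := 1) (n := y + t + 1) (by omega)
  rw [show N + t - y - 1 = N + t - 1 - y by ring] at k1
  rw [show y + t + 1 - 1 = y + t by ring] at k4
  rw [leftWeight, leftStep, k1, k2, k3, k4]
  ring

lemma leftWeight_pred_eq {t y : ℤ} (ht : 0 ≤ t) (htT : t < T) (hy : IsSite N S T (t + 1) y) :
    leftWeight N S T p s r₁ r₂ t (y - 1) = leftStep N S T p s r₁ r₂ t y *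
      (br p s 1 y * br p s (r₁ * r₂) (y + N - S) * br p s r₂ y * br p s r₁ (y - 1 - 2 * t - S)) := by
  obtain ⟨h0, h1, h2, h3⟩ := hy
  -- At y = 0 the product recursions start below their lower limit. Both sides vanish instead: the
  -- left through `brRec` at -1, the right through the odd theta function at 0.
  rcases eq_or_lt_of_le h0 with rfl | h0
  · rw [br_one_zero nd.norm_lt]
    simp [leftWeight, brRec]
  have k1 := brRec_pred (s := s) nd.norm_lt (n := y) fun h => nd.e_ne _ (by omega) (by omega)
  have hS := nd.S_le
  have hS0 := nd.S_nonneg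
  have k2 := brProd_succ p s (r₁ * r₂) (lo := 1 - T) (n := y + N - S) (by omega)
  have k3 := brProd_succ p s r₁ (lo := 1 - 2 * T) (n := y - 1 - 2 * t - S) (by omega)
  have k4 := brProd_succ p s r₂ (lo := 1) (n := y) (by omega)
  have n2 := nd.c_ne (y + N - S) (by omega) (by omega)
  have n3 := nd.a_ne (y - 1 - 2 * t - S) (by omega) (by omega)
  have n4 := nd.b_ne y (by omega) (by omega)
  rw [leftWeight, leftStep, k1, k2, k3, k4, show N + t - 1 - (y - 1) = N + t - y by ring,
    show y - 1 - t - S = y - t - S - 1 by ring, show y - 1 + N - S = y + N - S - 1 by ring,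
    show y - 1 - 1 - 2 * t - S = y - 1 - 2 * t - S - 1 by ring,
    show y - 1 + t + 1 = y + t by ring]
  rw [← div_div _ _ (br p s (r₁ * r₂) (y + N - S)),
    ← div_div _ _ (br p s r₁ (y - 1 - 2 * t - S)), ← div_div _ _ (br p s r₂ y)]
  field_simp

/-- Mirror image of the left side: a particle at x on line t goes to x + 1 or to x on line t + 1,
with common factor `rightStep`. -/
lemma rightWeight_succ_eq {t x : ℤ} (ht : 0 ≤ t) (htT : t < T) (hx : IsSite N S T t x) :
    rightWeight N S T p s r₁ r₂ (t + 1) (x + 1) = rightStep N S T p s r₁ r₂ t x *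
      (br p s 1 (S + N - 1 - x) * br p s (r₁ * r₂) (x + 1 - T) * br p s r₂ (x + 1 + T) *
        br p s r₁ (x - 2 * t - S)) := by
  obtain ⟨h0, h1, h2, h3⟩ := hx
  have hS := nd.S_le
  have k1 := brRec_pred (s := s) nd.norm_lt (n := S + N - 1 - x)
    fun h => nd.e_ne _ (by omega) (by omega)
  have k2 := brProd_succ p s (r₁ * r₂) (lo := 1 - T) (n := x + 1 - T) (by omega)
  have k3 := brProd_succ p s r₁ (lo := 1 - 2 * T) (n := x - 2 * t - S) (by omega)
  have k4 := brProd_succ p s r₂ (lo := 1) (n := x + 1 + T) (by omega)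
  rw [show S + N - 1 - x - 1 = S + N - 1 - (x + 1) by ring] at k1
  rw [show x + 1 - T - 1 = x - T by ring] at k2
  rw [show x - 2 * t - S - 1 = x - 1 - 2 * t - S by ring] at k3
  rw [show x + 1 + T - 1 = x + T by ring] at k4
  rw [rightWeight, rightStep, show x + 1 - (t + 1) - S + T = x - t - S + T by ring,
    show x + 1 + N - (t + 1) = x + N - t by ring, show x + 1 - (t + 1) - T - S = x - t - T - S by ring,
    show x + 1 + 1 - 2 * (t + 1) - S = x - 2 * t - S by ring,
    show x + 1 + (t + 1) - 1 = x + t + 1 by ring, k1, k2, k3, k4]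
  ring

lemma rightWeight_eq {t x : ℤ} (ht : 0 ≤ t) (htT : t < T) (hx : IsSite N S T t x) :
    rightWeight N S T p s r₁ r₂ (t + 1) x = rightStep N S T p s r₁ r₂ t x *
      (br p s 1 (x - t - S + T) * br p s (r₁ * r₂) (x + N - t) * br p s r₁ (x - t - T - S) *
        br p s r₂ (x + t + 1)) := by
  obtain ⟨h0, h1, h2, h3⟩ := hx
  have hS := nd.S_le
  have hS0 := nd.S_nonneg
  -- On the lower edge x = t + S - T a horizontal step leaves the hexagon, and both sides vanish.
  rcases eq_or_lt_of_le h1 with rfl | h1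
  · rw [show t + S - T - t - S + T = 0 by ring, br_one_zero nd.norm_lt]
    simp [rightWeight, brRec, show ¬ (1 ≤ (0 : ℤ)) by omega,
      show t + S - T - (t + 1) - S + T = -1 by ring]
  have k1 := brRec_pred (s := s) nd.norm_lt (n := x - t - S + T)
    fun h => nd.e_ne _ (by omega) (by omega)
  have k2 := brProd_succ p s (r₁ * r₂) (lo := 1 - T) (n := x + N - t) (by omega)
  have k3 := brProd_succ p s r₁ (lo := 1 - 2 * T) (n := x - t - T - S) (by omega)
  have k4 := brProd_succ p s r₂ (lo := 1) (n := x + t + 1) (by omega)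
  have n2 := nd.c_ne (x + N - t) (by omega) (by omega)
  have n3 := nd.a_ne (x - t - T - S) (by omega) (by omega)
  have n4 := nd.b_ne (x + t + 1) (by omega) (by omega)
  rw [rightWeight, rightStep, k2, k3, k4, show x - (t + 1) - S + T = x - t - S + T - 1 by ring, k1,
    show x + N - (t + 1) = x + N - t - 1 by ring,
    show x - (t + 1) - T - S = x - t - T - S - 1 by ring,
    show x + 1 - 2 * (t + 1) - S = x - 1 - 2 * t - S by ring,
    show x + (t + 1) - 1 = x + t + 1 - 1 by ring]
  rw [← div_div _ _ (br p s (r₁ * r₂) (x + N - t)),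
    ← div_div _ _ (br p s r₁ (x - t - T - S)), ← div_div _ _ (br p s r₂ (x + t + 1))]
  field_simp

/-- Adding the particles of the line `t + 1` to the left part. -/
lemma leftStep_mul_eq {t y : ℤ} (ht : 0 ≤ t) (htT : t + 1 < T) (hy : IsSite N S T (t + 1) y) :
    leftStep N S T p s r₁ r₂ t y * br p s (r₁ * r₂) (2 * y - t - S) =
      holeWeight S p s r₁ r₂ (t + 1) y * leftWeight N S T p s r₁ r₂ (t + 1) y := by
  obtain ⟨h0, h1, h2, h3⟩ := hy
  have hS := nd.S_le
  have hS0 := nd.S_nonneg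
  have k3 := brProd_succ p s r₁ (lo := 1 - 2 * T) (n := y - 1 - 2 * t - S) (by omega)
  have k3' := brProd_succ p s r₁ (lo := 1 - 2 * T) (n := y - 1 - 2 * t - S - 1) (by omega)
  have k4 := brProd_succ p s r₂ (lo := 1) (n := y + t + 2) (by omega)
  have k4' := brProd_succ p s r₂ (lo := 1) (n := y + t + 1) (by omega)
  have n1 := nd.a_ne (y - 1 - 2 * t - S) (by omega) (by omega)
  have n2 := nd.a_ne (y - 1 - 2 * t - S - 1) (by omega) (by omega)
  have n3 := nd.b_ne (y + t + 1) (by omega) (by omega)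
  have n4 := nd.b_ne (y + t + 2) (by omega) (by omega)
  rw [show y + t + 2 - 1 = y + t + 1 by ring] at k4
  rw [show y + t + 1 - 1 = y + t by ring] at k4'
  rw [leftStep, leftWeight, holeWeight, show N + (t + 1) - 1 - y = N + t - y by ring,
    show y - (t + 1) - S = y - t - S - 1 by ring,
    show y - 1 - 2 * (t + 1) - S = y - 1 - 2 * t - S - 1 - 1 by ring,
    show y + (t + 1) + 1 = y + t + 2 by ring,
    show y - 2 * (t + 1) - S = y - 1 - 2 * t - S - 1 by ring,
    show y - 1 - 2 * t - S - 1 + 1 = y - 1 - 2 * t - S by ring,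
    show y + (t + 1) = y + t + 1 by ring,
    show 2 * y + 1 - (t + 1) - S = 2 * y - t - S by ring, k3, k3', k4, k4']
  simp only [← div_div]
  field_simp

/-- Adding the particles of the line `t` to the right part. -/
lemma rightStep_mul_eq {t x : ℤ} (ht : 0 < t) (htT : t < T) (hx : IsSite N S T t x) :
    rightStep N S T p s r₁ r₂ t x * br p s (r₁ * r₂) (2 * x + 1 - t - S) =
      holeWeight S p s r₁ r₂ t x * rightWeight N S T p s r₁ r₂ t x := by
  obtain ⟨h0, h1, h2, h3⟩ := hx
  have hS := nd.S_le
  have hS0 := nd.S_nonneg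
  have k3 := brProd_succ p s r₁ (lo := 1 - 2 * T) (n := x - 2 * t - S + 1) (by omega)
  have k3' := brProd_succ p s r₁ (lo := 1 - 2 * T) (n := x - 2 * t - S) (by omega)
  have k4 := brProd_succ p s r₂ (lo := 1) (n := x + t + 1) (by omega)
  have k4' := brProd_succ p s r₂ (lo := 1) (n := x + t) (by omega)
  have n1 := nd.a_ne (x - 2 * t - S) (by omega) (by omega)
  have n2 := nd.a_ne (x - 2 * t - S + 1) (by omega) (by omega)
  have n3 := nd.b_ne (x + t) (by omega) (by omega)
  have n4 := nd.b_ne (x + t + 1) (by omega) (by omega)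
  rw [show x - 2 * t - S + 1 - 1 = x - 2 * t - S by ring] at k3
  rw [show x + t + 1 - 1 = x + t by ring] at k4
  rw [rightStep, rightWeight, holeWeight, show x - 1 - 2 * t - S = x - 2 * t - S - 1 by ring,
    show x + 1 - 2 * t - S = x - 2 * t - S + 1 by ring, k3, k3', k4, k4']
  simp only [← div_div]
  field_simp

lemma leftWeight_ne_zero {t x : ℤ} (ht : 0 ≤ t) (htT : t < T) (hx : IsSite N S T t x) :
    leftWeight N S T p s r₁ r₂ t x ≠ 0 := by
  obtain ⟨h0, h1, h2, h3⟩ := hx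
  have hS := nd.S_le
  have hS0 := nd.S_nonneg
  refine mul_ne_zero (mul_ne_zero (mul_ne_zero (mul_ne_zero ?_ ?_) (div_ne_zero ?_ ?_))
    (div_ne_zero ?_ ?_)) (div_ne_zero ?_ ?_)
  · exact brRec_ne_zero (by omega) fun k _ _ => nd.e_ne k (by omega) (by omega)
  · exact brRec_ne_zero (by omega) fun k _ _ => nd.e_ne k (by omega) (by omega)
  · exact brProd_ne_zero fun k _ _ => nd.c_ne k (by omega) (by omega)
  · exact brProd_ne_zero fun k _ _ => nd.c_ne k (by omega) (by omega)
  · exact brProd_ne_zero fun k _ _ => nd.a_ne k (by omega) (by omega)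
  · exact brProd_ne_zero fun k _ _ => nd.a_ne k (by omega) (by omega)
  · exact brProd_ne_zero fun k _ _ => nd.b_ne k (by omega) (by omega)
  · exact brProd_ne_zero fun k _ _ => nd.b_ne k (by omega) (by omega)

lemma rightWeight_ne_zero {t x : ℤ} (ht : 0 < t) (htT : t ≤ T) (hx : IsSite N S T t x) :
    rightWeight N S T p s r₁ r₂ t x ≠ 0 := by
  obtain ⟨h0, h1, h2, h3⟩ := hx
  have hS := nd.S_le
  have hS0 := nd.S_nonneg
  refine mul_ne_zero (mul_ne_zero (mul_ne_zero (mul_ne_zero ?_ ?_) (div_ne_zero ?_ ?_))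
    (div_ne_zero ?_ ?_)) (div_ne_zero ?_ ?_)
  · exact brRec_ne_zero (by omega) fun k _ _ => nd.e_ne k (by omega) (by omega)
  · exact brRec_ne_zero (by omega) fun k _ _ => nd.e_ne k (by omega) (by omega)
  · exact brProd_ne_zero fun k _ _ => nd.c_ne k (by omega) (by omega)
  · exact brProd_ne_zero fun k _ _ => nd.c_ne k (by omega) (by omega)
  · exact brProd_ne_zero fun k _ _ => nd.b_ne k (by omega) (by omega)
  · exact brProd_ne_zero fun k _ _ => nd.a_ne k (by omega) (by omega)
  · exact brProd_ne_zero fun k _ _ => nd.a_ne k (by omega) (by omega)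
  · exact brProd_ne_zero fun k _ _ => nd.b_ne k (by omega) (by omega)

end Weights

end EllipticTilings

/-! ### One-step transfer identities on the lattices of sites -/

namespace EllipticTilings

lemma zpow_mul_eq_sq {s : ℂ} (hs : s ≠ 0) {a b c : ℤ} (h : a + b = 2 * c) :
    s ^ a * s ^ b = (s ^ c) ^ 2 := by
  rw [← zpow_add₀ hs, h, mul_comm, zpow_mul]
  norm_cast

lemma theta_lattice {p s x y w : ℂ} {a m k : ℤ} (hs : s ≠ 0) (hw : w ≠ 0) (h : x * y = w ^ 2)
    (hk : a + m = 2 * k) :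
    theta p (s ^ a * x * (s ^ m * y)) = s ^ k * w * br p s w k := by
  have : s ^ a * x * (s ^ m * y) = (s ^ k * w) ^ 2 := by
    rw [mul_pow, ← h, ← zpow_mul_eq_sq hs hk]
    ring
  rw [this, theta_sq (by positivity), br]

/-- `fourTheta` on a lattice in terms of odd theta functions. -/
lemma fourTheta_lattice {p s y x₁ x₂ x₃ x₄ w₁ w₂ w₃ w₄ : ℂ} {m a₁ a₂ a₃ a₄ k₁ k₂ k₃ k₄ d : ℤ}
    (hs : s ≠ 0) (hw₁ : w₁ ≠ 0) (hw₂ : w₂ ≠ 0) (hw₃ : w₃ ≠ 0) (hw₄ : w₄ ≠ 0)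
    (h₁ : x₁ * y = w₁ ^ 2) (h₂ : x₂ * y = w₂ ^ 2) (h₃ : x₃ * y = w₃ ^ 2) (h₄ : x₄ * y = w₄ ^ 2)
    (hk₁ : a₁ + m = 2 * k₁) (hk₂ : a₂ + m = 2 * k₂) (hk₃ : a₃ + m = 2 * k₃)
    (hk₄ : a₄ + m = 2 * k₄) (hw : w₁ * w₂ * w₃ * w₄ = y ^ 2) (hd : k₁ + k₂ + k₃ + k₄ = 2 * m + d) :
    fourTheta p (s ^ a₁ * x₁) (s ^ a₂ * x₂) (s ^ a₃ * x₃) (s ^ a₄ * x₄) (s ^ m * y) =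
      s ^ d * (br p s w₁ k₁ * br p s w₂ k₂ * br p s w₃ k₃ * br p s w₄ k₄) := by
  rw [fourTheta, theta_lattice hs hw₁ h₁ hk₁, theta_lattice hs hw₂ h₂ hk₂,
    theta_lattice hs hw₃ h₃ hk₃, theta_lattice hs hw₄ h₄ hk₄, mul_pow, ← hw]
  have e : s ^ k₁ * s ^ k₂ * s ^ k₃ * s ^ k₄ = (s ^ m) ^ 2 * s ^ d := by
    rw [← zpow_natCast (s ^ m), ← zpow_mul]
    simp only [← zpow_add₀ hs]
    rw [hd, mul_comm]
    rfl
  have h0 : (s ^ m) ^ 2 ≠ 0 := by positivity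
  field_simp
  linear_combination (br p s w₁ k₁ * br p s w₂ k₂ * br p s w₃ k₃ * br p s w₄ k₄) * e

/-- Reduces the genericity condition on the nodes of the operator to non-vanishing of two odd theta
functions in the assumed ranges. -/
lemma thetaKernel_lattice_ne_zero {p s x y w w' : ℂ} {a b k l : ℤ} (hs : s ≠ 0) (hx : x ≠ 0)
    (hy : y ≠ 0) (hw : w ≠ 0) (hw' : w' ≠ 0) (h : x * y = w ^ 2) (h' : x = w' ^ 2 * y)
    (hk : a + b = 2 * k) (hl : a - b = 2 * l) (hb : br p s w k ≠ 0) (hb' : br p s w' l ≠ 0) :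
    thetaKernel p (s ^ a * x) (s ^ b * y) ≠ 0 := by
  have e : s ^ a * x / (s ^ b * y) = s ^ a * w' ^ 2 * (s ^ (-b) * 1) := by
    rw [zpow_neg, h']
    field_simp
  rw [thetaKernel, theta_lattice hs hw h hk, e,
    theta_lattice (w := w') (k := l) hs hw' (by ring) (by omega)]
  positivity

lemma thetaKernel_symm {p x y : ℂ} (hp1 : ‖p‖ < 1) (hx : x ≠ 0) (hy : y ≠ 0) :
    thetaKernel p x y = -thetaKernel p y x := by
  obtain ⟨α, β, h⟩ := exists_thetaKernel_eq hp1
  rw [h x y hx hy, h y x hy hx]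
  ring

lemma br_inv' {p s x : ℂ} (hp1 : ‖p‖ < 1) (hs : s ≠ 0) (hx : x ≠ 0) {k l : ℤ} (h : l = -k) :
    br p s x⁻¹ l = -br p s x k := by
  rw [h, br, br_inv hp1 hs hx]

/-- The displacement of a step. -/
def stepSize (b : Bool) : ℤ := if b then 1 else 0

section Transfer

variable {N : ℕ} {S T : ℤ} {p s r₁ r₂ : ℂ} (nd : Nondegenerate N S T p s r₁ r₂)
include nd

lemma Nondegenerate.e_ne' {k : ℤ} (h0 : k ≠ 0) (h1 : -(N + T - 1) ≤ k) (h2 : k ≤ N + T - 1) :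
    br p s 1 k ≠ 0 := by
  rcases lt_or_gt_of_ne h0 with h | h
  · rw [← neg_neg k, br_one_neg nd.norm_lt nd.s_ne]
    exact neg_ne_zero.mpr (nd.e_ne _ (by omega) (by omega))
  · exact nd.e_ne _ (by omega) h2

/-- An instance of `exists_transfer_eq` at the points z_k of line t + 1: the points sz_k and s⁻¹z_k
are the sites y_k and y_k - 1 of line t. All 2^N moves are summed, including forbidden ones. -/
lemma exists_left_transfer {t : ℤ} (ht : 0 ≤ t) (htT : t < T) :
    ∃ c : ℂ, ∀ y : Fin N → ℤ, (∀ k, IsSite N S T (t + 1) (y k)) →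
      ∑ e : Fin N → Bool, (∏ k, leftWeight N S T p s r₁ r₂ t (y k - stepSize (e k))) *
          kernelVandermonde p (fun k => sitePos S s r₁ r₂ t (y k - stepSize (e k))) =
        c * ((∏ k, leftStep N S T p s r₁ r₂ t (y k) * br p s (r₁ * r₂) (2 * y k - t - S)) *
          kernelVandermonde p (fun k => sitePos S s r₁ r₂ (t + 1) (y k))) := by
  have hp1 := nd.norm_lt
  have hs := nd.s_ne
  have hr₁ := nd.r₁_ne
  have hr₂ := nd.r₂_ne
  have hS := nd.S_le
  have hS0 := nd.S_nonneg
  have zp : ∀ (a : ℤ) (x : ℂ) (i : ℕ), s * (s ^ a * x) * (s ^ 2) ^ i = s ^ (a + 1 + 2 * i) * x := by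
    intro a x i
    rw [← pow_mul, ← zpow_natCast s (2 * i), zpow_add₀ hs, zpow_add₀ hs, zpow_one]
    push_cast
    ring
  -- The four parameters are read off from the theta factors in `leftWeight_eq`. Substituting the
  -- inverse point then yields the factors in `leftWeight_pred_eq`, and the powers of s satisfy the
  -- balancing condition.
  obtain ⟨c, hc⟩ := exists_transfer_eq (p := p) (s := s) (t₁ := s ^ (-t - S) * (r₁ * r₂))
    (t₂ := s ^ (-2 * N - t + S) * (r₁ * r₂)⁻¹) (t₃ := s ^ (-t - S) * (r₁ / r₂))
    (t₄ := s ^ (3 * t + S + 2) * (r₂ / r₁)) hp1 hs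
    (by positivity) (by positivity) (by positivity) (by positivity) N (by
      have e : s ^ (-t - S) * s ^ (-2 * (N : ℤ) - t + S) * s ^ (-t - S) * s ^ (3 * t + S + 2) *
          (s ^ 2) ^ ((N : ℤ) - 1) = 1 := by
        rw [← zpow_natCast, ← zpow_mul]
        simp only [← zpow_add₀ hs]
        rw [← zpow_zero s]
        congr 1
        push_cast
        ring
      rw [← e]
      field_simp) (by
      intro i j hij
      rw [zp, zp]
      refine thetaKernel_lattice_ne_zero (w := 1) (w' := r₁ * r₂) (k := 1 - t - N + i + j)
        (l := N - S + i - j) hs (by positivity) (by positivity) one_ne_zero (by positivity)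
        (by field_simp) (by field_simp) (by ring) (by ring)
        (nd.e_ne' (by omega) (by omega) (by omega)) (nd.c_ne _ (by omega) (by omega)))
  -- Passing to odd theta functions leaves a power s^{1-N} for each particle, and reversing one odd
  -- factor leaves a sign; U_k contains the compensating -s^{N-1}.
  refine ⟨c * ((-s ^ ((N : ℤ) - 1)) ^ N), fun y hy => ?_⟩
  have hsN : s ^ ((N : ℤ) - 1) * s ^ (1 - (N : ℤ)) = 1 := by
    rw [← zpow_add₀ hs]; simp
  have key := hc (fun k => sitePos S s r₁ r₂ (t + 1) (y k))
    (fun k => -s ^ ((N : ℤ) - 1) * leftStep N S T p s r₁ r₂ t (y k))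
    (fun k b => leftWeight N S T p s r₁ r₂ t (y k - stepSize b))
    (fun k => by rw [sitePos]; positivity)
    (fun k => by
      have f1 : br p s 1 (N + t - y k) = -br p s 1 (y k - N - t) := by
        rw [show (N : ℤ) + t - y k = -(y k - N - t) by ring, br_one_neg hp1 hs]
      simp only [stepSize, Bool.false_eq_true, if_false, sub_zero]
      rw [sitePos, leftWeight_eq nd ht htT (hy k), f1,
        fourTheta_lattice (w₁ := r₁ * r₂) (w₂ := 1) (w₃ := r₁) (w₄ := r₂) (k₁ := y k - t - S)
        (k₂ := y k - N - t) (k₃ := y k - t - S) (k₄ := y k + t + 1) (d := 1 - N) hs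
        (mul_ne_zero hr₁ hr₂) one_ne_zero hr₁ hr₂
        (by ring) (by field_simp) (by field_simp) (by field_simp) (by ring) (by ring) (by ring)
        (by ring) (by ring) (by ring)]
      linear_combination (leftStep N S T p s r₁ r₂ t (y k) * (br p s (r₁ * r₂) (y k - t - S) *
        br p s 1 (y k - N - t) * br p s r₁ (y k - t - S) * br p s r₂ (y k + t + 1))) * hsN)
    (fun k => by
      simp only [stepSize, if_true]
      rw [sitePos, leftWeight_pred_eq nd ht htT (hy k),
        mul_inv (s ^ (2 * y k + 1 - (t + 1) - S)) (r₁ * r₂), ← zpow_neg,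
        fourTheta_lattice (w₁ := 1⁻¹) (w₂ := (r₁ * r₂)⁻¹) (w₃ := r₂⁻¹) (w₄ := r₁⁻¹) (k₁ := -(y k))
        (k₂ := -(y k + N - S)) (k₃ := -(y k)) (k₄ := -(y k - 1 - 2 * t - S)) (d := 1 - N) hs
        (by simp) (by positivity) (by positivity) (by positivity)
        (by field_simp) (by field_simp) (by field_simp) (by field_simp) (by ring) (by ring)
        (by ring) (by ring) (by field_simp) (by ring),
        br_inv' hp1 hs one_ne_zero rfl, br_inv' hp1 hs (mul_ne_zero hr₁ hr₂) rfl,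
        br_inv' hp1 hs hr₁ rfl, br_inv' hp1 hs hr₂ rfl]
      linear_combination (-leftStep N S T p s r₁ r₂ t (y k) * (br p s 1 (y k) *
        br p s (r₁ * r₂) (y k + N - S) * br p s r₂ (y k) * br p s r₁ (y k - 1 - 2 * t - S))) * hsN)
  have hpos : ∀ (b : Bool) (x : ℤ), shiftBy s b (sitePos S s r₁ r₂ (t + 1) x) =
      sitePos S s r₁ r₂ t (x - stepSize b) := by
    intro b x
    cases b
    · rw [shiftBy, sitePos, sitePos, stepSize, if_neg (by simp), if_neg (by simp),
        show 2 * (x - 0) + 1 - t - S = 2 * x + 1 - (t + 1) - S + 1 by ring, zpow_add_one₀ hs]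
      ring
    · rw [shiftBy, sitePos, sitePos, stepSize, if_pos rfl, if_pos rfl,
        show 2 * (x - 1) + 1 - t - S = 2 * x + 1 - (t + 1) - S - 1 by ring, zpow_sub_one₀ hs]
      ring
  have hodd : ∀ x : ℤ, oddTheta p (sitePos S s r₁ r₂ (t + 1) x) =
      br p s (r₁ * r₂) (2 * x - t - S) := by
    intro x
    rw [sitePos, br, show 2 * x + 1 - (t + 1) - S = 2 * x - t - S by ring]
  simp only [hpos, hodd, mul_assoc, prod_mul_distrib (f := fun _ : Fin N => -s ^ ((N : ℤ) - 1)),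
    prod_const, card_univ, Fintype.card_fin] at key
  rw [key]
  ring

/-- The same identity at the points of line t: now sz and s⁻¹z are the sites x + 1 and x of line t +
1. -/
lemma exists_right_transfer {t : ℤ} (ht : 0 ≤ t) (htT : t < T) :
    ∃ c : ℂ, ∀ x : Fin N → ℤ, (∀ k, IsSite N S T t (x k)) →
      ∑ e : Fin N → Bool, (∏ k, rightWeight N S T p s r₁ r₂ (t + 1) (x k + stepSize (e k))) *
          kernelVandermonde p (fun k => sitePos S s r₁ r₂ (t + 1) (x k + stepSize (e k))) =
        c * ((∏ k, rightStep N S T p s r₁ r₂ t (x k) * br p s (r₁ * r₂) (2 * x k + 1 - t - S)) *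
          kernelVandermonde p (fun k => sitePos S s r₁ r₂ t (x k))) := by
  have hp1 := nd.norm_lt
  have hs := nd.s_ne
  have hr₁ := nd.r₁_ne
  have hr₂ := nd.r₂_ne
  have hS := nd.S_le
  have hS0 := nd.S_nonneg
  have zp : ∀ (a : ℤ) (x : ℂ) (i : ℕ), s * (s ^ a * x) * (s ^ 2) ^ i = s ^ (a + 1 + 2 * i) * x := by
    intro a x i
    rw [← pow_mul, ← zpow_natCast s (2 * i), zpow_add₀ hs, zpow_add₀ hs, zpow_one]
    push_cast
    ring
  obtain ⟨c, hc⟩ := exists_transfer_eq (p := p) (s := s)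
    (t₁ := s ^ (1 - 2 * N - S + t) * (r₁ * r₂)⁻¹) (t₂ := s ^ (1 - 2 * T + t + S) * (r₁ * r₂))
    (t₃ := s ^ (1 + 2 * T + t + S) * (r₂ / r₁)) (t₄ := s ^ (-3 * t - S - 1) * (r₁ / r₂)) hp1 hs
    (by positivity) (by positivity) (by positivity) (by positivity) N (by
      have e : s ^ (1 - 2 * (N : ℤ) - S + t) * s ^ (1 - 2 * T + t + S) * s ^ (1 + 2 * T + t + S) *
          s ^ (-3 * t - S - 1) * (s ^ 2) ^ ((N : ℤ) - 1) = 1 := by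
        rw [← zpow_natCast, ← zpow_mul]
        simp only [← zpow_add₀ hs]
        rw [← zpow_zero s]
        congr 1
        push_cast
        ring
      rw [← e]
      field_simp) (by
      intro i j hij
      rw [zp, zp, thetaKernel_symm hp1 (by positivity) (by positivity), neg_ne_zero]
      refine thetaKernel_lattice_ne_zero (w := 1) (w' := r₁ * r₂) (k := 2 - N - T + t + i + j)
        (l := N + S - T + j - i) hs (by positivity) (by positivity) one_ne_zero (by positivity)
        (by field_simp) (by field_simp) (by ring) (by ring)
        (nd.e_ne' (by omega) (by omega) (by omega)) (nd.c_ne _ (by omega) (by omega)))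
  refine ⟨c * ((-s ^ ((N : ℤ) - 1)) ^ N), fun x hx => ?_⟩
  have hsN : s ^ ((N : ℤ) - 1) * s ^ (1 - (N : ℤ)) = 1 := by
    rw [← zpow_add₀ hs]; simp
  have key := hc (fun k => sitePos S s r₁ r₂ t (x k))
    (fun k => -s ^ ((N : ℤ) - 1) * rightStep N S T p s r₁ r₂ t (x k))
    (fun k b => rightWeight N S T p s r₁ r₂ (t + 1) (x k + stepSize (!b)))
    (fun k => by rw [sitePos]; positivity)
    (fun k => by
      have f1 : br p s 1 (S + N - 1 - x k) = -br p s 1 (x k + 1 - S - N) := by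
        rw [show S + (N : ℤ) - 1 - x k = -(x k + 1 - S - N) by ring, br_one_neg hp1 hs]
      simp only [stepSize, Bool.not_false, if_true]
      rw [sitePos, rightWeight_succ_eq nd ht htT (hx k), f1,
        fourTheta_lattice (w₁ := 1) (w₂ := r₁ * r₂) (w₃ := r₂) (w₄ := r₁) (k₁ := x k + 1 - S - N)
        (k₂ := x k + 1 - T) (k₃ := x k + 1 + T) (k₄ := x k - 2 * t - S) (d := 1 - N) hs
        one_ne_zero (mul_ne_zero hr₁ hr₂) hr₂ hr₁
        (by field_simp) (by field_simp) (by field_simp) (by field_simp) (by ring) (by ring)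
        (by ring) (by ring) (by ring) (by ring)]
      linear_combination (rightStep N S T p s r₁ r₂ t (x k) * (br p s 1 (x k + 1 - S - N) *
        br p s (r₁ * r₂) (x k + 1 - T) * br p s r₂ (x k + 1 + T) * br p s r₁ (x k - 2 * t - S))) *
          hsN)
    (fun k => by
      simp only [stepSize, Bool.not_true, Bool.false_eq_true, if_false, add_zero]
      rw [sitePos, rightWeight_eq nd ht htT (hx k),
        mul_inv (s ^ (2 * x k + 1 - t - S)) (r₁ * r₂), ← zpow_neg,
        fourTheta_lattice (w₁ := (r₁ * r₂)⁻¹) (w₂ := 1⁻¹) (w₃ := r₁⁻¹) (w₄ := r₂⁻¹)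
        (k₁ := -(x k + N - t)) (k₂ := -(x k - t - S + T)) (k₃ := -(x k - t - T - S))
        (k₄ := -(x k + t + 1)) (d := 1 - N) hs
        (by positivity) (by simp) (by positivity) (by positivity)
        (by field_simp) (by field_simp) (by field_simp) (by field_simp) (by ring) (by ring)
        (by ring) (by ring) (by field_simp) (by ring),
        br_inv' hp1 hs one_ne_zero rfl, br_inv' hp1 hs (mul_ne_zero hr₁ hr₂) rfl,
        br_inv' hp1 hs hr₁ rfl, br_inv' hp1 hs hr₂ rfl]
      linear_combination (-rightStep N S T p s r₁ r₂ t (x k) * (br p s 1 (x k - t - S + T) *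
        br p s (r₁ * r₂) (x k + N - t) * br p s r₁ (x k - t - T - S) * br p s r₂ (x k + t + 1))) *
          hsN)
  have hpos : ∀ (b : Bool) (y : ℤ), shiftBy s b (sitePos S s r₁ r₂ t y) =
      sitePos S s r₁ r₂ (t + 1) (y + stepSize (!b)) := by
    intro b y
    cases b
    · rw [shiftBy, sitePos, sitePos, stepSize, if_neg (by simp), if_pos (by simp),
        show 2 * (y + 1) + 1 - (t + 1) - S = 2 * y + 1 - t - S + 1 by ring, zpow_add_one₀ hs]
      ring
    · rw [shiftBy, sitePos, sitePos, stepSize, if_pos rfl, if_neg (by simp),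
        show 2 * (y + 0) + 1 - (t + 1) - S = 2 * y + 1 - t - S - 1 by ring, zpow_sub_one₀ hs]
      ring
  have hodd : ∀ y : ℤ, oddTheta p (sitePos S s r₁ r₂ t y) =
      br p s (r₁ * r₂) (2 * y + 1 - t - S) := fun y => rfl
  simp only [hpos, hodd, mul_assoc, prod_mul_distrib (f := fun _ : Fin N => -s ^ ((N : ℤ) - 1)),
    prod_const, card_univ, Fintype.card_fin] at key
  -- Here the unshifted Boolean `false` means z ↦ sz, which is the upward step, so the step
  -- variables are negated in the sum.
  have hflip : Function.Involutive fun (e : Fin N → Bool) k => !e k := fun e => by simp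
  rw [← Equiv.sum_comp hflip.toPerm]
  simp only [Function.Involutive.coe_toPerm]
  rw [key]
  ring

end Transfer

end EllipticTilings

namespace EllipticTilings

/-! ### Transfer matrices -/

section TransferMatrix

variable {α : Type*} (V : ℕ → α → ℂ) (κ : α → α → ℂ)

/-- The weight of a path. -/
def pathWeight (n : ℕ) (X : Fin (n + 1) → α) : ℂ :=
  (∏ i : Fin (n + 1), V i (X i)) * ∏ i : Fin n, κ (X i.castSucc) (X i.succ)

lemma pathWeight_snoc (n : ℕ) (X : Fin (n + 1) → α) (y : α) :
    pathWeight V κ (n + 1) (Fin.snoc (α := fun _ => α) X y) =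
      pathWeight V κ n X * (V (n + 1) y * κ (X (Fin.last n)) y) := by
  have h : ∀ i : Fin n, (i.castSucc).succ = (i.succ).castSucc := fun i => rfl
  have h' : (Fin.last n).succ = Fin.last (n + 1) := rfl
  rw [pathWeight, pathWeight, Fin.prod_univ_castSucc (n := n + 1),
    Fin.prod_univ_castSucc (n := n) (fun i => κ _ _)]
  simp only [Fin.snoc_castSucc, Fin.snoc_last, h, h', Fin.val_castSucc, Fin.val_last]
  ring

variable [Fintype α]

/-- The sum over the paths up to time `n` that end at a given point. -/
def forwardSum : ℕ → α → ℂ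
  | 0, x => V 0 x
  | n + 1, y => V (n + 1) y * ∑ x, κ x y * forwardSum n x

/-- The sum over the paths of length `r` that start at a given point at time `t`, without the weight
of that point. -/
def backwardSum : ℕ → ℕ → α → ℂ
  | _, 0, _ => 1
  | t, r + 1, x => ∑ y, κ x y * (V (t + 1) y * backwardSum (t + 1) r y)

lemma sum_pathWeight_mul (n : ℕ) (b : α → ℂ) :
    ∑ X : Fin (n + 1) → α, pathWeight V κ n X * b (X (Fin.last n)) =
      ∑ x, forwardSum V κ n x * b x := by
  induction n generalizing b with
  | zero =>
    rw [← (Equiv.funUnique (Fin 1) α).symm.sum_comp]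
    refine sum_congr rfl fun x _ => ?_
    simp [pathWeight, forwardSum]
  | succ n ih =>
    rw [← (Fin.snocEquiv fun _ => α).sum_comp, Fintype.sum_prod_type, sum_comm]
    have : ∀ X : Fin (n + 1) → α, ∑ y, pathWeight V κ (n + 1) (Fin.snocEquiv (fun _ => α) (y, X)) *
        b (Fin.snocEquiv (fun _ => α) (y, X) (Fin.last (n + 1))) =
        pathWeight V κ n X * ∑ y, V (n + 1) y * κ (X (Fin.last n)) y * b y := by
      intro X
      rw [mul_sum]
      refine sum_congr rfl fun y _ => ?_
      have e : Fin.snocEquiv (fun _ => α) (y, X) = Fin.snoc (α := fun _ => α) X y := rfl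
      rw [e, pathWeight_snoc, Fin.snoc_last]
      ring
    refine (sum_congr rfl fun X _ => this X).trans ?_
    rw [ih fun x => ∑ y, V (n + 1) y * κ x y * b y]
    simp only [forwardSum, mul_sum, sum_mul]
    rw [sum_comm]
    refine sum_congr rfl fun y _ => sum_congr rfl fun x _ => ?_
    ring

/-- Cutting at any time t gives the same total: moving one factor of the transfer matrix across the
cut is an interchange of two sums. -/
lemma sum_forwardSum (t r : ℕ) :
    ∑ x, forwardSum V κ (t + r) x = ∑ x, forwardSum V κ t x * backwardSum V κ t r x := by
  induction r generalizing t with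
  | zero => simp [backwardSum]
  | succ r ih =>
    rw [← add_assoc, add_right_comm, ih]
    simp only [forwardSum, backwardSum, mul_sum, sum_mul]
    rw [sum_comm]
    refine sum_congr rfl fun y _ => sum_congr rfl fun x _ => ?_
    ring

variable {V}

lemma forwardSum_congr {V' : ℕ → α → ℂ} {t : ℕ} (h : ∀ i ≤ t, ∀ x, V i x = V' i x) (x : α) :
    forwardSum V κ t x = forwardSum V' κ t x := by
  induction t generalizing x with
  | zero => exact h 0 le_rfl x
  | succ t ih =>
    rw [forwardSum, forwardSum, h _ le_rfl]
    congr 1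
    exact sum_congr rfl fun y _ => by rw [ih fun i hi => h i (by omega)]

lemma backwardSum_congr {V' : ℕ → α → ℂ} {t r : ℕ} (h : ∀ i, t < i → ∀ x, V i x = V' i x) (x : α) :
    backwardSum V κ t r x = backwardSum V' κ t r x := by
  induction r generalizing t x with
  | zero => rfl
  | succ r ih =>
    rw [backwardSum, backwardSum]
    exact sum_congr rfl fun y _ => by
      rw [h _ (by omega), ih fun i hi => h i (by omega)]

variable (V)

-- Prescribing the state at time t amounts to setting its weight to zero at all other states. The
-- total for the modified weights then reduces to one summand of the decomposition at t, and neither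
-- the backward sum nor the earlier part of the forward sum is affected.
open scoped Classical in
lemma sum_pathWeight_filter (t r : ℕ) (x : α) (i : Fin (t + r + 1)) (hi : (i : ℕ) = t) :
    ∑ X ∈ univ.filter (fun X : Fin (t + r + 1) → α => X i = x), pathWeight V κ (t + r) X =
      forwardSum V κ t x * backwardSum V κ t r x := by
  set V' : ℕ → α → ℂ := fun j y => if j = t ∧ y ≠ x then 0 else V j y with hV'
  have h1 : ∀ X : Fin (t + r + 1) → α, pathWeight V' κ (t + r) X =
      if X i = x then pathWeight V κ (t + r) X else 0 := by
    intro X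
    split_ifs with h
    · rw [pathWeight, pathWeight]
      congr 1
      refine prod_congr rfl fun j _ => ?_
      rw [hV']
      refine if_neg ?_
      rintro ⟨hj, hx⟩
      have : j = i := Fin.ext (hj.trans hi.symm)
      exact hx (this ▸ h)
    · rw [pathWeight, prod_eq_zero (mem_univ i), zero_mul]
      exact if_pos ⟨hi, h⟩
  have h2 := sum_pathWeight_mul V' κ (t + r) fun _ => 1
  simp only [mul_one, h1] at h2
  rw [sum_filter, h2, sum_forwardSum]
  have h3 : ∀ y, forwardSum V' κ t y = if y = x then forwardSum V κ t x else 0 := by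
    intro y
    by_cases hy : y = x
    · subst hy
      rw [if_pos rfl]
      cases t with
      | zero => simp [forwardSum, hV']
      | succ t =>
        rw [forwardSum, forwardSum]
        congr 1
        · simp [hV']
        · refine sum_congr rfl fun z _ => ?_
          rw [forwardSum_congr κ fun j hj z => ?_]
          exact if_neg fun h => absurd h.1 (by omega)
    · rw [if_neg hy]
      cases t with
      | zero => simp [forwardSum, hV', hy]
      | succ t => rw [forwardSum]; simp [hV', hy]
  simp only [h3, ite_mul, zero_mul, sum_ite_eq', mem_univ, if_true]
  congr 1
  exact backwardSum_congr κ (fun j hj z => if_neg fun h => absurd h.1 (by omega)) x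

/-- Turns a sum over admissible neighbours x into a sum over all moves e in a larger set β, provided
G vanishes at every target outside the configuration space. It connects the sum over configurations
with the 2^N moves of the transfer identity. -/
lemma sum_steps {β ε : Type*} [Fintype ε] [DecidableEq ε] {ι : α → β} (hι : Function.Injective ι)
    {m : ε → β} (hm : Function.Injective m) {k H : α → ℂ} {G : β → ℂ}
    (hk1 : ∀ x e, ι x = m e → k x = 1) (hk0 : ∀ x, (∀ e, ι x ≠ m e) → k x = 0)
    (hH : ∀ x e, ι x = m e → H x = G (m e)) (hG : ∀ e, (∀ x, ι x ≠ m e) → G (m e) = 0) :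
    ∑ x, k x * H x = ∑ e, G (m e) := by
  classical
  have h1 : ∀ e, G (m e) = ∑ x, if ι x = m e then H x else 0 := by
    intro e
    by_cases h : ∃ x, ι x = m e
    · obtain ⟨x, hx⟩ := h
      rw [sum_eq_single x, if_pos hx, hH x e hx]
      · intro y _ hy
        exact if_neg fun h => hy (hι (h.trans hx.symm))
      · simp
    · push Not at h
      rw [hG e h]
      exact (sum_eq_zero fun x _ => if_neg (h x)).symm
  simp only [h1]
  rw [sum_comm]
  refine sum_congr rfl fun x _ => ?_
  by_cases h : ∃ e, ι x = m e
  · obtain ⟨e, he⟩ := h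
    rw [hk1 x e he, one_mul, sum_eq_single e, if_pos he]
    · intro e' _ hne
      exact if_neg fun h' => hne (hm (h'.symm.trans he))
    · simp
  · push Not at h
    rw [hk0 x h, zero_mul]
    exact (sum_eq_zero fun e _ => if_neg (h e)).symm

end TransferMatrix

end EllipticTilings

/-! ### Tilings as weighted paths of line configurations -/

namespace EllipticTilings

section Model

open scoped Classical in
/-- The transfer weight of a configuration on a line: the product of the weights of its holes. -/
def lineWeight (N S T : ℕ) (p s r₁ r₂ : ℂ) (t : ℕ) (x : Fin N → Fin (S + N)) : ℂ :=
  if x ∈ lineConfigs N S T t then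
    ∏ y ∈ (sites N S T t).filter (fun y => ∀ k, x k ≠ y),
      lozengeWeight p s r₁ r₂ S t (2 * ((y : ℕ) : ℤ) + 2 - t)
  else 0

open scoped Classical in
/-- The indicator function of a step. -/
def stepIndicator {N M : ℕ} (x y : Fin N → Fin M) : ℂ :=
  if ∀ k, (y k : ℕ) = x k ∨ (y k : ℕ) = x k + 1 then 1 else 0

/-- The positions as integers. -/
def toInt {N M : ℕ} (x : Fin N → Fin M) : Fin N → ℤ := fun k => ((x k : ℕ) : ℤ)

lemma toInt_injective {N M : ℕ} : Function.Injective (toInt (N := N) (M := M)) := by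
  intro x y h
  funext k
  have := congrFun h k
  simp only [toInt] at this
  exact Fin.ext (by exact_mod_cast this)

lemma strictMono_toInt {N M : ℕ} {x : Fin N → Fin M} : StrictMono (toInt x) ↔ StrictMono x := by
  refine forall_congr' fun i => forall_congr' fun j => imp_congr Iff.rfl ?_
  simp [toInt]

variable {N S T : ℕ} {p s r₁ r₂ : ℂ}

lemma mem_sites {t : ℕ} {x : Fin (S + N)} :
    x ∈ sites N S T t ↔ IsSite N S T t ((x : ℕ) : ℤ) := by
  have := x.2
  simp only [sites, mem_filter, mem_univ, true_and, IsSite]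
  omega

lemma mem_lineConfigs {t : ℕ} {x : Fin N → Fin (S + N)} :
    x ∈ lineConfigs N S T t ↔ StrictMono (toInt x) ∧ ∀ k, IsSite N S T t (toInt x k) := by
  simp only [lineConfigs, mem_filter, mem_univ, true_and, mem_sites, strictMono_toInt]
  exact Iff.rfl

lemma exists_toInt_eq {t : ℤ} {z : Fin N → ℤ} (hz : ∀ k, IsSite N S T t (z k)) :
    ∃ x : Fin N → Fin (S + N), toInt x = z := by
  refine ⟨fun k => ⟨(z k).toNat, ?_⟩, funext fun k => ?_⟩
  · obtain ⟨h0, h1, h2, h3⟩ := hz k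
    omega
  · have := (hz k).1
    simp only [toInt]
    omega

lemma strictMono_add_le {z : Fin N → ℤ} (hz : StrictMono z) {i j : Fin N} (hij : i ≤ j) :
    z i + ((j : ℕ) - (i : ℕ)) ≤ z j := by
  obtain ⟨j, hj⟩ := j
  obtain ⟨i, hi⟩ := i
  simp only [Fin.mk_le_mk] at hij ⊢
  induction j, hij using Nat.le_induction with
  | base => simp
  | succ j hij ih =>
    have h1 := ih (by omega)
    have h2 : z ⟨j, by omega⟩ < z ⟨j + 1, hj⟩ := hz (by simp)
    push_cast
    linarith

lemma isPathFamily_iff (X : Fin (T + 1) → Fin N → Fin (S + N)) :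
    IsPathFamily N S T X ↔ (∀ t : Fin (T + 1), X t ∈ lineConfigs N S T t) ∧
      ∀ (t : Fin T) (k : Fin N),
        (X t.succ k : ℕ) = X t.castSucc k ∨ (X t.succ k : ℕ) = X t.castSucc k + 1 := by
  constructor
  · rintro ⟨h0, hT, hm, hs⟩
    refine ⟨fun t => mem_lineConfigs.mpr ⟨strictMono_toInt.mpr (hm t), fun k => ?_⟩, hs⟩
    have up : ∀ (n : ℕ) (hn : n < T + 1), (X ⟨n, hn⟩ k : ℕ) ≤ k + n := by
      intro n
      induction n with
      | zero => intro hn; exact (h0 k).le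
      | succ n ih =>
        intro hn
        have h1 := ih (by omega)
        have h2 : (X ⟨n + 1, hn⟩ k : ℕ) = X ⟨n, by omega⟩ k ∨
          (X ⟨n + 1, hn⟩ k : ℕ) = X ⟨n, by omega⟩ k + 1 := hs ⟨n, by omega⟩ k
        omega
    have down : ∀ (n : ℕ) (hn : n ≤ T), S + k ≤ (X ⟨T - n, by omega⟩ k : ℕ) + n := by
      intro n
      induction n with
      | zero => intro hn; exact (hT k).ge
      | succ n ih =>
        intro hn
        have h1 := ih (by omega)
        have h2 : (X ⟨T - (n + 1) + 1, by omega⟩ k : ℕ) = X ⟨T - (n + 1), by omega⟩ k ∨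
          (X ⟨T - (n + 1) + 1, by omega⟩ k : ℕ) = X ⟨T - (n + 1), by omega⟩ k + 1 :=
          hs ⟨T - (n + 1), by omega⟩ k
        have e : (⟨T - (n + 1) + 1, by omega⟩ : Fin (T + 1)) = ⟨T - n, by omega⟩ :=
          Fin.ext (by simp only; omega)
        rw [e] at h2
        omega
    have h1 := up t t.2
    have h2 := down (T - t) (by omega)
    have e : (⟨T - (T - t), by omega⟩ : Fin (T + 1)) = t := Fin.ext (by simp only; omega)
    rw [e] at h2
    have h3 := (X t k).2
    have h4 := k.2
    have h5 := t.2
    simp only [IsSite, toInt, Fin.eta] at h1 ⊢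
    omega
  · rintro ⟨hc, hs⟩
    have hm : ∀ t, StrictMono (toInt (X t)) := fun t => (mem_lineConfigs.mp (hc t)).1
    refine ⟨fun k => ?_, fun k => ?_, fun t => strictMono_toInt.mp (hm t), hs⟩
    · obtain ⟨h1, h2⟩ := mem_lineConfigs.mp (hc 0)
      have hN := k.2
      have a1 := strictMono_add_le h1 (i := ⟨0, by omega⟩) (j := k) (by simp [Fin.le_def])
      have a2 := strictMono_add_le h1 (i := k) (j := ⟨N - 1, by omega⟩)
        (by simp only [Fin.le_def]; omega)
      obtain ⟨b1, b2, b3, b4⟩ := h2 ⟨0, by omega⟩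
      obtain ⟨c1, c2, c3, c4⟩ := h2 ⟨N - 1, by omega⟩
      simp only [toInt, Fin.val_zero] at *
      omega
    · obtain ⟨h1, h2⟩ := mem_lineConfigs.mp (hc (Fin.last T))
      have hN := k.2
      have a1 := strictMono_add_le h1 (i := ⟨0, by omega⟩) (j := k) (by simp [Fin.le_def])
      have a2 := strictMono_add_le h1 (i := k) (j := ⟨N - 1, by omega⟩)
        (by simp only [Fin.le_def]; omega)
      obtain ⟨b1, b2, b3, b4⟩ := h2 ⟨0, by omega⟩
      obtain ⟨c1, c2, c3, c4⟩ := h2 ⟨N - 1, by omega⟩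
      simp only [toInt, Fin.val_last] at *
      omega

lemma lineConfigs_subsingleton {t : ℕ} (ht : t = 0 ∨ t = T) {x y : Fin N → Fin (S + N)}
    (hx : x ∈ lineConfigs N S T t) (hy : y ∈ lineConfigs N S T t) : x = y := by
  refine toInt_injective (funext fun k => ?_)
  obtain ⟨h1, h2⟩ := mem_lineConfigs.mp hx
  obtain ⟨h1', h2'⟩ := mem_lineConfigs.mp hy
  have hN := k.2
  have a1 := strictMono_add_le h1 (i := ⟨0, by omega⟩) (j := k) (by simp [Fin.le_def])
  have a2 := strictMono_add_le h1 (i := k) (j := ⟨N - 1, by omega⟩)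
    (by simp only [Fin.le_def]; omega)
  have a1' := strictMono_add_le h1' (i := ⟨0, by omega⟩) (j := k) (by simp [Fin.le_def])
  have a2' := strictMono_add_le h1' (i := k) (j := ⟨N - 1, by omega⟩)
    (by simp only [Fin.le_def]; omega)
  obtain ⟨b1, b2, b3, b4⟩ := h2 ⟨0, by omega⟩
  obtain ⟨c1, c2, c3, c4⟩ := h2 ⟨N - 1, by omega⟩
  obtain ⟨b1', b2', b3', b4'⟩ := h2' ⟨0, by omega⟩
  obtain ⟨c1', c2', c3', c4'⟩ := h2' ⟨N - 1, by omega⟩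
  simp only [] at a1 a2 a1' a2'
  rcases ht with rfl | rfl <;> push_cast at * <;> omega

open scoped Classical in
lemma pathWeight_eq (X : Fin (T + 1) → Fin N → Fin (S + N)) :
    pathWeight (lineWeight N S T p s r₁ r₂) stepIndicator T X =
      if IsPathFamily N S T X then tilingWeight N S T p s r₁ r₂ X else 0 := by
  split_ifs with h
  · obtain ⟨h1, h2⟩ := (isPathFamily_iff X).mp h
    have e : ∏ i : Fin T, stepIndicator (X i.castSucc) (X i.succ) = 1 :=
      prod_eq_one fun t _ => if_pos (h2 t)
    rw [pathWeight, tilingWeight, e, mul_one]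
    refine prod_congr rfl fun t _ => ?_
    rw [lineWeight, if_pos (h1 t)]
  · rw [isPathFamily_iff, not_and_or] at h
    rcases h with h | h
    · push Not at h
      obtain ⟨t, ht⟩ := h
      rw [pathWeight, prod_eq_zero (mem_univ t) (if_neg ht), zero_mul]
    · push Not at h
      obtain ⟨t, k, hk⟩ := h
      rw [pathWeight, prod_eq_zero (i := t) (s := univ) (f := fun i : Fin T => stepIndicator _ _)
        (mem_univ t) (if_neg fun h => ?_), mul_zero]
      rcases h k with h | h
      · exact hk.1 h
      · exact hk.2 h

open scoped Classical in
/-- The mass of the tilings with a given configuration on the line `t`. -/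
lemma sum_tilingWeight_filter {t r : ℕ} (h : T = t + r) (i : Fin (T + 1)) (hi : (i : ℕ) = t)
    (x : Fin N → Fin (S + N)) :
    ∑ X ∈ (pathFamilies N S T).filter (fun X => X i = x), tilingWeight N S T p s r₁ r₂ X =
      forwardSum (lineWeight N S T p s r₁ r₂) stepIndicator t x *
        backwardSum (lineWeight N S T p s r₁ r₂) stepIndicator t r x := by
  subst h
  rw [← sum_pathWeight_filter _ _ t r x i hi]
  simp only [pathWeight_eq, pathFamilies, filter_filter]
  rw [← sum_filter, filter_filter]
  refine sum_congr ?_ fun _ _ => rfl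
  ext X
  simp only [mem_filter, mem_univ, true_and]
  exact and_comm

lemma forwardSum_eq_zero {t : ℕ} {x : Fin N → Fin (S + N)} (hx : x ∉ lineConfigs N S T t) :
    forwardSum (lineWeight N S T p s r₁ r₂) stepIndicator t x = 0 := by
  have h : lineWeight N S T p s r₁ r₂ t x = 0 := if_neg hx
  cases t with
  | zero => exact h
  | succ t => rw [forwardSum, h, zero_mul]

/-- The elementary prefactor of the lozenge weight is precisely the one that disappears when all
theta functions are replaced by their odd versions. -/
lemma lozengeWeight_eq (hs : s ≠ 0) (hr₁ : r₁ ≠ 0) (hr₂ : r₂ ≠ 0) (t x : ℤ) :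
    lozengeWeight p s r₁ r₂ S t (2 * x + 2 - t) = holeWeight S p s r₁ r₂ t x := by
  have e : ∀ (k : ℤ) (w : ℂ), w ≠ 0 → theta p (s ^ (2 * k) * w ^ 2) = s ^ k * w * br p s w k := by
    intro k w hw
    rw [br, ← theta_sq (by positivity), mul_pow, ← zpow_natCast (s ^ k), ← zpow_mul,
      mul_comm k]
    rfl
  rw [lozengeWeight, holeWeight, ← mul_pow r₁ r₂,
    show 2 * (2 * x + 2 - t - S - 1) = 2 * (2 * x + 1 - t - S) by ring,
    show 2 * x + 2 - t - S - 1 = 2 * x + 1 - t - S by ring,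
    show 2 * x + 2 - t - 3 * t - 2 * S - 2 = 2 * (x - 2 * t - S) by ring,
    show 2 * x + 2 - t - 3 * t - 2 * S = 2 * (x - 2 * t - S + 1) by ring,
    show 2 * x + 2 - t + 3 * t - 2 = 2 * (x + t) by ring,
    show 2 * x + 2 - t + 3 * t = 2 * (x + t + 1) by ring,
    e _ _ (mul_ne_zero hr₁ hr₂), e _ _ hr₁, e _ _ hr₁, e _ _ hr₂, e _ _ hr₂]
  have h2 : s ^ (2 * x + 1 - t - S) * s ^ (2 * x + 1 - t - S) =
      s ^ (x - 2 * t - S) * s ^ (x - 2 * t - S + 1) * s ^ (x + t) * s ^ (x + t + 1) := by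
    simp only [← zpow_add₀ hs]
    congr 1
    ring
  have h3 : r₁ * r₂ * s ^ (2 * x + 1 - t - S) *
      (s ^ (2 * x + 1 - t - S) * (r₁ * r₂) * br p s (r₁ * r₂) (2 * x + 1 - t - S)) =
      (s ^ (x - 2 * t - S) * s ^ (x - 2 * t - S + 1) * s ^ (x + t) * s ^ (x + t + 1) *
        (r₁ * r₂) ^ 2) * br p s (r₁ * r₂) (2 * x + 1 - t - S) := by
    rw [← h2]; ring
  have h4 : s ^ (x - 2 * t - S) * r₁ * br p s r₁ (x - 2 * t - S) *
      (s ^ (x - 2 * t - S + 1) * r₁ * br p s r₁ (x - 2 * t - S + 1)) *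
      (s ^ (x + t) * r₂ * br p s r₂ (x + t)) * (s ^ (x + t + 1) * r₂ * br p s r₂ (x + t + 1)) =
      (s ^ (x - 2 * t - S) * s ^ (x - 2 * t - S + 1) * s ^ (x + t) * s ^ (x + t + 1) *
        (r₁ * r₂) ^ 2) * (br p s r₁ (x - 2 * t - S) * br p s r₁ (x - 2 * t - S + 1) *
      (br p s r₂ (x + t) * br p s r₂ (x + t + 1))) := by ring
  rw [h3, h4, mul_div_mul_left _ _ (by positivity)]

variable (nd : Nondegenerate N S T p s r₁ r₂)
include nd

/-- Holes and particles partition the sites, so up to a constant of the line a product over holes is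
the reciprocal of a product over particles. The multiplicative form avoids any non-vanishing
assumption. -/
lemma lineWeight_mul_prod {t : ℕ} {x : Fin N → Fin (S + N)} (hx : x ∈ lineConfigs N S T t) :
    lineWeight N S T p s r₁ r₂ t x * ∏ k, holeWeight S p s r₁ r₂ t (toInt x k) =
      ∏ y ∈ sites N S T t, holeWeight S p s r₁ r₂ t ((y : ℕ) : ℤ) := by
  classical
  rw [lineWeight, if_pos hx]
  obtain ⟨h1, h2⟩ := mem_lineConfigs.mp hx
  have hinj : Function.Injective x := by
    intro i j hij
    exact h1.injective (by simp only [toInt, hij])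
  rw [← prod_filter_mul_prod_filter_not (sites N S T t) (fun y => ∀ k, x k ≠ y)]
  congr 1
  · refine prod_congr (by ext; simp) fun y _ => ?_
    rw [← lozengeWeight_eq nd.s_ne nd.r₁_ne nd.r₂_ne]
  · symm
    refine prod_bij' (i := fun y hy => (show ∃ k, x k = y by
      simpa using (mem_filter.mp hy).2).choose) (j := fun k _ => x k) ?_ ?_ ?_ ?_ ?_
    · simp
    · intro k _
      refine mem_filter.mpr ⟨mem_sites.mpr (h2 k), ?_⟩
      push Not
      exact ⟨k, rfl⟩
    · intro y hy
      exact (show ∃ k, x k = y by simpa using (mem_filter.mp hy).2).choose_spec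
    · intro k hk
      have : ∃ k', x k' = x k := ⟨k, rfl⟩
      exact hinj this.choose_spec
    · intro y hy
      have := (show ∃ k, x k = y by simpa using (mem_filter.mp hy).2).choose_spec
      simp only [toInt, this]

lemma thetaKernel_sitePos {t x y : ℤ} : thetaKernel p (sitePos S s r₁ r₂ t x)
    (sitePos S s r₁ r₂ t y) = br p s 1 (x - y) * br p s (r₁ * r₂) (x + y + 1 - t - S) := by
  have hs := nd.s_ne
  have hr₁ := nd.r₁_ne
  have hr₂ := nd.r₂_ne
  have e : sitePos S s r₁ r₂ t x / sitePos S s r₁ r₂ t y =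
      s ^ (2 * x + 1 - t - S) * 1 * (s ^ (-(2 * y + 1 - t - S)) * 1) := by
    rw [sitePos, sitePos, zpow_neg]
    field_simp
  rw [thetaKernel, e, theta_lattice (w := 1) (k := x - y) hs one_ne_zero (by ring) (by ring),
    sitePos, sitePos, theta_lattice (w := r₁ * r₂) (k := x + y + 1 - t - S) hs (by positivity)
    (by ring) (by ring)]
  have h : s ^ (2 * x + 1 - t - S) = s ^ (x + y + 1 - t - S) * s ^ (x - y) := by
    rw [← zpow_add₀ hs]
    congr 1
    ring
  rw [h]
  field_simp

lemma kernelVandermonde_ne_zero {t : ℤ} (ht : 0 ≤ t) (htT : t ≤ T) {z : Fin N → ℤ}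
    (hz : StrictMono z) (hzs : ∀ k, IsSite N S T t (z k)) :
    kernelVandermonde p (fun k => sitePos S s r₁ r₂ t (z k)) ≠ 0 := by
  refine prod_ne_zero_iff.mpr fun k _ => prod_ne_zero_iff.mpr fun l hl => ?_
  have hkl := hz (mem_Ioi.mp hl)
  obtain ⟨h0, h1, h2, h3⟩ := hzs k
  obtain ⟨h0', h1', h2', h3'⟩ := hzs l
  have hS := nd.S_le
  have hS0 := nd.S_nonneg
  rw [thetaKernel_sitePos nd]
  exact mul_ne_zero (nd.e_ne' (by omega) (by omega) (by omega)) (nd.c_ne _ (by omega) (by omega))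

/-- This removes from the transfer sums the moves after which two paths meet. -/
lemma kernelVandermonde_eq_zero {t : ℤ} {z : Fin N → ℤ} {k l : Fin N} (hkl : k < l)
    (h : z k = z l) : kernelVandermonde p (fun k => sitePos S s r₁ r₂ t (z k)) = 0 := by
  refine prod_eq_zero (mem_univ k) (prod_eq_zero (mem_Ioi.mpr hkl) ?_)
  rw [thetaKernel_sitePos nd, h, sub_self, br_one_zero nd.norm_lt, zero_mul]

end Model

end EllipticTilings

/-! ### Left and right partial sums, and the marginal on a line -/

namespace EllipticTilings

section Marginals

variable {N S T : ℕ} {p s r₁ r₂ : ℂ} (nd : Nondegenerate N S T p s r₁ r₂)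

/-- The Vandermonde product at the sites `z` of the line `t`. -/
def siteVandermonde (S : ℤ) (p s r₁ r₂ : ℂ) {N : ℕ} (t : ℤ) (z : Fin N → ℤ) : ℂ :=
  kernelVandermonde p (fun k => sitePos S s r₁ r₂ t (z k))

lemma stepSize_injective : Function.Injective stepSize := by decide

lemma eq_or_eq_stepSize {a b : ℤ} (h : b = a ∨ b = a + 1) : ∃ e, b = a + stepSize e := by
  rcases h with h | h
  · exact ⟨false, by simp [stepSize, h]⟩
  · exact ⟨true, by simp [stepSize, h]⟩

lemma stepSize_eq (e : Bool) : stepSize e = 0 ∨ stepSize e = 1 := by cases e <;> simp [stepSize]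

lemma stepIndicator_eq_one {M : ℕ} {x y : Fin N → Fin M} {e : Fin N → Bool}
    (h : ∀ k, toInt y k = toInt x k + stepSize (e k)) : stepIndicator x y = 1 := by
  refine if_pos fun k => ?_
  have h1 := h k
  have h2 := stepSize_eq (e k)
  simp only [toInt] at h1
  omega

lemma stepIndicator_eq_zero {M : ℕ} {x y : Fin N → Fin M}
    (h : ∀ e : Fin N → Bool, ¬ ∀ k, toInt y k = toInt x k + stepSize (e k)) :
    stepIndicator x y = 0 := by
  refine if_neg fun h' => ?_
  have : ∀ k, ∃ e, toInt y k = toInt x k + stepSize e := fun k => eq_or_eq_stepSize (by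
    simp only [toInt]
    have := h' k
    omega)
  choose e he using this
  exact h e he

include nd

/-- The legal predecessors may be replaced by all 2^N of them. Two ordered particles can at worst
coincide after one step, which kills the Vandermonde product, and a backward step from a site of
line t + 1 can leave the sites of line t only at the boundaries guarded by the two `brRec` factors.
-/
lemma sum_stepIndicator_left {t : ℕ} {y : Fin N → Fin (S + N)}
    (hy : y ∈ lineConfigs N S T (t + 1)) {H : (Fin N → Fin (S + N)) → ℂ} {c : ℂ}
    (h0 : ∀ x, x ∉ lineConfigs N S T t → H x = 0)
    (h1 : ∀ x ∈ lineConfigs N S T t, H x = c * ((∏ k, leftWeight N S T p s r₁ r₂ t (toInt x k)) *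
      siteVandermonde S p s r₁ r₂ t (toInt x))) :
    ∑ x, stepIndicator x y * H x = c * ∑ e : Fin N → Bool,
      (∏ k, leftWeight N S T p s r₁ r₂ t (toInt y k - stepSize (e k))) *
        siteVandermonde S p s r₁ r₂ t (fun k => toInt y k - stepSize (e k)) := by
  obtain ⟨hm, hs⟩ := mem_lineConfigs.mp hy
  have key : ∀ e : Fin N → Bool,
      (¬ ((StrictMono fun k => toInt y k - stepSize (e k)) ∧
        ∀ k, IsSite N S T t (toInt y k - stepSize (e k)))) →
      (∏ k, leftWeight N S T p s r₁ r₂ t (toInt y k - stepSize (e k))) *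
        siteVandermonde S p s r₁ r₂ t (fun k => toInt y k - stepSize (e k)) = 0 := by
    intro e he
    rw [not_and_or] at he
    rcases he with he | he
    · simp only [StrictMono, not_forall] at he
      obtain ⟨i, j, hij, h⟩ := he
      have h1 := hm hij
      have h2 := stepSize_eq (e i)
      have h3 := stepSize_eq (e j)
      rw [siteVandermonde, kernelVandermonde_eq_zero nd (z := fun k => toInt y k - stepSize (e k))
        hij (by omega), mul_zero]
    · push Not at he
      obtain ⟨k, hk⟩ := he
      rw [prod_eq_zero (mem_univ k), zero_mul]
      have h2 := stepSize_eq (e k)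
      obtain ⟨a1, a2, a3, a4⟩ := hs k
      simp only [IsSite] at hk
      have h3 : toInt y k - stepSize (e k) < 0 ∨ (N : ℤ) + t - 1 - (toInt y k - stepSize (e k)) < 0 := by
        push_cast at *
        omega
      rcases h3 with h3 | h3
      · simp only [leftWeight, brRec, if_neg (not_le.mpr h3)]
        simp
      · simp only [leftWeight, brRec, if_neg (not_le.mpr h3)]
        simp
  rw [mul_sum]
  refine sum_steps (ι := toInt) toInt_injective (m := fun (e : Fin N → Bool) k =>
    toInt y k - stepSize (e k)) (k := fun x => stepIndicator x y) (H := H) (G := fun z =>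
      c * ((∏ k, leftWeight N S T p s r₁ r₂ t (z k)) * siteVandermonde S p s r₁ r₂ t z))
      ?_ ?_ ?_ ?_ ?_
  · intro e e' h
    funext k
    have := congrFun h k
    exact stepSize_injective (by simpa using this)
  · intro x e h
    exact stepIndicator_eq_one (e := e) fun k => by rw [h]; ring
  · intro x h
    refine stepIndicator_eq_zero fun e he => h e (funext fun k => ?_)
    rw [he k]; ring
  · intro x e h
    by_cases hx : x ∈ lineConfigs N S T t
    · rw [h1 x hx, h]
    · rw [h0 x hx]
      rw [mem_lineConfigs, h] at hx
      rw [key e hx, mul_zero]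
  · intro e h
    rw [key e, mul_zero]
    rintro ⟨-, h2⟩
    obtain ⟨x, hx⟩ := exists_toInt_eq h2
    exact h x hx

lemma sum_stepIndicator_right {t : ℕ} {x : Fin N → Fin (S + N)}
    (hx : x ∈ lineConfigs N S T t) {H : (Fin N → Fin (S + N)) → ℂ} {c : ℂ}
    (h0 : ∀ y, y ∉ lineConfigs N S T (t + 1) → H y = 0)
    (h1 : ∀ y ∈ lineConfigs N S T (t + 1), H y =
      c * ((∏ k, rightWeight N S T p s r₁ r₂ (t + 1) (toInt y k)) *
        siteVandermonde S p s r₁ r₂ (t + 1) (toInt y))) :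
    ∑ y, stepIndicator x y * H y = c * ∑ e : Fin N → Bool,
      (∏ k, rightWeight N S T p s r₁ r₂ (t + 1) (toInt x k + stepSize (e k))) *
        siteVandermonde S p s r₁ r₂ (t + 1) (fun k => toInt x k + stepSize (e k)) := by
  obtain ⟨hm, hs⟩ := mem_lineConfigs.mp hx
  have key : ∀ e : Fin N → Bool,
      (¬ ((StrictMono fun k => toInt x k + stepSize (e k)) ∧
        ∀ k, IsSite N S T (t + 1 : ℕ) (toInt x k + stepSize (e k)))) →
      (∏ k, rightWeight N S T p s r₁ r₂ (t + 1) (toInt x k + stepSize (e k))) *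
        siteVandermonde S p s r₁ r₂ (t + 1) (fun k => toInt x k + stepSize (e k)) = 0 := by
    intro e he
    rw [not_and_or] at he
    rcases he with he | he
    · simp only [StrictMono, not_forall] at he
      obtain ⟨i, j, hij, h⟩ := he
      have h1 := hm hij
      have h2 := stepSize_eq (e i)
      have h3 := stepSize_eq (e j)
      rw [siteVandermonde, kernelVandermonde_eq_zero nd (z := fun k => toInt x k + stepSize (e k))
        hij (by omega), mul_zero]
    · push Not at he
      obtain ⟨k, hk⟩ := he
      rw [prod_eq_zero (mem_univ k), zero_mul]
      have h2 := stepSize_eq (e k)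
      obtain ⟨a1, a2, a3, a4⟩ := hs k
      simp only [IsSite] at hk
      have h3 : toInt x k + stepSize (e k) - (t + 1) - S + T < 0 ∨
          (S : ℤ) + N - 1 - (toInt x k + stepSize (e k)) < 0 := by
        push_cast at *
        omega
      rcases h3 with h3 | h3
      · simp only [rightWeight, brRec, if_neg (not_le.mpr h3)]
        simp
      · simp only [rightWeight, brRec, if_neg (not_le.mpr h3)]
        simp
  rw [mul_sum]
  refine sum_steps (ι := toInt) toInt_injective (m := fun (e : Fin N → Bool) k =>
    toInt x k + stepSize (e k)) (k := fun y => stepIndicator x y) (H := H) (G := fun z =>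
      c * ((∏ k, rightWeight N S T p s r₁ r₂ (t + 1) (z k)) *
        siteVandermonde S p s r₁ r₂ (t + 1) z)) ?_ ?_ ?_ ?_ ?_
  · intro e e' h
    funext k
    have := congrFun h k
    exact stepSize_injective (by simpa using this)
  · intro y e h
    exact stepIndicator_eq_one (e := e) fun k => by rw [h]
  · intro y h
    exact stepIndicator_eq_zero fun e he => h e (funext fun k => he k)
  · intro y e h
    by_cases hy : y ∈ lineConfigs N S T (t + 1)
    · rw [h1 y hy, h]
    · rw [h0 y hy]
      rw [mem_lineConfigs, h] at hy
      rw [key e hy, mul_zero]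
  · intro e h
    rw [key e, mul_zero]
    rintro ⟨-, h2⟩
    obtain ⟨y, hy⟩ := exists_toInt_eq h2
    exact h y hy

/-- Induction on lines: `exists_left_transfer` moves the product form from line t to line t + 1, and
`lineWeight_mul_prod` with `leftStep_mul_eq` turns the weight of the new holes into the missing
factors at the new particles. -/
lemma forwardSum_eq {t : ℕ} (htT : t < T) :
    ∃ c : ℂ, ∀ x ∈ lineConfigs N S T t,
      forwardSum (lineWeight N S T p s r₁ r₂) stepIndicator t x =
        c * ((∏ k, leftWeight N S T p s r₁ r₂ t (toInt x k)) *
          siteVandermonde S p s r₁ r₂ t (toInt x)) := by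
  induction t with
  | zero =>
    by_cases h : ∃ x₀, x₀ ∈ lineConfigs N S T 0
    · obtain ⟨x₀, hx₀⟩ := h
      obtain ⟨hm, hs⟩ := mem_lineConfigs.mp hx₀
      refine ⟨forwardSum (lineWeight N S T p s r₁ r₂) stepIndicator 0 x₀ /
        ((∏ k, leftWeight N S T p s r₁ r₂ (0 : ℕ) (toInt x₀ k)) *
          siteVandermonde S p s r₁ r₂ (0 : ℕ) (toInt x₀)), fun x hx => ?_⟩
      rw [lineConfigs_subsingleton (Or.inl rfl) hx hx₀, div_mul_cancel₀]
      refine mul_ne_zero (prod_ne_zero_iff.mpr fun k _ => ?_) ?_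
      · exact leftWeight_ne_zero nd (by simp) (by exact_mod_cast htT) (hs k)
      · exact kernelVandermonde_ne_zero nd (by simp) (by simp) hm hs
    · push Not at h
      exact ⟨0, fun x hx => absurd hx (h x)⟩
  | succ t ih =>
    obtain ⟨c, hc⟩ := ih (by omega)
    obtain ⟨c', hc'⟩ := exists_left_transfer nd (t := t) (by omega) (by omega)
    refine ⟨c * c' * ∏ y ∈ sites N S T (t + 1), holeWeight S p s r₁ r₂ (t + 1 : ℕ) ((y : ℕ) : ℤ),
      fun y hy => ?_⟩
    obtain ⟨hm, hs⟩ := mem_lineConfigs.mp hy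
    rw [forwardSum, sum_stepIndicator_left nd hy (fun x => forwardSum_eq_zero) hc]
    have h1 := hc' (toInt y) (fun k => by simpa using hs k)
    simp only [siteVandermonde]
    rw [h1, ← lineWeight_mul_prod nd hy]
    have h2 : ∀ k, leftStep N S T p s r₁ r₂ t (toInt y k) *
        br p s (r₁ * r₂) (2 * toInt y k - t - S) =
        holeWeight S p s r₁ r₂ (t + 1) (toInt y k) *
          leftWeight N S T p s r₁ r₂ (t + 1) (toInt y k) := fun k =>
      leftStep_mul_eq nd (by omega) (by exact_mod_cast htT) (by simpa using hs k)
    simp only [h2, prod_mul_distrib]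
    push_cast
    ring

/-- The backward sum omits the weight of line t itself, hence `rightStep` in place of `rightWeight`.
This way the holes of line t are counted once in the product with the forward sum. -/
lemma backwardSum_eq {t r : ℕ} (h : t + (r + 1) = T) :
    ∃ c : ℂ, ∀ x ∈ lineConfigs N S T t,
      backwardSum (lineWeight N S T p s r₁ r₂) stepIndicator t (r + 1) x =
        c * ((∏ k, rightStep N S T p s r₁ r₂ t (toInt x k) *
          br p s (r₁ * r₂) (2 * toInt x k + 1 - t - S)) *
          siteVandermonde S p s r₁ r₂ t (toInt x)) := by
  -- One application of the right transfer. It serves both the start, where line t + 1 is the last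
  -- line with its single configuration, and the induction step.
  have step : ∀ {t r : ℕ}, t + (r + 1) = T → (∃ c : ℂ, ∀ y ∈ lineConfigs N S T (t + 1),
      lineWeight N S T p s r₁ r₂ (t + 1) y *
        backwardSum (lineWeight N S T p s r₁ r₂) stepIndicator (t + 1) r y =
        c * ((∏ k, rightWeight N S T p s r₁ r₂ (t + 1) (toInt y k)) *
          siteVandermonde S p s r₁ r₂ (t + 1) (toInt y))) →
      ∃ c : ℂ, ∀ x ∈ lineConfigs N S T t,
      backwardSum (lineWeight N S T p s r₁ r₂) stepIndicator t (r + 1) x =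
        c * ((∏ k, rightStep N S T p s r₁ r₂ t (toInt x k) *
          br p s (r₁ * r₂) (2 * toInt x k + 1 - t - S)) *
          siteVandermonde S p s r₁ r₂ t (toInt x)) := by
    rintro t r h ⟨c, hc⟩
    obtain ⟨c', hc'⟩ := exists_right_transfer nd (t := t) (by omega) (by omega)
    refine ⟨c * c', fun x hx => ?_⟩
    obtain ⟨hm, hs⟩ := mem_lineConfigs.mp hx
    rw [backwardSum, sum_stepIndicator_right nd hx
      (fun y hy => by rw [lineWeight, if_neg hy, zero_mul]) hc]
    have h1 := hc' (toInt x) hs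
    simp only [siteVandermonde]
    rw [h1, mul_assoc]
  induction r generalizing t with
  | zero =>
    refine step h ?_
    by_cases h' : ∃ x₀, x₀ ∈ lineConfigs N S T (t + 1)
    · obtain ⟨x₀, hx₀⟩ := h'
      obtain ⟨hm, hs⟩ := mem_lineConfigs.mp hx₀
      refine ⟨lineWeight N S T p s r₁ r₂ (t + 1) x₀ *
        backwardSum (lineWeight N S T p s r₁ r₂) stepIndicator (t + 1) 0 x₀ /
        ((∏ k, rightWeight N S T p s r₁ r₂ (t + 1) (toInt x₀ k)) *
          siteVandermonde S p s r₁ r₂ (t + 1) (toInt x₀)), fun x hx => ?_⟩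
      rw [lineConfigs_subsingleton (Or.inr (by omega)) hx hx₀, div_mul_cancel₀]
      refine mul_ne_zero (prod_ne_zero_iff.mpr fun k _ => ?_) ?_
      · exact rightWeight_ne_zero nd (by omega) (by omega) (by simpa using hs k)
      · exact kernelVandermonde_ne_zero nd (by omega) (by omega) hm (by simpa using hs)
    · push Not at h'
      exact ⟨0, fun x hx => absurd hx (h' x)⟩
  | succ r ih =>
    obtain ⟨c, hc⟩ := ih (t := t + 1) (by omega)
    refine step h ⟨c * ∏ y ∈ sites N S T (t + 1), holeWeight S p s r₁ r₂ (t + 1 : ℕ) ((y : ℕ) : ℤ),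
      fun y hy => ?_⟩
    obtain ⟨hm, hs⟩ := mem_lineConfigs.mp hy
    rw [hc y hy, ← lineWeight_mul_prod nd hy]
    have h2 : ∀ k, rightStep N S T p s r₁ r₂ (t + 1 : ℕ) (toInt y k) *
        br p s (r₁ * r₂) (2 * toInt y k + 1 - (t + 1 : ℕ) - S) =
        holeWeight S p s r₁ r₂ (t + 1 : ℕ) (toInt y k) *
          rightWeight N S T p s r₁ r₂ (t + 1 : ℕ) (toInt y k) := fun k =>
      rightStep_mul_eq nd (by omega) (by omega) (hs k)
    simp only [h2, prod_mul_distrib]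
    push_cast
    ring

/-- The univariate weight of the marginal on the line `t`. -/
def marginalWeight (N S T : ℤ) (p s r₁ r₂ : ℂ) (t x : ℤ) : ℂ :=
  br p s (r₁ * r₂) (2 * x + 1 - t - S) *
    (brRec p s x * brRec p s (N + t - 1 - x) * brRec p s (x - t - S + T) *
      brRec p s (S + N - 1 - x)) *
    (brProd p s (r₁ * r₂) (1 - T) (x - t - S) * brProd p s (r₁ * r₂) (1 - T) (x - T) /
      (brProd p s (r₁ * r₂) (1 - T) (x + N - S) * brProd p s (r₁ * r₂) (1 - T) (x + N - t))) *
    (brProd p s r₁ (1 - 2 * T) (x - t - S) / brProd p s r₁ (1 - 2 * T) (x - t - T - S)) *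
    (brProd p s r₂ 1 (x + T) / brProd p s r₂ 1 x)

/-- The products that depend on x through x - 2t and x + t occur in both factors and cancel. -/
lemma leftWeight_mul_rightStep {t x : ℤ} (ht : 0 ≤ t) (htT : t < T) (hx : IsSite N S T t x) :
    leftWeight N S T p s r₁ r₂ t x * (rightStep N S T p s r₁ r₂ t x *
      br p s (r₁ * r₂) (2 * x + 1 - t - S)) = marginalWeight N S T p s r₁ r₂ t x := by
  obtain ⟨h0, h1, h2, h3⟩ := hx
  have hS := nd.S_le
  have hS0 := nd.S_nonneg
  have n1 : brProd p s r₁ (1 - 2 * T) (x - 1 - 2 * t - S) ≠ 0 :=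
    brProd_ne_zero fun k _ _ => nd.a_ne k (by omega) (by omega)
  have n2 : brProd p s r₂ 1 (x + t + 1) ≠ 0 :=
    brProd_ne_zero fun k _ _ => nd.b_ne k (by omega) (by omega)
  rw [leftWeight, rightStep, marginalWeight]
  generalize brProd p s r₁ (1 - 2 * T) (x - 1 - 2 * t - S) = X at n1 ⊢
  generalize brProd p s r₂ 1 (x + t + 1) = Y at n2 ⊢
  simp only [div_eq_mul_inv, mul_inv]
  linear_combination (br p s (r₁ * r₂) (2 * x + 1 - t - S) *
    (brRec p s x * brRec p s (N + t - 1 - x) * brRec p s (x - t - S + T) *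
      brRec p s (S + N - 1 - x)) *
    (brProd p s (r₁ * r₂) (1 - T) (x - t - S) * brProd p s (r₁ * r₂) (1 - T) (x - T) *
      ((brProd p s (r₁ * r₂) (1 - T) (x + N - S))⁻¹ *
        (brProd p s (r₁ * r₂) (1 - T) (x + N - t))⁻¹)) *
    (brProd p s r₁ (1 - 2 * T) (x - t - S) * (brProd p s r₁ (1 - 2 * T) (x - t - T - S))⁻¹) *
    (brProd p s r₂ 1 (x + T) * (brProd p s r₂ 1 x)⁻¹)) *
      (mul_inv_cancel₀ n1 * (Y * Y⁻¹) + mul_inv_cancel₀ n2)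

open scoped Classical in
/-- The mass of the tilings with a given configuration on a line. -/
lemma exists_marginal_eq {t : ℕ} (htT : t < T) (i : Fin (T + 1)) (hi : (i : ℕ) = t) :
    ∃ c : ℂ, ∀ x ∈ lineConfigs N S T t,
      ∑ X ∈ (pathFamilies N S T).filter (fun X => X i = x), tilingWeight N S T p s r₁ r₂ X =
        c * ((∏ k, marginalWeight N S T p s r₁ r₂ t (toInt x k)) *
          siteVandermonde S p s r₁ r₂ t (toInt x) ^ 2) := by
  obtain ⟨c, hc⟩ := forwardSum_eq nd htT
  obtain ⟨c', hc'⟩ := backwardSum_eq nd (t := t) (r := T - t - 1) (by omega)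
  refine ⟨c * c', fun x hx => ?_⟩
  obtain ⟨hm, hs⟩ := mem_lineConfigs.mp hx
  rw [sum_tilingWeight_filter (t := t) (r := T - t - 1 + 1) (by omega) i hi, hc x hx, hc' x hx,
    prod_congr rfl fun k _ =>
      (leftWeight_mul_rightStep nd (by omega) (by omega) (hs k)).symm]
  simp only [prod_mul_distrib]
  ring

end Marginals

end EllipticTilings

/-! ### The theta factors of the Selberg weight as odd theta functions -/

namespace EllipticTilings

section Selberg

lemma thetaPoch_succ (p q x : ℂ) (n : ℕ) :
    thetaPoch p q x (n + 1) = thetaPoch p q x n * theta p (q ^ n * x) := prod_range_succ _ _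

lemma theta_eq_br {p s x y : ℂ} (hs : s ≠ 0) (hy : y ≠ 0) (k : ℤ) (h : x = (s ^ k * y) ^ 2) :
    theta p x = s ^ k * y * br p s y k := by
  rw [h, theta_sq (by positivity), br]

lemma zpow_mul_zpow_mul {s : ℂ} (hs : s ≠ 0) (n : ℕ) {a b k : ℤ} (h : 2 * n + a + b = 2 * k) :
    (s ^ 2) ^ n * (s ^ a * s ^ b) = (s ^ k) ^ 2 := by
  rw [← pow_mul, ← zpow_natCast, ← zpow_natCast, ← zpow_mul, ← zpow_add₀ hs, ← zpow_add₀ hs]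
  congr 1
  push_cast
  linarith

lemma zpow_mul_zpow_div {s : ℂ} (hs : s ≠ 0) (n : ℕ) {a b k : ℤ} (h : 2 * n + 2 + b - a = 2 * k) :
    (s ^ 2) ^ n * (s ^ 2 * s ^ b / s ^ a) = (s ^ k) ^ 2 := by
  rw [← pow_mul, ← zpow_natCast, ← zpow_natCast s 2, ← zpow_natCast, ← zpow_mul, ← zpow_add₀ hs,
    ← zpow_sub₀ hs, ← zpow_add₀ hs]
  congr 1
  push_cast
  linarith

/-- The parameters `q^{-m} A`, `B`, …, `E`, `q^m F`, and `q`. -/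
structure IsShiftedParams (N S T t m : ℤ) (s r₁ r₂ q A B C D E F : ℂ) : Prop where
  q_eq : q = s ^ 2
  A_eq : A = s ^ (t + S - 2 * T + 1 - 2 * m) * (r₁ * r₂)
  B_eq : B = parB S T t s r₁ r₂
  C_eq : C = parC N S t s r₁ r₂
  D_eq : D = parD N S t s r₁ r₂
  E_eq : E = parE S t s r₁ r₂
  F_eq : F = s ^ (-t - S + 1 + 2 * m) * (r₁ * r₂)

section

variable {N S T t m : ℤ} {p s r₁ r₂ q A B C D E F : ℂ} (nd : Nondegenerate N S T p s r₁ r₂)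
  (h : IsShiftedParams N S T t m s r₁ r₂ q A B C D E F)
include nd h

lemma theta_pow_AF (n : ℕ) : theta p (q ^ n * (A * F)) =
    s ^ (n + 1 - T) * (r₁ * r₂) * br p s (r₁ * r₂) (n + 1 - T) := by
  refine theta_eq_br nd.s_ne (mul_ne_zero nd.r₁_ne nd.r₂_ne) _ ?_
  rw [mul_pow, ← zpow_mul_zpow_mul nd.s_ne n (a := t + S - 2 * T + 1 - 2 * m)
    (b := -t - S + 1 + 2 * m) (by ring), h.q_eq, h.A_eq, h.F_eq]
  ring

lemma theta_pow_BF (n : ℕ) : theta p (q ^ n * (B * F)) =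
    s ^ (n + m + 1 + T) * r₂ * br p s r₂ (n + m + 1 + T) := by
  have h1 := nd.r₁_ne
  refine theta_eq_br nd.s_ne nd.r₂_ne _ ?_
  rw [mul_pow, ← zpow_mul_zpow_mul nd.s_ne n (a := t + S + 2 * T + 1)
    (b := -t - S + 1 + 2 * m) (by ring), h.q_eq, h.B_eq, h.F_eq, parB]
  field_simp

lemma theta_pow_CF (n : ℕ) : theta p (q ^ n * (C * F)) =
    s ^ (n + m + 1 - N - S) * 1 * br p s 1 (n + m + 1 - N - S) := by
  have h1 := nd.r₁_ne
  have h2 := nd.r₂_ne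
  refine theta_eq_br nd.s_ne one_ne_zero _ ?_
  rw [mul_pow, ← zpow_mul_zpow_mul nd.s_ne n (a := t - S - 2 * N + 1)
    (b := -t - S + 1 + 2 * m) (by ring), h.q_eq, h.C_eq, h.F_eq, parC]
  field_simp

lemma theta_pow_DF (n : ℕ) : theta p (q ^ n * (D * F)) =
    s ^ (n + m + 1 - N - t) * 1 * br p s 1 (n + m + 1 - N - t) := by
  have h1 := nd.r₁_ne
  have h2 := nd.r₂_ne
  refine theta_eq_br nd.s_ne one_ne_zero _ ?_
  rw [mul_pow, ← zpow_mul_zpow_mul nd.s_ne n (a := -t + S - 2 * N + 1)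
    (b := -t - S + 1 + 2 * m) (by ring), h.q_eq, h.D_eq, h.F_eq, parD]
  field_simp

lemma theta_pow_EF (n : ℕ) : theta p (q ^ n * (E * F)) =
    s ^ (n + m + 1 - t - S) * r₁ * br p s r₁ (n + m + 1 - t - S) := by
  have h2 := nd.r₂_ne
  refine theta_eq_br nd.s_ne nd.r₁_ne _ ?_
  rw [mul_pow, ← zpow_mul_zpow_mul nd.s_ne n (a := -t - S + 1)
    (b := -t - S + 1 + 2 * m) (by ring), h.q_eq, h.E_eq, h.F_eq, parE]
  field_simp

lemma theta_pow_sq (n : ℕ) : theta p (q ^ n * F ^ 2) =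
    s ^ (n + m + 1 - t - S + m) * (r₁ * r₂) * br p s (r₁ * r₂) (n + m + 1 - t - S + m) := by
  refine theta_eq_br nd.s_ne (mul_ne_zero nd.r₁_ne nd.r₂_ne) _ ?_
  rw [mul_pow, ← zpow_mul_zpow_mul nd.s_ne n (a := -t - S + 1 + 2 * m)
    (b := -t - S + 1 + 2 * m) (by ring), h.q_eq, h.F_eq]
  ring

omit nd in
lemma theta_pow_q (hs : s ≠ 0) (n : ℕ) : theta p (q ^ n * q) =
    s ^ ((n : ℤ) + 1) * 1 * br p s 1 (n + 1) := by
  refine theta_eq_br hs one_ne_zero _ ?_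
  rw [h.q_eq, mul_one, ← pow_succ, ← pow_mul, ← zpow_natCast s, ← zpow_natCast _ 2, ← zpow_mul]
  congr 1
  push_cast
  ring

lemma theta_pow_div_A (n : ℕ) : theta p (q ^ n * (q * F / A)) =
    s ^ (n + m + 1 - S - t + T + m) * 1 * br p s 1 (n + m + 1 - S - t + T + m) := by
  have h1 := nd.r₁_ne
  have h2 := nd.r₂_ne
  refine theta_eq_br nd.s_ne one_ne_zero _ ?_
  rw [mul_pow, ← zpow_mul_zpow_div nd.s_ne n (a := t + S - 2 * T + 1 - 2 * m)
    (b := -t - S + 1 + 2 * m) (by ring), h.q_eq, h.A_eq, h.F_eq]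
  field_simp

lemma theta_pow_div_B (n : ℕ) : theta p (q ^ n * (q * F / B)) =
    s ^ (n + m + 1 - t - T - S) * r₁ * br p s r₁ (n + m + 1 - t - T - S) := by
  have h1 := nd.r₁_ne
  have h2 := nd.r₂_ne
  refine theta_eq_br nd.s_ne nd.r₁_ne _ ?_
  rw [mul_pow, ← zpow_mul_zpow_div nd.s_ne n (a := t + S + 2 * T + 1)
    (b := -t - S + 1 + 2 * m) (by ring), h.q_eq, h.B_eq, h.F_eq, parB]
  field_simp

lemma theta_pow_div_C (n : ℕ) : theta p (q ^ n * (q * F / C)) =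
    s ^ (n + m + 1 + N - t) * (r₁ * r₂) * br p s (r₁ * r₂) (n + m + 1 + N - t) := by
  have h1 := nd.r₁_ne
  have h2 := nd.r₂_ne
  refine theta_eq_br nd.s_ne (mul_ne_zero h1 h2) _ ?_
  rw [mul_pow, ← zpow_mul_zpow_div nd.s_ne n (a := t - S - 2 * N + 1)
    (b := -t - S + 1 + 2 * m) (by ring), h.q_eq, h.C_eq, h.F_eq, parC]
  field_simp

lemma theta_pow_div_D (n : ℕ) : theta p (q ^ n * (q * F / D)) =
    s ^ (n + m + 1 + N - S) * (r₁ * r₂) * br p s (r₁ * r₂) (n + m + 1 + N - S) := by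
  have h1 := nd.r₁_ne
  have h2 := nd.r₂_ne
  refine theta_eq_br nd.s_ne (mul_ne_zero h1 h2) _ ?_
  rw [mul_pow, ← zpow_mul_zpow_div nd.s_ne n (a := -t + S - 2 * N + 1)
    (b := -t - S + 1 + 2 * m) (by ring), h.q_eq, h.D_eq, h.F_eq, parD]
  field_simp

lemma theta_pow_div_E (n : ℕ) : theta p (q ^ n * (q * F / E)) =
    s ^ (n + m + 1) * r₂ * br p s r₂ (n + m + 1) := by
  have h1 := nd.r₁_ne
  have h2 := nd.r₂_ne
  refine theta_eq_br nd.s_ne h2 _ ?_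
  rw [mul_pow, ← zpow_mul_zpow_div nd.s_ne n (a := -t - S + 1)
    (b := -t - S + 1 + 2 * m) (by ring), h.q_eq, h.E_eq, h.F_eq, parE]
  field_simp

end

end Selberg

end EllipticTilings

/-! ### Proportionality of the Selberg weight and the marginal weight -/

namespace EllipticTilings

section Selberg

section

variable {N S T : ℤ} {p s r₁ r₂ : ℂ} (nd : Nondegenerate N S T p s r₁ r₂)
include nd

lemma marginalWeight_succ {t x : ℤ} (ht : 0 ≤ t) (htT : t ≤ T) (hx : IsSite N S T t x)
    (hx' : IsSite N S T t (x + 1)) :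
    marginalWeight N S T p s r₁ r₂ t (x + 1) * (br p s (r₁ * r₂) (2 * x + 1 - t - S) *
      (br p s 1 (x + 1) * br p s 1 (x + 1 - t - S + T) * br p s (r₁ * r₂) (x + 1 + N - S) *
        br p s (r₁ * r₂) (x + 1 + N - t) * br p s r₁ (x + 1 - t - T - S) * br p s r₂ (x + 1))) =
    marginalWeight N S T p s r₁ r₂ t x * (br p s (r₁ * r₂) (2 * x + 3 - t - S) *
      (br p s 1 (N + t - 1 - x) * br p s 1 (S + N - 1 - x) * br p s (r₁ * r₂) (x + 1 - t - S) *
        br p s (r₁ * r₂) (x + 1 - T) * br p s r₁ (x + 1 - t - S) * br p s r₂ (x + 1 + T))) := by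
  obtain ⟨h0, h1, h2, h3⟩ := hx
  obtain ⟨h0', h1', h2', h3'⟩ := hx'
  have hS := nd.S_le
  have hS0 := nd.S_nonneg
  have e1 := brRec_pred (s := s) nd.norm_lt (n := x + 1) fun h => nd.e_ne _ (by omega) (by omega)
  have e2 := brRec_pred (s := s) nd.norm_lt (n := N + t - 1 - x)
    fun h => nd.e_ne _ (by omega) (by omega)
  have e3 := brRec_pred (s := s) nd.norm_lt (n := x + 1 - t - S + T)
    fun h => nd.e_ne _ (by omega) (by omega)
  have e4 := brRec_pred (s := s) nd.norm_lt (n := S + N - 1 - x)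
    fun h => nd.e_ne _ (by omega) (by omega)
  have e5 := brProd_succ p s (r₁ * r₂) (lo := 1 - T) (n := x + 1 - t - S) (by omega)
  have e6 := brProd_succ p s (r₁ * r₂) (lo := 1 - T) (n := x + 1 - T) (by omega)
  have e7 := brProd_succ p s (r₁ * r₂) (lo := 1 - T) (n := x + 1 + N - S) (by omega)
  have e8 := brProd_succ p s (r₁ * r₂) (lo := 1 - T) (n := x + 1 + N - t) (by omega)
  have e9 := brProd_succ p s r₁ (lo := 1 - 2 * T) (n := x + 1 - t - S) (by omega)
  have e10 := brProd_succ p s r₁ (lo := 1 - 2 * T) (n := x + 1 - t - T - S) (by omega)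
  have e11 := brProd_succ p s r₂ (lo := 1) (n := x + 1 + T) (by omega)
  have e12 := brProd_succ p s r₂ (lo := 1) (n := x + 1) (by omega)
  rw [show x + 1 - 1 = x by ring] at e1 e12
  rw [show N + t - 1 - x - 1 = N + t - 1 - (x + 1) by ring] at e2
  rw [show x + 1 - t - S + T - 1 = x - t - S + T by ring] at e3
  rw [show S + N - 1 - x - 1 = S + N - 1 - (x + 1) by ring] at e4
  rw [show x + 1 - t - S - 1 = x - t - S by ring] at e5 e9
  rw [show x + 1 - T - 1 = x - T by ring] at e6
  rw [show x + 1 + N - S - 1 = x + N - S by ring] at e7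
  rw [show x + 1 + N - t - 1 = x + N - t by ring] at e8
  rw [show x + 1 - t - T - S - 1 = x - t - T - S by ring] at e10
  rw [show x + 1 + T - 1 = x + T by ring] at e11
  have n7 := nd.c_ne (x + 1 + N - S) (by omega) (by omega)
  have n8 := nd.c_ne (x + 1 + N - t) (by omega) (by omega)
  have n10 := nd.a_ne (x + 1 - t - T - S) (by omega) (by omega)
  have n12 := nd.b_ne (x + 1) (by omega) (by omega)
  rw [marginalWeight, marginalWeight, show 2 * (x + 1) + 1 - t - S = 2 * x + 3 - t - S by ring,
    e1, e2, e3, e4, e5, e6, e7, e8, e9, e10, e11, e12]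
  generalize br p s (r₁ * r₂) (x + 1 + N - S) = b7 at *
  generalize br p s (r₁ * r₂) (x + 1 + N - t) = b8 at *
  generalize br p s r₁ (x + 1 - t - T - S) = b10 at *
  generalize br p s r₂ (x + 1) = b12 at *
  simp only [div_eq_mul_inv, mul_inv]
  have i7 := mul_inv_cancel₀ n7
  have i8 := mul_inv_cancel₀ n8
  have i10 := mul_inv_cancel₀ n10
  have i12 := mul_inv_cancel₀ n12
  have key : (b7 * b7⁻¹) * (b8 * b8⁻¹) * (b10 * b10⁻¹) * (b12 * b12⁻¹) = 1 := by
    rw [i7, i8, i10, i12]; norm_num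
  refine Eq.trans ?_ ((mul_one _).symm.trans (congrArg _ key.symm)).symm
  ring

lemma marginalWeight_ne_zero {t x : ℤ} (ht : 0 ≤ t) (htT : t ≤ T) (hx : IsSite N S T t x) :
    marginalWeight N S T p s r₁ r₂ t x ≠ 0 := by
  obtain ⟨h0, h1, h2, h3⟩ := hx
  have hS := nd.S_le
  have hS0 := nd.S_nonneg
  refine mul_ne_zero (mul_ne_zero (mul_ne_zero (mul_ne_zero ?_ (mul_ne_zero (mul_ne_zero
    (mul_ne_zero ?_ ?_) ?_) ?_)) (div_ne_zero (mul_ne_zero ?_ ?_) (mul_ne_zero ?_ ?_)))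
    (div_ne_zero ?_ ?_)) (div_ne_zero ?_ ?_)
  · exact nd.c_ne _ (by omega) (by omega)
  · exact brRec_ne_zero (by omega) fun k _ _ => nd.e_ne k (by omega) (by omega)
  · exact brRec_ne_zero (by omega) fun k _ _ => nd.e_ne k (by omega) (by omega)
  · exact brRec_ne_zero (by omega) fun k _ _ => nd.e_ne k (by omega) (by omega)
  · exact brRec_ne_zero (by omega) fun k _ _ => nd.e_ne k (by omega) (by omega)
  · exact brProd_ne_zero fun k _ _ => nd.c_ne k (by omega) (by omega)
  · exact brProd_ne_zero fun k _ _ => nd.c_ne k (by omega) (by omega)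
  · exact brProd_ne_zero fun k _ _ => nd.c_ne k (by omega) (by omega)
  · exact brProd_ne_zero fun k _ _ => nd.c_ne k (by omega) (by omega)
  · exact brProd_ne_zero fun k _ _ => nd.a_ne k (by omega) (by omega)
  · exact brProd_ne_zero fun k _ _ => nd.a_ne k (by omega) (by omega)
  · exact brProd_ne_zero fun k _ _ => nd.b_ne k (by omega) (by omega)
  · exact brProd_ne_zero fun k _ _ => nd.b_ne k (by omega) (by omega)

end

/-- The ratio at consecutive integers is kept cross-multiplied, for comparison with
`marginalWeight_succ`. -/
lemma selbergWeight_succ (N : ℕ) {p q A B C D E F : ℂ} (hq : q ≠ 0) (n : ℕ)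
    (h : theta p (q ^ n * q) * theta p (q ^ n * (q * F / A)) * theta p (q ^ n * (q * F / B)) *
      theta p (q ^ n * (q * F / C)) * theta p (q ^ n * (q * F / D)) *
      theta p (q ^ n * (q * F / E)) ≠ 0) :
    selbergWeight N p q A B C D E F (n + 1) * (theta p (q ^ (2 * n) * F ^ 2) *
      (theta p (q ^ n * q) * theta p (q ^ n * (q * F / A)) * theta p (q ^ n * (q * F / B)) *
        theta p (q ^ n * (q * F / C)) * theta p (q ^ n * (q * F / D)) *
        theta p (q ^ n * (q * F / E)))) =
    selbergWeight N p q A B C D E F n * (q ^ (2 * (N : ℤ) - 1) *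
      theta p (q ^ (2 * n + 2) * F ^ 2) *
      (theta p (q ^ n * (A * F)) * theta p (q ^ n * (B * F)) * theta p (q ^ n * (C * F)) *
        theta p (q ^ n * (D * F)) * theta p (q ^ n * (E * F)) * theta p (q ^ n * F ^ 2))) := by
  have e : q ^ ((2 * (N : ℤ) - 1) * (n + 1 : ℕ)) =
      q ^ ((2 * (N : ℤ) - 1) * n) * q ^ (2 * (N : ℤ) - 1) := by
    rw [← zpow_add₀ hq]; congr 1; push_cast; ring
  simp only [selbergWeight, thetaPochs, List.map_cons, List.map_nil, List.prod_cons, List.prod_nil,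
    thetaPoch_succ, e, mul_add, mul_one]
  have i := mul_inv_cancel₀ h
  simp only [div_eq_mul_inv, mul_inv] at i ⊢
  refine Eq.trans ?_ ((mul_one _).symm.trans (congrArg _ i.symm)).symm
  ring

section

variable {N : ℕ} {S T t m : ℤ} {p s r₁ r₂ q A B C D E F : ℂ} (nd : Nondegenerate N S T p s r₁ r₂)
  (h : IsShiftedParams N S T t m s r₁ r₂ q A B C D E F)
include nd h

/-- The univariate weights of the Selberg density and of the marginal have the same ratios. -/
lemma selbergWeight_succ_mul_marginalWeight (ht : 0 ≤ t) (htT : t ≤ T)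
    (hm : m = 0 ∧ t + S ≤ T ∨ m = t + S - T ∧ T ≤ t + S) (n : ℕ) (hx : IsSite N S T t (n + m))
    (hx' : IsSite N S T t (n + m + 1)) :
    selbergWeight N p q A B C D E F (n + 1) * marginalWeight N S T p s r₁ r₂ t (n + m) =
      selbergWeight N p q A B C D E F n * marginalWeight N S T p s r₁ r₂ t (n + m + 1) := by
  have hM := marginalWeight_succ nd ht htT hx hx'
  have hs := nd.s_ne
  have hr₁ := nd.r₁_ne
  have hr₂ := nd.r₂_ne
  have hS := nd.S_le
  have hS0 := nd.S_nonneg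
  have hq : q ≠ 0 := by rw [h.q_eq]; positivity
  obtain ⟨h0, h1, h2, h3⟩ := hx
  obtain ⟨h0', h1', h2', h3'⟩ := hx'
  -- Shifting the origin to m and exchanging A with F exchanges the factors of q and qF/A, and
  -- likewise those of AF and F². Only the two products matter, so both cases are covered at once.
  have c1 : br p s 1 (n + 1) * br p s 1 (n + m + 1 - S - t + T + m) =
      br p s 1 (n + m + 1) * br p s 1 (n + m + 1 - t - S + T) := by
    rcases hm with ⟨rfl, _⟩ | ⟨rfl, _⟩
    · congr 2; ring
    · rw [mul_comm]; congr 2 <;> ring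
  have c2 : br p s (r₁ * r₂) (n + 1 - T) * br p s (r₁ * r₂) (n + m + 1 - t - S + m) =
      br p s (r₁ * r₂) (n + m + 1 - t - S) * br p s (r₁ * r₂) (n + m + 1 - T) := by
    rcases hm with ⟨rfl, _⟩ | ⟨rfl, _⟩
    · rw [mul_comm]; congr 2; ring
    · congr 2 <;> ring
  have c3 : br p s 1 (n + m + 1 - N - S) = -br p s 1 (S + N - 1 - (n + m)) := by
    rw [← br_one_neg nd.norm_lt hs]; congr 1; ring
  have c4 : br p s 1 (n + m + 1 - N - t) = -br p s 1 (N + t - 1 - (n + m)) := by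
    rw [← br_one_neg nd.norm_lt hs]; congr 1; ring
  have n1 := nd.e_ne (n + m + 1) (by omega) (by omega)
  have n2 := nd.e_ne (n + m + 1 - t - S + T) (by omega) (by omega)
  have n3 := nd.c_ne (n + m + 1 + N - S) (by omega) (by omega)
  have n4 := nd.c_ne (n + m + 1 + N - t) (by omega) (by omega)
  have n5 := nd.a_ne (n + m + 1 - t - T - S) (by omega) (by omega)
  have n6 := nd.b_ne (n + m + 1) (by omega) (by omega)
  have n7 := nd.c_ne (2 * (n + m) + 1 - t - S) (by omega) (by omega)
  have hD : theta p (q ^ n * q) * theta p (q ^ n * (q * F / A)) * theta p (q ^ n * (q * F / B)) *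
      theta p (q ^ n * (q * F / C)) * theta p (q ^ n * (q * F / D)) *
      theta p (q ^ n * (q * F / E)) =
      s ^ (6 * (n + 1) + 6 * m + 2 * N - 3 * S - 3 * t) * (r₁ ^ 3 * r₂ ^ 3) *
      (br p s 1 (n + m + 1) * br p s 1 (n + m + 1 - t - S + T) *
        br p s (r₁ * r₂) (n + m + 1 + N - S) * br p s (r₁ * r₂) (n + m + 1 + N - t) *
        br p s r₁ (n + m + 1 - t - T - S) * br p s r₂ (n + m + 1)) := by
    have hz : s ^ (6 * (n + 1) + 6 * m + 2 * N - 3 * S - 3 * t) = s ^ ((n : ℤ) + 1) *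
        s ^ (n + m + 1 - S - t + T + m) * s ^ (n + m + 1 - t - T - S) * s ^ (n + m + 1 + N - t) *
        s ^ (n + m + 1 + N - S) * s ^ (n + m + 1) := by
      simp only [← zpow_add₀ hs]; congr 1; ring
    rw [theta_pow_q h hs, theta_pow_div_A nd h, theta_pow_div_B nd h, theta_pow_div_C nd h,
      theta_pow_div_D nd h, theta_pow_div_E nd h, ← c1, hz]
    ring
  have hN : theta p (q ^ n * (A * F)) * theta p (q ^ n * (B * F)) * theta p (q ^ n * (C * F)) *
      theta p (q ^ n * (D * F)) * theta p (q ^ n * (E * F)) * theta p (q ^ n * F ^ 2) =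
      s ^ (6 * (n + 1) + 6 * m - 2 * N - 3 * S - 3 * t) * (r₁ ^ 3 * r₂ ^ 3) *
      (br p s 1 (N + t - 1 - (n + m)) * br p s 1 (S + N - 1 - (n + m)) *
        br p s (r₁ * r₂) (n + m + 1 - t - S) * br p s (r₁ * r₂) (n + m + 1 - T) *
        br p s r₁ (n + m + 1 - t - S) * br p s r₂ (n + m + 1 + T)) := by
    have hz : s ^ (6 * (n + 1) + 6 * m - 2 * N - 3 * S - 3 * t) = s ^ (n + 1 - T) *
        s ^ (n + m + 1 + T) * s ^ (n + m + 1 - N - S) * s ^ (n + m + 1 - N - t) *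
        s ^ (n + m + 1 - t - S) * s ^ (n + m + 1 - t - S + m) := by
      simp only [← zpow_add₀ hs]; congr 1; ring
    rw [theta_pow_AF nd h, theta_pow_BF nd h, theta_pow_CF nd h, theta_pow_DF nd h,
      theta_pow_EF nd h, theta_pow_sq nd h, hz, c3, c4]
    linear_combination (s ^ (n + 1 - T) * s ^ (n + m + 1 + T) * s ^ (n + m + 1 - N - S) *
      s ^ (n + m + 1 - N - t) * s ^ (n + m + 1 - t - S) * s ^ (n + m + 1 - t - S + m) *
      (r₁ ^ 3 * r₂ ^ 3) * (br p s 1 (N + t - 1 - (n + m)) * br p s 1 (S + N - 1 - (n + m)) *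
        br p s r₁ (n + m + 1 - t - S) * br p s r₂ (n + m + 1 + T))) * c2
  have hD0 : br p s 1 (n + m + 1) * br p s 1 (n + m + 1 - t - S + T) *
      br p s (r₁ * r₂) (n + m + 1 + N - S) * br p s (r₁ * r₂) (n + m + 1 + N - t) *
      br p s r₁ (n + m + 1 - t - T - S) * br p s r₂ (n + m + 1) ≠ 0 := by positivity
  have hW := selbergWeight_succ N (p := p) (q := q) (A := A) (B := B) (C := C) (D := D) (E := E)
    (F := F) hq n (by rw [hD]; positivity)
  have t1 := theta_pow_sq nd h (2 * n)
  have t2 := theta_pow_sq nd h (2 * n + 2)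
  rw [show ((2 * n : ℕ) : ℤ) + m + 1 - t - S + m = 2 * (n + m) + 1 - t - S by push_cast; ring] at t1
  rw [show ((2 * n + 2 : ℕ) : ℤ) + m + 1 - t - S + m = 2 * (n + m) + 3 - t - S by
    push_cast; ring] at t2
  -- The powers of s lost in passing to odd theta functions are balanced exactly by q^{2N-1}, the
  -- growth factor of the Selberg weight.
  have hk : s ^ (2 * (n + m) + 1 - t - S) * (r₁ * r₂) *
      (s ^ (6 * (n + 1) + 6 * m + 2 * N - 3 * S - 3 * t) * (r₁ ^ 3 * r₂ ^ 3)) =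
      q ^ (2 * (N : ℤ) - 1) * (s ^ (2 * (n + m) + 3 - t - S) * (r₁ * r₂)) *
      (s ^ (6 * (n + 1) + 6 * m - 2 * N - 3 * S - 3 * t) * (r₁ ^ 3 * r₂ ^ 3)) := by
    have : s ^ (2 * (n + m) + 1 - t - S) * s ^ (6 * (n + 1) + 6 * m + 2 * N - 3 * S - 3 * t) =
        q ^ (2 * (N : ℤ) - 1) * s ^ (2 * (n + m) + 3 - t - S) *
          s ^ (6 * (n + 1) + 6 * m - 2 * N - 3 * S - 3 * t) := by
      rw [h.q_eq, ← zpow_natCast, ← zpow_mul]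
      simp only [← zpow_add₀ hs]
      congr 1
      push_cast
      ring
    linear_combination (r₁ * r₂ * (r₁ ^ 3 * r₂ ^ 3)) * this
  rw [hD, hN, t1, t2] at hW
  generalize br p s 1 (n + m + 1) * br p s 1 (n + m + 1 - t - S + T) *
      br p s (r₁ * r₂) (n + m + 1 + N - S) * br p s (r₁ * r₂) (n + m + 1 + N - t) *
      br p s r₁ (n + m + 1 - t - T - S) * br p s r₂ (n + m + 1) = X at *
  generalize br p s 1 (N + t - 1 - (n + m)) * br p s 1 (S + N - 1 - (n + m)) *
        br p s (r₁ * r₂) (n + m + 1 - t - S) * br p s (r₁ * r₂) (n + m + 1 - T) *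
        br p s r₁ (n + m + 1 - t - S) * br p s r₂ (n + m + 1 + T) = Y at *
  have hK0 : s ^ (2 * (n + m) + 1 - t - S) * (r₁ * r₂) *
      (s ^ (6 * (n + 1) + 6 * m + 2 * N - 3 * S - 3 * t) * (r₁ ^ 3 * r₂ ^ 3)) ≠ 0 := by positivity
  refine mul_left_cancel₀ (mul_ne_zero hK0 (mul_ne_zero n7 hD0)) ?_
  linear_combination marginalWeight N S T p s r₁ r₂ t (n + m) * hW -
    selbergWeight N p q A B C D E F n * (s ^ (2 * (n + m) + 1 - t - S) * (r₁ * r₂) *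
      (s ^ (6 * (n + 1) + 6 * m + 2 * N - 3 * S - 3 * t) * (r₁ ^ 3 * r₂ ^ 3))) * hM -
    marginalWeight N S T p s r₁ r₂ t (n + m) * selbergWeight N p q A B C D E F n *
      br p s (r₁ * r₂) (2 * (n + m) + 3 - t - S) * Y * hk

/-- Equal ratios along the interval of sites. Its lowest site is m, where all Pochhammer symbols are
empty and the Selberg weight is θ(F²) ≠ 0; for N = 0 the point m need not be a site. -/
lemma exists_selbergWeight_eq (hN : 0 < N) (ht : 0 ≤ t) (htT : t ≤ T)
    (hm : m = 0 ∧ t + S ≤ T ∨ m = t + S - T ∧ T ≤ t + S) :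
    ∃ c ≠ 0, ∀ n : ℕ, IsSite N S T t (n + m) →
      selbergWeight N p q A B C D E F n = c * marginalWeight N S T p s r₁ r₂ t (n + m) := by
  have hS := nd.S_le
  have hS0 := nd.S_nonneg
  have h0 : IsSite N S T t ((0 : ℕ) + m) := by
    simp only [IsSite]
    omega
  have hM0 := marginalWeight_ne_zero nd ht htT h0
  refine ⟨selbergWeight N p q A B C D E F 0 / marginalWeight N S T p s r₁ r₂ t ((0 : ℕ) + m),
    div_ne_zero ?_ hM0, fun n hn => ?_⟩
  · have t1 := theta_pow_sq nd h 0
    have hs := nd.s_ne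
    have hr₁ := nd.r₁_ne
    have hr₂ := nd.r₂_ne
    have hc := nd.c_ne ((0 : ℕ) + m + 1 - t - S + m) (by omega) (by omega)
    rw [pow_zero, one_mul] at t1
    simp only [selbergWeight, thetaPochs, thetaPoch, List.map_cons, List.map_nil, List.prod_cons,
      List.prod_nil, range_zero, prod_empty, mul_zero, pow_zero, one_mul, t1]
    simp only [Nat.cast_zero, mul_zero, zpow_zero, mul_one, one_mul, div_one]
    positivity
  · induction n with
    | zero => rw [div_mul_cancel₀ _ hM0]
    | succ n ih =>
      have hn0 : IsSite N S T t (n + m) := by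
        obtain ⟨h1, h2, h3, h4⟩ := hn
        push_cast at h1 h2 h3 h4
        simp only [IsSite]
        omega
      have hn' : IsSite N S T t (n + m + 1) := by
        convert hn using 1
        push_cast
        ring
      have h1 := selbergWeight_succ_mul_marginalWeight nd h ht htT hm n hn0 hn'
      rw [ih hn0] at h1
      refine mul_right_cancel₀ (marginalWeight_ne_zero nd ht htT hn0) ?_
      rw [h1, show ((n + 1 : ℕ) : ℤ) + m = n + m + 1 by push_cast; ring]
      ring

end

end Selberg

end EllipticTilings

/-! ### Normalization and the first two densities -/

namespace EllipticTilings

section Densities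

variable {N S T : ℕ} {p s r₁ r₂ : ℂ}

lemma apply_mem_lineConfigs {X : Fin (T + 1) → Fin N → Fin (S + N)} (hX : X ∈ pathFamilies N S T)
    (i : Fin (T + 1)) : X i ∈ lineConfigs N S T i := by
  classical
  exact ((isPathFamily_iff X).mp (by simpa [pathFamilies] using hX)).1 i

/-- A function proportional to the masses of the configurations on a line is a density. -/
lemma isNormalization_of_proportional (hZ : partitionFunction N S T p s r₁ r₂ ≠ 0)
    (i : Fin (T + 1)) {d : (Fin N → Fin (S + N)) → ℂ} {c : ℂ}
    (h : ∀ x ∈ lineConfigs N S T i, ∑ X ∈ (pathFamilies N S T).filter (fun X => X i = x),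
      tilingWeight N S T p s r₁ r₂ X = c * d x) :
    IsNormalization (lineConfigs N S T i) d (lineProb N S T p s r₁ r₂ i) := by
  have e : partitionFunction N S T p s r₁ r₂ = c * ∑ y ∈ lineConfigs N S T i, d y := by
    rw [partitionFunction, ← sum_fiberwise_of_maps_to (g := fun X => X i)
      (t := lineConfigs N S T i) (fun X hX => apply_mem_lineConfigs hX i), mul_sum]
    exact sum_congr rfl h
  -- The sum of the masses is Z ≠ 0, so the unknown transfer constants cannot vanish.
  have hc : c ≠ 0 := fun h => hZ (by rw [e, h, zero_mul])
  refine ⟨fun h => hZ (by rw [e, h, mul_zero]), fun x hx => ?_, fun x hx => ?_⟩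
  · rw [lineProb, h x hx, e, mul_div_mul_left _ _ hc]
  · rw [lineProb, sum_eq_zero, zero_div]
    intro X hX
    obtain ⟨h1, rfl⟩ := mem_filter.mp hX
    exact absurd (apply_mem_lineConfigs h1 i) hx

/-- The constant is nonzero automatically, since the sum of `d` is. -/
lemma IsNormalization.of_eq_mul {ι : Type*} {s : Finset ι} {d d' P : ι → ℂ} {c : ℂ}
    (h : IsNormalization s d P) (hd : ∀ x ∈ s, d x = c * d' x) : IsNormalization s d' P := by
  obtain ⟨h1, h2, h3⟩ := h
  rw [sum_congr rfl hd, ← mul_sum] at h1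
  have hc : c ≠ 0 := left_ne_zero_of_mul h1
  refine ⟨right_ne_zero_of_mul h1, fun x hx => ?_, h3⟩
  rw [h2 x hx, sum_congr rfl hd, ← mul_sum, hd x hx, mul_div_mul_left _ _ hc]

variable (nd : Nondegenerate N S T p s r₁ r₂)
include nd

lemma marginal_ne_zero {t : ℕ} (htT : t ≤ T) {x : Fin N → Fin (S + N)}
    (hx : x ∈ lineConfigs N S T t) :
    (∏ k, marginalWeight N S T p s r₁ r₂ t (toInt x k)) *
      siteVandermonde S p s r₁ r₂ t (toInt x) ^ 2 ≠ 0 := by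
  obtain ⟨hm, hs⟩ := mem_lineConfigs.mp hx
  refine mul_ne_zero (prod_ne_zero_iff.mpr fun k _ => ?_) (pow_ne_zero _ ?_)
  · exact marginalWeight_ne_zero nd (by omega) (by omega) (hs k)
  · exact kernelVandermonde_ne_zero nd (by omega) (by omega) hm hs

lemma isNormalization_marginal (hZ : partitionFunction N S T p s r₁ r₂ ≠ 0) (i : Fin (T + 1)) :
    IsNormalization (lineConfigs N S T i)
      (fun x => (∏ k, marginalWeight N S T p s r₁ r₂ (i : ℕ) (toInt x k)) *
        siteVandermonde S p s r₁ r₂ (i : ℕ) (toInt x) ^ 2) (lineProb N S T p s r₁ r₂ i) := by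
  rcases lt_or_eq_of_le (Nat.lt_succ_iff.mp i.isLt) with hi | hi
  · obtain ⟨c, hc⟩ := exists_marginal_eq nd hi i rfl
    refine isNormalization_of_proportional hZ i (c := c) fun x hx => ?_
    rw [← hc x hx]
  -- The induction from the left stops before line T. On that line there is at most one
  -- configuration, so proportionality is trivial.
  · by_cases h : ∃ x₀, x₀ ∈ lineConfigs N S T i
    · obtain ⟨x₀, hx₀⟩ := h
      refine isNormalization_of_proportional hZ i
        (c := (∑ X ∈ (pathFamilies N S T).filter (fun X => X i = x₀),
          tilingWeight N S T p s r₁ r₂ X) /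
          ((∏ k, marginalWeight N S T p s r₁ r₂ (i : ℕ) (toInt x₀ k)) *
            siteVandermonde S p s r₁ r₂ (i : ℕ) (toInt x₀) ^ 2)) fun x hx => ?_
      rw [lineConfigs_subsingleton (Or.inr hi) hx hx₀, div_mul_cancel₀ _
        (marginal_ne_zero nd hi.le hx₀)]
    · push Not at h
      exact isNormalization_of_proportional hZ i (c := 0) fun x hx => absurd hx (h x)

lemma phi_eq {t x y : ℤ} : phi p (s ^ 2) (r₁ ^ 2) (r₂ ^ 2) t S x y =
    s ^ (1 - t - S) * (r₁ * r₂) *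
      thetaKernel p (sitePos S s r₁ r₂ t x) (sitePos S s r₁ r₂ t y) := by
  have hs := nd.s_ne
  rw [thetaKernel_sitePos nd, phi, theta_eq_br hs one_ne_zero (x - y), theta_eq_br hs
    (mul_ne_zero nd.r₁_ne nd.r₂_ne) (x + y + 1 - t - S)]
  · have : (s ^ 2) ^ (-x) * (s ^ (x - y) * s ^ (x + y + 1 - t - S)) = s ^ (1 - t - S) := by
      rw [← zpow_natCast, ← zpow_mul, ← zpow_add₀ hs, ← zpow_add₀ hs]
      congr 1
      push_cast
      ring
    linear_combination (r₁ * r₂ * br p s 1 (x - y) * br p s (r₁ * r₂) (x + y + 1 - t - S)) * this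
  · rw [mul_pow, mul_pow, ← zpow_natCast, ← zpow_natCast (s ^ _), ← zpow_mul, ← zpow_mul,
      mul_comm (_ : ℤ)]
  · rw [mul_one, ← zpow_natCast, ← zpow_natCast (s ^ _), ← zpow_mul, ← zpow_mul,
      mul_comm (_ : ℤ)]

lemma vandermondeSq_eq (t : ℤ) (x : Fin N → Fin (S + N)) :
    vandermondeSq p (s ^ 2) (r₁ ^ 2) (r₂ ^ 2) t S x =
      (∏ k : Fin N, ∏ _l ∈ Ioi k, (s ^ (1 - t - S) * (r₁ * r₂)) ^ 2) *
        siteVandermonde S p s r₁ r₂ t (toInt x) ^ 2 := by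
  simp only [vandermondeSq, siteVandermonde, kernelVandermonde, ← prod_pow, ← prod_mul_distrib]
  refine prod_congr rfl fun k _ => prod_congr rfl fun l _ => ?_
  rw [phi_eq nd, ← mul_pow]
  rfl

lemma isNormalization_selbergDensity (hZ : partitionFunction N S T p s r₁ r₂ ≠ 0)
    (i : Fin (T + 1)) {m : ℕ} {A B C D E F : ℂ}
    (hm : m = 0 ∧ (i : ℕ) + S ≤ T ∨ m = (i : ℕ) + S - T ∧ T ≤ (i : ℕ) + S)
    (h : IsShiftedParams N S T (i : ℕ) m s r₁ r₂ (s ^ 2) A B C D E F) :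
    IsNormalization (lineConfigs N S T i)
      (selbergDensity N S i m p (s ^ 2) (r₁ ^ 2) (r₂ ^ 2) A B C D E F)
      (lineProb N S T p s r₁ r₂ i) := by
  have hs := nd.s_ne
  have hr₁ := nd.r₁_ne
  have hr₂ := nd.r₂_ne
  have hi := i.isLt
  have main : ∃ c ≠ 0, ∀ x ∈ lineConfigs N S T i,
      selbergDensity N S i m p (s ^ 2) (r₁ ^ 2) (r₂ ^ 2) A B C D E F x =
        c * ((∏ k, marginalWeight N S T p s r₁ r₂ (i : ℕ) (toInt x k)) *
          siteVandermonde S p s r₁ r₂ (i : ℕ) (toInt x) ^ 2) := by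
    rcases Nat.eq_zero_or_pos N with rfl | hN
    · refine ⟨1, one_ne_zero, fun x _ => ?_⟩
      simp [selbergDensity, vandermondeSq, siteVandermonde, kernelVandermonde]
    · obtain ⟨c, hc, hcx⟩ := exists_selbergWeight_eq nd h hN (by omega) (by omega) (by omega)
      refine ⟨(∏ k : Fin N, ∏ _l ∈ Ioi k, (s ^ (1 - ((i : ℕ) : ℤ) - S) * (r₁ * r₂)) ^ 2) * c ^ N,
        mul_ne_zero (prod_ne_zero_iff.mpr fun k _ => prod_ne_zero_iff.mpr fun l _ => by positivity)
          (pow_ne_zero _ hc), fun x hx => ?_⟩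
      obtain ⟨hm', hs'⟩ := mem_lineConfigs.mp hx
      have e : ∏ k, selbergWeight N p (s ^ 2) A B C D E F ((x k : ℕ) - m) =
          c ^ N * ∏ k, marginalWeight N S T p s r₁ r₂ (i : ℕ) (toInt x k) := by
        rw [← Fin.prod_const N c, ← prod_mul_distrib]
        refine prod_congr rfl fun k _ => ?_
        have h1 := hs' k
        have h2 : (((x k : ℕ) - m : ℕ) : ℤ) + m = toInt x k := by
          obtain ⟨a1, a2, a3, a4⟩ := h1
          simp only [toInt] at *
          omega
        rw [hcx _ (by rw [h2]; exact h1), h2]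
      rw [selbergDensity, vandermondeSq_eq nd, e]
      ring
  obtain ⟨c, hc, hcx⟩ := main
  refine (isNormalization_marginal nd hZ i).of_eq_mul (c := c⁻¹) fun x hx => ?_
  rw [hcx x hx, inv_mul_cancel_left₀ hc]

omit nd in
/-- The two forms of the density for `t + S ≤ T`. -/
lemma lineDensity_eq (hs : s ≠ 0) (hr₁ : r₁ ≠ 0) (hr₂ : r₂ ≠ 0) (t : ℕ) :
    lineDensity (M := S + N) N S T t p (s ^ 2) (r₁ ^ 2) (r₂ ^ 2) =
      selbergDensity N S t 0 p (s ^ 2) (r₁ ^ 2) (r₂ ^ 2) (parA S T t s r₁ r₂)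
        (parB S T t s r₁ r₂) (parC N S t s r₁ r₂) (parD N S t s r₁ r₂) (parE S t s r₁ r₂)
        (parF S t s r₁ r₂) := by
  have mulz : ∀ {a b : ℤ} (k : ℤ), a + b = 2 * k → s ^ a * s ^ b = (s ^ 2) ^ k := by
    intro a b k h
    rw [← zpow_add₀ hs, h, zpow_mul]
    norm_cast
  have divz : ∀ {a b : ℤ} (k : ℤ), 2 + b - a = 2 * k → s ^ 2 * s ^ b / s ^ a = (s ^ 2) ^ k := by
    intro a b k h
    rw [← zpow_natCast, ← zpow_add₀ hs, ← zpow_sub₀ hs, ← zpow_mul]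
    congr 1
  funext x
  have hAF : parA S T t s r₁ r₂ * parF S t s r₁ r₂ =
      (s ^ 2) ^ (1 - (T : ℤ)) * (r₁ ^ 2 * r₂ ^ 2) := by
    rw [parA, parF, ← mulz (1 - (T : ℤ)) (a := t + S - 2 * T + 1) (b := -t - S + 1) (by ring)]
    ring
  have hBF : parB S T t s r₁ r₂ * parF S t s r₁ r₂ = (s ^ 2) ^ (1 + (T : ℤ)) * r₂ ^ 2 := by
    rw [parB, parF, ← mulz (1 + (T : ℤ)) (a := t + S + 2 * T + 1) (b := -t - S + 1) (by ring)]
    field_simp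
  have hCF : parC N S t s r₁ r₂ * parF S t s r₁ r₂ = (s ^ 2) ^ (1 - (N : ℤ) - S) := by
    rw [parC, parF, ← mulz (1 - (N : ℤ) - S) (a := t - S - 2 * N + 1) (b := -t - S + 1) (by ring)]
    field_simp
  have hDF : parD N S t s r₁ r₂ * parF S t s r₁ r₂ = (s ^ 2) ^ (1 - (N : ℤ) - t) := by
    rw [parD, parF, ← mulz (1 - (N : ℤ) - t) (a := -t + S - 2 * N + 1) (b := -t - S + 1) (by ring)]
    field_simp
  have hEF : parE S t s r₁ r₂ * parF S t s r₁ r₂ = (s ^ 2) ^ (1 - (t : ℤ) - S) * r₁ ^ 2 := by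
    rw [parE, parF, ← mulz (1 - (t : ℤ) - S) (a := -t - S + 1) (b := -t - S + 1) (by ring)]
    field_simp
  have hFF : parF S t s r₁ r₂ ^ 2 = (s ^ 2) ^ (1 - (t : ℤ) - S) * (r₁ ^ 2 * r₂ ^ 2) := by
    rw [parF, ← mulz (1 - (t : ℤ) - S) (a := -t - S + 1) (b := -t - S + 1) (by ring)]
    ring
  have hqA : s ^ 2 * parF S t s r₁ r₂ / parA S T t s r₁ r₂ =
      (s ^ 2) ^ (1 - (S : ℤ) - t + T) := by
    rw [parA, parF, ← divz (1 - (S : ℤ) - t + T) (a := t + S - 2 * T + 1) (b := -t - S + 1)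
      (by ring)]
    field_simp
  have hqB : s ^ 2 * parF S t s r₁ r₂ / parB S T t s r₁ r₂ =
      (s ^ 2) ^ (1 - (t : ℤ) - T - S) * r₁ ^ 2 := by
    rw [parB, parF, ← divz (1 - (t : ℤ) - T - S) (a := t + S + 2 * T + 1) (b := -t - S + 1)
      (by ring)]
    field_simp
  have hqC : s ^ 2 * parF S t s r₁ r₂ / parC N S t s r₁ r₂ =
      (s ^ 2) ^ (1 + (N : ℤ) - t) * (r₁ ^ 2 * r₂ ^ 2) := by
    rw [parC, parF, ← divz (1 + (N : ℤ) - t) (a := t - S - 2 * N + 1) (b := -t - S + 1) (by ring)]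
    field_simp
  have hqD : s ^ 2 * parF S t s r₁ r₂ / parD N S t s r₁ r₂ =
      (s ^ 2) ^ (1 + (N : ℤ) - S) * (r₁ ^ 2 * r₂ ^ 2) := by
    rw [parD, parF, ← divz (1 + (N : ℤ) - S) (a := -t + S - 2 * N + 1) (b := -t - S + 1) (by ring)]
    field_simp
  have hqE : s ^ 2 * parF S t s r₁ r₂ / parE S t s r₁ r₂ = s ^ 2 * r₂ ^ 2 := by
    rw [parE, parF]
    field_simp
  have hF2 : ∀ n : ℕ, (s ^ 2) ^ (2 * n) * ((s ^ 2) ^ (1 - (t : ℤ) - S) * (r₁ ^ 2 * r₂ ^ 2)) =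
      (s ^ 2) ^ (2 * (n : ℤ) + 1 - t - S) * (r₁ ^ 2 * r₂ ^ 2) := by
    intro n
    rw [← mul_assoc, ← zpow_natCast (s ^ 2) (2 * n), ← zpow_add₀ (pow_ne_zero 2 hs)]
    congr 2
    push_cast
    ring
  rw [lineDensity, selbergDensity, mul_assoc, ← prod_mul_distrib]
  congr 1
  refine prod_congr rfl fun k _ => ?_
  simp only [selbergWeight, hAF, hBF, hCF, hDF, hEF, hFF, hqA, hqB, hqC, hqD, hqE, hF2, Nat.sub_zero,
    thetaPochs, List.map_cons, List.map_nil, List.prod_cons, List.prod_nil]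
  simp only [div_eq_mul_inv, mul_inv]
  ring

end Densities

end EllipticTilings

/-! ### The C-symbols in the coordinates ξ_i = λ_i + N - i -/

namespace EllipticTilings

section Symbols

lemma thetaPoch_add (p q x : ℂ) (a b : ℕ) :
    thetaPoch p q x (a + b) = thetaPoch p q x a * thetaPoch p q (q ^ a * x) b := by
  rw [thetaPoch, prod_range_add, thetaPoch, thetaPoch]
  congr 1
  refine prod_congr rfl fun i _ => ?_
  rw [pow_add]
  congr 1
  ring

lemma thetaPoch_ne_zero {p q x : ℂ} {n : ℕ} (h : ∀ k < n, theta p (q ^ k * x) ≠ 0) :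
    thetaPoch p q x n ≠ 0 :=
  prod_ne_zero_iff.mpr fun k hk => h k (mem_range.mp hk)

lemma thetaPoch_shift {p q x : ℂ} {a : ℕ} (h : ∀ k < a, theta p (q ^ k * x) ≠ 0) (b : ℕ) :
    thetaPoch p q (q ^ a * x) b = thetaPoch p q x (a + b) / thetaPoch p q x a := by
  rw [thetaPoch_add, mul_div_cancel_left₀ _ (thetaPoch_ne_zero h)]

lemma prod_Icc_div_succ {N : ℕ} (G H : ℕ → ℂ) {i : ℕ} (hi : i ≤ N) :
    ∏ j ∈ Icc i N, G j / H (j + 1) = G i / H (N + 1) * ∏ j ∈ Ioc i N, G j / H j := by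
  have h1 : ∏ j ∈ Icc i N, G j = G i * ∏ j ∈ Ioc i N, G j := by
    rw [← Ioc_insert_left hi, prod_insert (by simp)]
  have h2 : ∏ j ∈ Icc i N, H (j + 1) = H (N + 1) * ∏ j ∈ Ioc i N, H j := by
    have : ∏ j ∈ Icc i N, H (j + 1) = ∏ j ∈ Ioc i (N + 1), H j := by
      refine prod_bij' (fun j _ => j + 1) (fun j _ => j - 1) ?_ ?_ ?_ ?_ (fun _ _ => rfl)
      · intro j hj
        obtain ⟨h1, h2⟩ := mem_Icc.mp hj
        exact mem_Ioc.mpr ⟨by omega, by omega⟩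
      · intro j hj
        obtain ⟨h1, h2⟩ := mem_Ioc.mp hj
        exact mem_Icc.mpr ⟨by omega, by omega⟩
      · intro j hj
        omega
      · intro j hj
        exact Nat.sub_add_cancel (by have := (mem_Ioc.mp hj).1; omega)
    rw [this, show Ioc i (N + 1) = insert (N + 1) (Ioc i N) by
      ext j; simp only [mem_Ioc, mem_insert]; omega, prod_insert (by simp)]
  rw [prod_div_distrib, prod_div_distrib, h1, h2]
  ring

variable {N : ℕ} {lam ξ : ℕ → ℕ} (hξ : ∀ i, 1 ≤ i → i ≤ N → ξ i = lam i + (N - i))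
  {p q : ℂ} (hq : q ≠ 0)
include hξ hq

/-- At argument q^{N-1} b the i-th factor starts at q^{N-i} b and has length λ_i, so it is the
Pochhammer symbol of length ξ_i divided by its first N - i factors, which do not depend on λ. -/
lemma symbolC0_eq {b : ℂ} (hb : ∀ k, k + 1 < N → theta p (q ^ k * b) ≠ 0) :
    symbolC0 p q N lam (q ^ ((N : ℤ) - 1) * b) =
      (∏ i ∈ Icc 1 N, thetaPoch p q b (ξ i)) / ∏ i ∈ Icc 1 N, thetaPoch p q b (N - i) := by
  rw [symbolC0, ← prod_div_distrib]
  refine prod_congr rfl fun i hi => ?_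
  obtain ⟨h1, h2⟩ := mem_Icc.mp hi
  have e : q ^ (1 - (i : ℤ)) * (q ^ ((N : ℤ) - 1) * b) = q ^ (N - i) * b := by
    rw [← mul_assoc, ← zpow_add₀ hq, ← zpow_natCast]
    congr 2
    omega
  rw [e, thetaPoch_shift fun k hk => hb k (by omega), hξ i h1 h2, add_comm]

lemma symbolC0Double_eq {y : ℂ} (hy : ∀ k, k + 2 ≤ 2 * N → theta p (q ^ k * y) ≠ 0) :
    symbolC0Double p q N lam (q ^ (2 * (N : ℤ) - 1) * y) =
      ((∏ i ∈ Icc 1 N, thetaPoch p q y (2 * ξ i)) *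
        ∏ i ∈ Icc 1 N, thetaPoch p q (q * y) (2 * ξ i)) /
      ((∏ i ∈ Icc 1 N, thetaPoch p q y (2 * (N - i))) *
        ∏ i ∈ Icc 1 N, thetaPoch p q (q * y) (2 * (N - i))) := by
  rw [symbolC0Double, ← prod_mul_distrib, ← prod_mul_distrib, ← prod_div_distrib]
  refine prod_congr rfl fun i hi => ?_
  obtain ⟨h1, h2⟩ := mem_Icc.mp hi
  have e : q ^ (1 - 2 * (i : ℤ)) * (q ^ (2 * (N : ℤ) - 1) * y) = q ^ (2 * (N - i)) * y := by
    rw [← mul_assoc, ← zpow_add₀ hq, ← zpow_natCast]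
    congr 2
    push_cast [h2]
    ring
  have e' : q ^ (2 - 2 * (i : ℤ)) * (q ^ (2 * (N : ℤ) - 1) * y) = q ^ (2 * (N - i)) * (q * y) := by
    rw [← mul_assoc, ← zpow_add₀ hq, ← mul_assoc, ← pow_succ, ← zpow_natCast]
    congr 2
    push_cast [h2]
    ring
  rw [thetaPochs]
  simp only [List.map_cons, List.map_nil, List.prod_cons, List.prod_nil, mul_one]
  rw [e, e', thetaPoch_shift fun k hk => hy k (by omega), thetaPoch_shift fun k hk => ?_,
    hξ i h1 h2, div_mul_div_comm, show 2 * (lam i + (N - i)) = 2 * (N - i) + 2 * lam i by ring]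
  rw [← mul_assoc, ← pow_succ]
  exact hy (k + 1) (by omega)

variable (h0 : lam (N + 1) = 0)
include h0

/-- For fixed i the numerator at j has length ξ_i + ξ_j, and the denominator at j - 1 has length ξ_i
+ ξ_j + 1. Pairing them leaves one theta factor for each pair i < j, together with the extreme terms
of lengths 2ξ_i and ξ_i. -/
lemma symbolCPlus_eq {f : ℂ} {K : ℕ} (hf : ∀ k, k ≤ K → theta p (q ^ k * f) ≠ 0)
    (hNK : 2 * N ≤ K + 2) (hξK : ∀ i, 1 ≤ i → i ≤ N → 2 * ξ i ≤ K) :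
    symbolCPlus p q N lam (q ^ (2 * (N : ℤ) - 2) * f) =
      ((∏ i ∈ Icc 1 N, thetaPoch p q f (2 * ξ i)) / ∏ i ∈ Icc 1 N, thetaPoch p q f (ξ i)) *
        (∏ i ∈ Icc 1 N, ∏ j ∈ Ioc i N, theta p (q ^ (ξ i + ξ j) * f))⁻¹ := by
  rw [symbolCPlus, ← prod_div_distrib, ← prod_inv_distrib, ← prod_mul_distrib]
  refine prod_congr rfl fun i hi => ?_
  obtain ⟨h1, h2⟩ := mem_Icc.mp hi
  have e : ∀ j ∈ Icc i N,
      thetaPoch p q (q ^ (2 - (i : ℤ) - (j : ℤ)) * (q ^ (2 * (N : ℤ) - 2) * f)) (lam i + lam j) /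
        thetaPoch p q (q ^ (2 - (i : ℤ) - (j : ℤ)) * (q ^ (2 * (N : ℤ) - 2) * f))
          (lam i + lam (j + 1)) =
      thetaPoch p q f (ξ i + ξ j) /
        (fun j => thetaPoch p q f (ξ i + (lam j + (N + 1 - j)))) (j + 1) := by
    intro j hj
    obtain ⟨h3, h4⟩ := mem_Icc.mp hj
    have e : q ^ (2 - (i : ℤ) - (j : ℤ)) * (q ^ (2 * (N : ℤ) - 2) * f) =
        q ^ ((N - i) + (N - j)) * f := by
      rw [← mul_assoc, ← zpow_add₀ hq, ← zpow_natCast]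
      congr 2
      push_cast [h2, h4]
      ring
    rw [e, thetaPoch_shift fun k hk => hf k (by omega), thetaPoch_shift fun k hk => hf k (by omega),
      div_div_div_cancel_right₀ (thetaPoch_ne_zero fun k hk => hf k (by omega)), hξ i h1 h2,
      hξ j (by omega) h4]
    simp only
    congr 2 <;> omega
  rw [prod_congr rfl e, prod_Icc_div_succ (fun j => thetaPoch p q f (ξ i + ξ j))
    (fun j => thetaPoch p q f (ξ i + (lam j + (N + 1 - j)))) h2,
    ← prod_inv_distrib]
  -- The last denominator has length ξ_i because λ_{N+1} = 0.
  simp only [h0, Nat.sub_self, ← two_mul]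
  congr 1
  refine prod_congr rfl fun j hj => ?_
  obtain ⟨h3, h4⟩ := mem_Ioc.mp hj
  have k1 := hξK i h1 h2
  have k2 := hξK j (by omega) h4
  rw [show ξ i + (lam j + (N + 1 - j)) = ξ i + ξ j + 1 by rw [hξ j (by omega) h4]; omega,
    thetaPoch_succ, ← div_div, div_self (thetaPoch_ne_zero fun k hk => hf k (by omega)), one_div]

variable (hlam : ∀ i j, 1 ≤ i → i ≤ j → j ≤ N + 1 → lam j ≤ lam i)
include hlam

omit hq in
-- The same pairing, with lengths ξ_i - ξ_j and ξ_i - ξ_j - 1. The numerators of the definition now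
-- play the role of the denominators, whence the inverses.
lemma symbolCMinus_eq {y : ℂ} {L : ℕ} (hy : ∀ k, k < L → theta p (q ^ k * y) ≠ 0)
    (hNL : N ≤ L + 1) (hξL : ∀ i, 1 ≤ i → i ≤ N → ξ i ≤ L) :
    symbolCMinus p q N lam y = (∏ i ∈ Icc 1 N, thetaPoch p q y (ξ i)) *
      (∏ i ∈ Icc 1 N, ∏ j ∈ Ioc i N, theta p (q ^ (ξ i - ξ j - 1) * y))⁻¹ := by
  rw [symbolCMinus, ← prod_inv_distrib, ← prod_mul_distrib]
  refine prod_congr rfl fun i hi => ?_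
  obtain ⟨h1, h2⟩ := mem_Icc.mp hi
  have e : ∀ j ∈ Icc i N,
      thetaPoch p q (q ^ ((j : ℤ) - (i : ℤ)) * y) (lam i - lam (j + 1)) /
        thetaPoch p q (q ^ ((j : ℤ) - (i : ℤ)) * y) (lam i - lam j) =
      (thetaPoch p q y (ξ i - ξ j))⁻¹ /
        (fun j => (thetaPoch p q y (lam i - lam j + (j - i) - 1))⁻¹) (j + 1) := by
    intro j hj
    obtain ⟨h3, h4⟩ := mem_Icc.mp hj
    have e : q ^ ((j : ℤ) - (i : ℤ)) = q ^ (j - i) := by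
      rw [← zpow_natCast]
      congr 1
      omega
    have l1 := hlam i j h1 h3 (by omega)
    have l2 := hlam i (j + 1) h1 (by omega) (by omega)
    rw [e, thetaPoch_shift fun k hk => hy k (by omega), thetaPoch_shift fun k hk => hy k (by omega),
      div_div_div_cancel_right₀ (thetaPoch_ne_zero fun k hk => hy k (by omega)), hξ i h1 h2,
      hξ j (by omega) h4, inv_div_inv]
    congr 2 <;> omega
  rw [prod_congr rfl e, prod_Icc_div_succ (fun j => (thetaPoch p q y (ξ i - ξ j))⁻¹)
    (fun j => (thetaPoch p q y (lam i - lam j + (j - i) - 1))⁻¹) h2,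
    ← prod_inv_distrib]
  have e1 : thetaPoch p q y (ξ i - ξ i) = 1 := by simp [thetaPoch]
  have e2 : lam i - lam (N + 1) + (N + 1 - i) - 1 = ξ i := by rw [h0, hξ i h1 h2]; omega
  rw [e1, e2, inv_one, one_div, inv_inv]
  congr 1
  refine prod_congr rfl fun j hj => ?_
  obtain ⟨h3, h4⟩ := mem_Ioc.mp hj
  have k1 := hξL i h1 h2
  have l1 := hlam i j h1 h3.le (by omega)
  have e3 : lam i - lam j + (j - i) - 1 = ξ i - ξ j - 1 := by
    rw [hξ i h1 h2, hξ j (by omega) h4]; omega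
  have e4 : ξ i - ξ j = ξ i - ξ j - 1 + 1 := by
    rw [hξ i h1 h2, hξ j (by omega) h4]; omega
  have n1 : thetaPoch p q y (ξ i - ξ j - 1) ≠ 0 := thetaPoch_ne_zero fun k hk => hy k (by omega)
  rw [e3, inv_div_inv, e4, thetaPoch_succ, ← e4, ← div_div, div_self n1, one_div]

end Symbols

end EllipticTilings

/-! ### Quasi-periodicity and the balancing condition -/

namespace EllipticTilings

section DeltaSymbols

/-- The factor by which a theta-Pochhammer symbol changes under `x ↦ p x`. -/
def shiftFactor (q x : ℂ) (n : ℕ) : ℂ := ∏ i ∈ range n, -(q ^ i * x)⁻¹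

lemma shiftFactor_succ (q x : ℂ) (n : ℕ) :
    shiftFactor q x (n + 1) = shiftFactor q x n * -(q ^ n * x)⁻¹ := prod_range_succ _ _

lemma shiftFactor_ne_zero {q x : ℂ} (hq : q ≠ 0) (hx : x ≠ 0) (n : ℕ) : shiftFactor q x n ≠ 0 :=
  prod_ne_zero_iff.mpr fun i _ => neg_ne_zero.mpr (inv_ne_zero (by positivity))

lemma theta_p_mul_ne_zero {p x : ℂ} (hp1 : ‖p‖ < 1) (hp : p ≠ 0) (hx : x ≠ 0)
    (h : theta p x ≠ 0) : theta p (p * x) ≠ 0 := by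
  rw [theta_p_mul hp1 hp hx]
  exact mul_ne_zero (neg_ne_zero.mpr (inv_ne_zero hx)) h

lemma thetaPoch_p_mul {p q x : ℂ} (hp1 : ‖p‖ < 1) (hp : p ≠ 0) (hq : q ≠ 0) (hx : x ≠ 0) (n : ℕ) :
    thetaPoch p q (p * x) n = shiftFactor q x n * thetaPoch p q x n := by
  rw [thetaPoch, thetaPoch, shiftFactor, ← prod_mul_distrib]
  refine prod_congr rfl fun i _ => ?_
  rw [mul_left_comm, theta_p_mul hp1 hp (by positivity)]

/-- The Delta symbol carries extra factors p on BF, on several denominators and on the double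
symbol. Under the balancing condition the multipliers from removing them combine, for each particle,
to the power q^{(2N-1)n} of the Selberg weight. -/
lemma shiftFactor_balance {N : ℕ} {q A B C D E F : ℂ} (hq : q ≠ 0) (hA : A ≠ 0) (hB : B ≠ 0)
    (hC : C ≠ 0) (hD : D ≠ 0) (hE : E ≠ 0) (hF : F ≠ 0)
    (h : A * B * C * D * E * F * q ^ (2 * N) = q ^ 3) (n : ℕ) :
    shiftFactor q (B * F) n * shiftFactor q (q * F ^ 2) (2 * n) =
      q ^ ((2 * (N : ℤ) - 1) * n) * (shiftFactor q (q * F / A) n * shiftFactor q (q * F / C) n *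
        shiftFactor q (q * F / D) n * shiftFactor q (q * F / E) n * shiftFactor q q n) := by
  induction n with
  | zero => simp [shiftFactor]
  | succ n ih =>
    have e : q ^ ((2 * (N : ℤ) - 1) * (n + 1 : ℕ)) =
        q ^ ((2 * (N : ℤ) - 1) * n) * (q ^ (2 * N) / q) := by
      rw [← zpow_natCast, div_eq_mul_inv, ← zpow_sub_one₀ hq, ← zpow_add₀ hq]
      congr 1
      push_cast
      ring
    have key : -(q ^ n * (B * F))⁻¹ * (-(q ^ (2 * n) * (q * F ^ 2))⁻¹ *
        -(q ^ (2 * n + 1) * (q * F ^ 2))⁻¹) = q ^ (2 * N) / q * (-(q ^ n * (q * F / A))⁻¹ *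
        -(q ^ n * (q * F / C))⁻¹ * -(q ^ n * (q * F / D))⁻¹ * -(q ^ n * (q * F / E))⁻¹ *
        -(q ^ n * q)⁻¹) := by
      have h' : q ^ (2 * N) = q ^ 3 / (A * B * C * D * E * F) := by
        rw [← h]; field_simp
      rw [h', show 2 * n = n + n by ring]
      simp only [pow_add, pow_one]
      field_simp
    rw [show 2 * (n + 1) = 2 * n + 1 + 1 by ring]
    simp only [shiftFactor_succ, e]
    linear_combination (-(q ^ n * (B * F))⁻¹ * (-(q ^ (2 * n) * (q * F ^ 2))⁻¹ *
        -(q ^ (2 * n + 1) * (q * F ^ 2))⁻¹)) * ih + q ^ ((2 * (N : ℤ) - 1) * n) *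
        (shiftFactor q (q * F / A) n * shiftFactor q (q * F / C) n *
        shiftFactor q (q * F / D) n * shiftFactor q (q * F / E) n * shiftFactor q q n) * key

lemma thetaPoch_mul_base (p q x : ℂ) (n : ℕ) :
    theta p x * thetaPoch p q (q * x) n = theta p (q ^ n * x) * thetaPoch p q x n := by
  have h1 := thetaPoch_add p q x 1 n
  have h2 := thetaPoch_add p q x n 1
  rw [add_comm] at h1
  rw [h1] at h2
  simp only [thetaPoch, prod_range_one, pow_zero, one_mul, pow_one] at h2 ⊢
  rw [h2, mul_comm]

/-- The four pair factors left by C⁻(pq), C⁻(q), C⁺(pa), C⁺(a). Removing p from two of them gives a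
square with multiplier q^{-2a} f⁻¹, which is the squared Vandermonde factor. -/
lemma theta_pair {p q f : ℂ} (hp1 : ‖p‖ < 1) (hp : p ≠ 0) (hq : q ≠ 0) (hf : f ≠ 0) {a b : ℕ}
    (hab : b < a) :
    theta p (q ^ (a - b - 1) * (p * q)) * theta p (q ^ (a - b - 1) * q) *
      (theta p (q ^ (a + b) * (p * f)) * theta p (q ^ (a + b) * f)) =
    f⁻¹ * ((q ^ a)⁻¹ * (theta p (q ^ (a - b)) * theta p (q ^ (a + b) * f))) ^ 2 := by
  obtain ⟨c, rfl⟩ : ∃ c, a = b + 1 + c := ⟨a - b - 1, by omega⟩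
  rw [show b + 1 + c - b - 1 = c by omega, show b + 1 + c - b = c + 1 by omega,
    show q ^ c * (p * q) = p * q ^ (c + 1) by ring, ← pow_succ, mul_left_comm _ p f,
    theta_p_mul hp1 hp (by positivity), theta_p_mul hp1 hp (by positivity)]
  field_simp
  ring

end DeltaSymbols

end EllipticTilings

/-! ### The Delta symbol as a discrete Selberg density -/

namespace EllipticTilings

section DeltaSymbols

/-- A product of theta-Pochhammer symbols with varying lengths. -/
def pochProd (p q : ℂ) (N : ℕ) (n : ℕ → ℕ) (b : ℂ) : ℂ := ∏ i ∈ Icc 1 N, thetaPoch p q b (n i)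

/-- The factor by which `pochProd` changes under `b ↦ p b`. -/
def shiftProd (q : ℂ) (N : ℕ) (n : ℕ → ℕ) (b : ℂ) : ℂ := ∏ i ∈ Icc 1 N, shiftFactor q b (n i)

lemma pochProd_ne_zero {p q b : ℂ} {N M : ℕ} {n : ℕ → ℕ} (hn : ∀ i, 1 ≤ i → i ≤ N → n i ≤ M)
    (h : ∀ k, k < M → theta p (q ^ k * b) ≠ 0) : pochProd p q N n b ≠ 0 := by
  refine prod_ne_zero_iff.mpr fun i hi => thetaPoch_ne_zero fun k hk => h k ?_
  obtain ⟨h1, h2⟩ := mem_Icc.mp hi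
  exact hk.trans_le (hn i h1 h2)

lemma shiftProd_ne_zero {q b : ℂ} (hq : q ≠ 0) (hb : b ≠ 0) (N : ℕ) (n : ℕ → ℕ) :
    shiftProd q N n b ≠ 0 :=
  prod_ne_zero_iff.mpr fun _ _ => shiftFactor_ne_zero hq hb _

lemma pochProd_p_mul {p q b : ℂ} (hp1 : ‖p‖ < 1) (hp : p ≠ 0) (hq : q ≠ 0) (hb : b ≠ 0) (N : ℕ)
    (n : ℕ → ℕ) : pochProd p q N n (p * b) = shiftProd q N n b * pochProd p q N n b := by
  rw [pochProd, pochProd, shiftProd, ← prod_mul_distrib]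
  exact prod_congr rfl fun i _ => thetaPoch_p_mul hp1 hp hq hb _

/-- The factor between the Delta symbol and the discrete Selberg density. -/
def deltaConst (N : ℕ) (p q A B C D E F : ℂ) : ℂ :=
  pochProd p q N (fun i => N - i) (p * F ^ 2) * pochProd p q N (fun i => N - i) (p * (q * F / A)) *
    pochProd p q N (fun i => N - i) (q * F / B) * pochProd p q N (fun i => N - i) (p * (q * F / C)) *
    pochProd p q N (fun i => N - i) (p * (q * F / D)) *
    pochProd p q N (fun i => N - i) (p * (q * F / E)) /
  (pochProd p q N (fun i => N - i) q * pochProd p q N (fun i => N - i) (A * F) *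
    pochProd p q N (fun i => N - i) (p * (B * F)) * pochProd p q N (fun i => N - i) (C * F) *
    pochProd p q N (fun i => N - i) (D * F) * pochProd p q N (fun i => N - i) (E * F) *
    pochProd p q N (fun i => 2 * (N - i)) (p * F ^ 2) *
    pochProd p q N (fun i => 2 * (N - i)) (q * (p * F ^ 2)) * theta p (F ^ 2) ^ N) *
  ∏ i ∈ Icc 1 N, ∏ _j ∈ Ioc i N, (F ^ 2)⁻¹

/-- The final rearrangement with all products abstracted to letters. Only the quantities that really
cancel must be nonzero; the other denominators enter as formal inverses on both sides. -/
lemma delta_algebra {Pq Pf' PA PB PC PD PE Pf QA QB QC QD QE gA gB gC gD gE gq G D₁ Dqf Df cq cf cA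
    cB cC cD cE kA kB kC kD kE d₁ d₂ W₁ W₂ W₃ W₄ Θ Q th w V : ℂ}
    (hV : W₁ * W₂ * (W₃ * W₄) = w * V) (hD : th * Dqf = Θ * Df)
    (hg : gB * G = Q * (gA * gC * gD * gE * gq)) (h1 : Pq ≠ 0) (h2 : Pf' ≠ 0) (h3 : D₁ ≠ 0)
    (h4 : Df ≠ 0) (h5 : th ≠ 0) (h6 : gA ≠ 0) (h7 : gC ≠ 0) (h8 : gD ≠ 0) (h9 : gE ≠ 0)
    (h10 : gq ≠ 0) :
    Pq / cq / (Pf' / cf) * (PA / cA / (gA * QA / kA) * (gB * PB / cB / (QB / kB) *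
      (PC / cC / (gC * QC / kC) * (PD / cD / (gD * QD / kD) * (PE / cE / (gE * QE / kE)))))) *
      (D₁ * (G * Dqf) / (d₁ * d₂) / (gq * Pq * W₁⁻¹ * (Pq * W₂⁻¹) *
        (D₁ / Pf' * W₃⁻¹ * (Df / Pf * W₄⁻¹)))) =
    cf * kA * kB * kC * kD * kE / (cq * cA * cB * cC * cD * cE * d₁ * d₂ * th) * w *
      (Q * Θ * (PA * PB * PC * PD * PE * Pf / (Pq * QA * QB * QC * QD * QE)) * V) := by
  have e1 : Dqf * Df⁻¹ = Θ * th⁻¹ := by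
    rw [← div_eq_mul_inv, ← div_eq_mul_inv, div_eq_div_iff h4 h5, mul_comm, hD]
  have e2 : gB * G * (gA⁻¹ * gC⁻¹ * gD⁻¹ * gE⁻¹ * gq⁻¹) = Q := by
    rw [hg]
    field_simp
  have e3 : Pq * Pq⁻¹ * (Pf' * Pf'⁻¹) * (D₁ * D₁⁻¹) = 1 := by
    rw [mul_inv_cancel₀ h1, mul_inv_cancel₀ h2, mul_inv_cancel₀ h3]
    norm_num
  calc _ = cf * kA * kB * kC * kD * kE * (cq * cA * cB * cC * cD * cE * d₁ * d₂)⁻¹ *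
        (PA * PB * PC * PD * PE * Pf * (Pq * QA * QB * QC * QD * QE)⁻¹) *
        (W₁ * W₂ * (W₃ * W₄)) * (Dqf * Df⁻¹) *
        (gB * G * (gA⁻¹ * gC⁻¹ * gD⁻¹ * gE⁻¹ * gq⁻¹)) *
        (Pq * Pq⁻¹ * (Pf' * Pf'⁻¹) * (D₁ * D₁⁻¹)) := by
        simp only [div_eq_mul_inv, mul_inv, inv_inv]
        ring
    _ = _ := by
        rw [hV, e1, e2, e3]
        simp only [div_eq_mul_inv, mul_inv]
        ring

/-- The Delta symbol is a discrete Selberg density. -/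
theorem deltaSymbol_eq {N K L : ℕ} {p q A B C D E F : ℂ} (hp1 : ‖p‖ < 1) (hp : p ≠ 0)
    (hq : q ≠ 0) (hA : A ≠ 0) (hB : B ≠ 0) (hC : C ≠ 0) (hD : D ≠ 0) (hE : E ≠ 0) (hF : F ≠ 0)
    (hbal : A * B * C * D * E * F * q ^ (2 * N) = q ^ 3)
    (hb : ∀ b ∈ [A * F, B * F, C * F, D * F, E * F, q * F / A, q * F / B, q * F / C, q * F / D,
      q * F / E], ∀ k, k + 1 < N → theta p (q ^ k * b) ≠ 0)
    (hf : ∀ k, k ≤ K → theta p (q ^ k * F ^ 2) ≠ 0) (hNK : 2 * N ≤ K + 2)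
    (he : ∀ k, k < L → theta p (q ^ k * q) ≠ 0) (hNL : N ≤ L + 1) :
    deltaConst N p q A B C D E F ≠ 0 ∧ ∀ lam ξ : ℕ → ℕ,
      (∀ i, 1 ≤ i → i ≤ N → ξ i = lam i + (N - i)) → lam (N + 1) = 0 →
      (∀ i j, 1 ≤ i → i ≤ j → j ≤ N + 1 → lam j ≤ lam i) →
      (∀ i, 1 ≤ i → i ≤ N → 2 * ξ i ≤ K) → (∀ i, 1 ≤ i → i ≤ N → ξ i ≤ L) →
      deltaSymbol p q N lam (q ^ (2 * (N : ℤ) - 2) * F ^ 2)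
        [q ^ N, q ^ ((N : ℤ) - 1) * (A * F), q ^ ((N : ℤ) - 1) * ((p * B) * F),
          q ^ ((N : ℤ) - 1) * (C * F), q ^ ((N : ℤ) - 1) * (D * F), q ^ ((N : ℤ) - 1) * (E * F)] =
      deltaConst N p q A B C D E F * ((∏ i ∈ Icc 1 N, selbergWeight N p q A B C D E F (ξ i)) *
        ∏ i ∈ Icc 1 N, ∏ j ∈ Ioc i N, ((q ^ ξ i)⁻¹ *
          (theta p (q ^ (ξ i - ξ j)) * theta p (q ^ (ξ i + ξ j) * F ^ 2))) ^ 2) := by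
  have hc0 : ∀ b, (∀ k, k + 1 < N → theta p (q ^ k * b) ≠ 0) →
      pochProd p q N (fun i => N - i) b ≠ 0 := fun b h =>
    pochProd_ne_zero (M := N - 1) (fun i _ _ => by omega) fun k hk => h k (by omega)
  have hpshift : ∀ {b : ℂ} {k : ℕ}, b ≠ 0 → theta p (q ^ k * b) ≠ 0 →
      theta p (q ^ k * (p * b)) ≠ 0 := by
    intro b k hb h
    rw [mul_left_comm]
    exact theta_p_mul_ne_zero hp1 hp (by positivity) h
  have hF2 : F ^ 2 ≠ 0 := by positivity
  have hfp : ∀ k, k ≤ K → theta p (q ^ k * (p * F ^ 2)) ≠ 0 := fun k hk => hpshift hF2 (hf k hk)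
  have hep : ∀ k, k < L → theta p (q ^ k * (p * q)) ≠ 0 := fun k hk => hpshift hq (he k hk)
  have h1 : ∀ k, k + 1 < N → theta p (q ^ k * q) ≠ 0 := fun k hk => he k (by omega)
  have h2 : ∀ k, k + 1 < N → theta p (q ^ k * (p * F ^ 2)) ≠ 0 := fun k hk => hfp k (by omega)
  simp only [List.forall_mem_cons, List.not_mem_nil, false_imp_iff, implies_true, and_true] at hb
  obtain ⟨bA, bB, bC, bD, bE, dA, dB, dC, dD, dE⟩ := hb
  have bB' : ∀ k, k + 1 < N → theta p (q ^ k * (p * (B * F))) ≠ 0 :=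
    fun k hk => hpshift (by positivity) (bB k hk)
  have dA' : ∀ k, k + 1 < N → theta p (q ^ k * (p * (q * F / A))) ≠ 0 :=
    fun k hk => hpshift (by positivity) (dA k hk)
  have dC' : ∀ k, k + 1 < N → theta p (q ^ k * (p * (q * F / C))) ≠ 0 :=
    fun k hk => hpshift (by positivity) (dC k hk)
  have dD' : ∀ k, k + 1 < N → theta p (q ^ k * (p * (q * F / D))) ≠ 0 :=
    fun k hk => hpshift (by positivity) (dD k hk)
  have dE' : ∀ k, k + 1 < N → theta p (q ^ k * (p * (q * F / E))) ≠ 0 :=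
    fun k hk => hpshift (by positivity) (dE k hk)
  have hd₁0 : pochProd p q N (fun i => 2 * (N - i)) (p * F ^ 2) ≠ 0 :=
    pochProd_ne_zero (M := 2 * N - 2) (fun i _ _ => by omega) fun k hk => hfp k (by omega)
  have hd₂0 : pochProd p q N (fun i => 2 * (N - i)) (q * (p * F ^ 2)) ≠ 0 := by
    refine pochProd_ne_zero (M := 2 * N - 2) (fun i _ _ => by omega) fun k hk => ?_
    rw [← mul_assoc, ← pow_succ]
    exact hfp (k + 1) (by omega)
  have hθ : theta p (F ^ 2) ≠ 0 := by simpa using hf 0 (by omega)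
  refine ⟨mul_ne_zero (div_ne_zero ?_ ?_) (prod_ne_zero_iff.mpr fun i _ =>
    prod_ne_zero_iff.mpr fun j _ => inv_ne_zero hF2), ?_⟩
  · exact mul_ne_zero (mul_ne_zero (mul_ne_zero (mul_ne_zero (mul_ne_zero (hc0 _ h2) (hc0 _ dA'))
      (hc0 _ dB)) (hc0 _ dC')) (hc0 _ dD')) (hc0 _ dE')
  · exact mul_ne_zero (mul_ne_zero (mul_ne_zero (mul_ne_zero (mul_ne_zero (mul_ne_zero (mul_ne_zero
      (mul_ne_zero (hc0 _ h1) (hc0 _ bA)) (hc0 _ bB')) (hc0 _ bC)) (hc0 _ bD)) (hc0 _ bE)) hd₁0)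
      hd₂0) (pow_ne_zero _ hθ)
  intro lam ξ hξ h0 hlam hξK hξL
  have hlt : ∀ i ∈ Icc 1 N, ∀ j ∈ Ioc i N, ξ j < ξ i := by
    intro i hi j hj
    have := mem_Icc.mp hi
    have := mem_Ioc.mp hj
    have := hlam i j (by omega) (by omega) (by omega)
    rw [hξ i (by omega) (by omega), hξ j (by omega) (by omega)]
    omega
  have hC0 : ∀ b, (∀ k, k + 1 < N → theta p (q ^ k * b) ≠ 0) →
      symbolC0 p q N lam (q ^ ((N : ℤ) - 1) * b) = pochProd p q N ξ b /
        pochProd p q N (fun i => N - i) b := fun b h => symbolC0_eq hξ hq h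
  have hqN : q ^ N = q ^ ((N : ℤ) - 1) * q := by
    rw [← zpow_add_one₀ hq, sub_add_cancel, zpow_natCast]
  -- The reflected argument pqa/b is again q^{N-1} times a base point. It carries a factor p for
  -- every parameter except (pB)F, where the two factors p cancel, and it is pF² for b = q^N.
  have ha : ∀ b, b ≠ 0 → p * q * (q ^ (2 * (N : ℤ) - 2) * F ^ 2) / (q ^ ((N : ℤ) - 1) * b) =
      q ^ ((N : ℤ) - 1) * (p * (q * F ^ 2 / b)) := by
    intro b hb
    have : q ^ (2 * (N : ℤ) - 2) = q ^ ((N : ℤ) - 1) * q ^ ((N : ℤ) - 1) := by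
      rw [← zpow_add₀ hq]; congr 1; ring
    rw [this]
    field_simp
  have a1 : q * F ^ 2 / q = F ^ 2 := by field_simp
  have a2 : ∀ X : ℂ, X ≠ 0 → q * F ^ 2 / (X * F) = q * F / X := by intro X hX; field_simp
  have a3 : p * (q * F ^ 2 / (p * B * F)) = q * F / B := by field_simp
  have a4 : p * q * (q ^ (2 * (N : ℤ) - 2) * F ^ 2) = q ^ (2 * (N : ℤ) - 1) * (p * F ^ 2) := by
    rw [show 2 * (N : ℤ) - 1 = 2 * N - 2 + 1 by ring, zpow_add_one₀ hq]; ring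
  have a5 : p * (q ^ (2 * (N : ℤ) - 2) * F ^ 2) = q ^ (2 * (N : ℤ) - 2) * (p * F ^ 2) := by ring
  have hCD : symbolC0Double p q N lam (q ^ (2 * (N : ℤ) - 1) * (p * F ^ 2)) =
      (pochProd p q N (fun i => 2 * ξ i) (p * F ^ 2) * pochProd p q N (fun i => 2 * ξ i) (q * (p * F ^ 2))) / (pochProd p q N (fun i => 2 * (N - i)) (p * F ^ 2) *
        pochProd p q N (fun i => 2 * (N - i)) (q * (p * F ^ 2))) :=
    symbolC0Double_eq hξ hq fun k hk => hfp k (by omega)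
  have hCP := symbolCPlus_eq hξ hq h0 hf hNK hξK
  have hCPp := symbolCPlus_eq hξ hq h0 hfp hNK hξK
  have hCM := symbolCMinus_eq hξ h0 hlam he hNL hξL
  have hCMp := symbolCMinus_eq hξ h0 hlam hep hNL hξL
  have hpair : (∏ i ∈ Icc 1 N, ∏ j ∈ Ioc i N, theta p (q ^ (ξ i - ξ j - 1) * (p * q))) *
      (∏ i ∈ Icc 1 N, ∏ j ∈ Ioc i N, theta p (q ^ (ξ i - ξ j - 1) * q)) *
      ((∏ i ∈ Icc 1 N, ∏ j ∈ Ioc i N, theta p (q ^ (ξ i + ξ j) * (p * F ^ 2))) *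
      (∏ i ∈ Icc 1 N, ∏ j ∈ Ioc i N, theta p (q ^ (ξ i + ξ j) * F ^ 2))) =
      (∏ i ∈ Icc 1 N, ∏ _j ∈ Ioc i N, (F ^ 2)⁻¹) * ∏ i ∈ Icc 1 N, ∏ j ∈ Ioc i N, ((q ^ ξ i)⁻¹ *
        (theta p (q ^ (ξ i - ξ j)) * theta p (q ^ (ξ i + ξ j) * F ^ 2))) ^ 2 := by
    simp only [← prod_mul_distrib]
    exact prod_congr rfl fun i hi => prod_congr rfl fun j hj =>
      theta_pair hp1 hp hq hF2 (hlt i hi j hj)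
  -- Since θ(x) θ(qx; q)_n = θ(qⁿx) θ(x; q)_n, half of the double symbol supplies the factor
  -- θ(q^{2ξ} F²) of the Selberg weight.
  have hDq : theta p (F ^ 2) ^ N * pochProd p q N (fun i => 2 * ξ i) (q * F ^ 2) =
      (∏ i ∈ Icc 1 N, theta p (q ^ (2 * ξ i) * F ^ 2)) * pochProd p q N (fun i => 2 * ξ i) (F ^ 2) := by
    simp only [pochProd, ← prod_mul_distrib, ← thetaPoch_mul_base]
    rw [prod_mul_distrib, prod_const, Nat.card_Icc, Nat.add_sub_cancel]
  have hGbal : shiftProd q N ξ (B * F) * shiftProd q N (fun i => 2 * ξ i) (q * F ^ 2) = (∏ i ∈ Icc 1 N, q ^ ((2 * (N : ℤ) - 1) * ξ i)) *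
      (shiftProd q N ξ (q * F / A) * shiftProd q N ξ (q * F / C) * shiftProd q N ξ (q * F / D) * shiftProd q N ξ (q * F / E) * shiftProd q N ξ q) := by
    simp only [shiftProd, ← prod_mul_distrib]
    exact prod_congr rfl fun i _ => shiftFactor_balance hq hA hB hC hD hE hF hbal _
  have hW : ∏ i ∈ Icc 1 N, selbergWeight N p q A B C D E F (ξ i) =
      (∏ i ∈ Icc 1 N, q ^ ((2 * (N : ℤ) - 1) * ξ i)) *
      (∏ i ∈ Icc 1 N, theta p (q ^ (2 * ξ i) * F ^ 2)) *
      (pochProd p q N ξ (A * F) * pochProd p q N ξ (B * F) * pochProd p q N ξ (C * F) * pochProd p q N ξ (D * F) * pochProd p q N ξ (E * F) * pochProd p q N ξ (F ^ 2) /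
        (pochProd p q N ξ q * pochProd p q N ξ (q * F / A) * pochProd p q N ξ (q * F / B) * pochProd p q N ξ (q * F / C) * pochProd p q N ξ (q * F / D) * pochProd p q N ξ (q * F / E))) := by
    simp only [pochProd, ← prod_mul_distrib, ← prod_div_distrib]
    refine prod_congr rfl fun i _ => ?_
    simp only [selbergWeight, thetaPochs, List.map_cons, List.map_nil, List.prod_cons,
      List.prod_nil, mul_one, mul_assoc]
  have n1 : pochProd p q N (fun i => 2 * ξ i) (F ^ 2) ≠ 0 :=
    pochProd_ne_zero hξK fun k hk => hf k hk.le
  have n2 : pochProd p q N (fun i => 2 * ξ i) (p * F ^ 2) ≠ 0 :=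
    pochProd_ne_zero hξK fun k hk => hfp k hk.le
  have n3 : pochProd p q N ξ q ≠ 0 := pochProd_ne_zero hξL he
  have n4 : pochProd p q N ξ (p * F ^ 2) ≠ 0 :=
    pochProd_ne_zero (M := K) (fun i h h' => by have := hξK i h h'; omega) fun k hk => hfp k hk.le
  rw [deltaSymbol]
  simp only [List.map_cons, List.map_nil, List.prod_cons, List.prod_nil, mul_one]
  rw [hqN, ha q hq, ha _ (by positivity), ha _ (by positivity), ha _ (by positivity),
    ha _ (by positivity), ha _ (by positivity), a1, a2 A hA, a2 C hC, a2 D hD, a2 E hE, a3, a4, a5,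
    hC0 _ h1, hC0 _ h2, hC0 _ bA, hC0 _ dA', hC0 _ dB, hC0 _ bC, hC0 _ dC', hC0 _ bD, hC0 _ dD',
    hC0 _ bE, hC0 _ dE', mul_assoc p B F, hC0 _ bB', hCD, hCP, hCPp, hCM, hCMp, hW]
  rw [pochProd_p_mul hp1 hp hq (b := q * F / A) (by positivity),
    pochProd_p_mul hp1 hp hq (b := B * F) (by positivity),
    pochProd_p_mul hp1 hp hq (b := q * F / C) (by positivity),
    pochProd_p_mul hp1 hp hq (b := q * F / D) (by positivity),
    pochProd_p_mul hp1 hp hq (b := q * F / E) (by positivity)]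
  refine Eq.trans ?_ (delta_algebra hpair hDq hGbal n3 n4 n2 n1 (pow_ne_zero N hθ)
    (shiftProd_ne_zero hq (by positivity) N ξ) (shiftProd_ne_zero hq (by positivity) N ξ)
    (shiftProd_ne_zero hq (by positivity) N ξ) (shiftProd_ne_zero hq (by positivity) N ξ)
    (shiftProd_ne_zero hq hq N ξ))
  rw [mul_left_comm q p, pochProd_p_mul hp1 hp hq (b := q * F ^ 2) (by positivity) N
    (fun i => 2 * ξ i), ← pochProd_p_mul hp1 hp hq hq]
  rfl

end DeltaSymbols

end EllipticTilings

/-! ### The Delta density on a line -/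

namespace EllipticTilings

section DeltaDensity

lemma prod_Icc_eq_prod_fin (N : ℕ) (H : ℕ → ℂ) :
    ∏ i ∈ Icc 1 N, H i = ∏ k : Fin N, H (N - k) := by
  symm
  refine prod_bij' (fun k _ => N - k) (fun i hi => ⟨N - i, by have := mem_Icc.mp hi; omega⟩)
    ?_ ?_ ?_ ?_ ?_
  · intro k _
    exact mem_Icc.mpr ⟨by omega, by omega⟩
  · simp
  · intro k _
    ext
    simp only
    omega
  · intro i hi
    have := mem_Icc.mp hi
    simp only
    omega
  · simp

/-- Parts of a partition decrease while particles increase; the index reversal i = N - k preserves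
the set of pairs but exchanges their order. -/
lemma prod_Icc_Ioc_eq_prod_fin (N : ℕ) (H : ℕ → ℕ → ℂ) :
    ∏ i ∈ Icc 1 N, ∏ j ∈ Ioc i N, H i j = ∏ k : Fin N, ∏ l ∈ Ioi k, H (N - l) (N - k) := by
  have e1 : ∀ i ∈ Icc 1 N, ∏ j ∈ Ioc i N, H i j =
      ∏ k : Fin N, if i < N - k then H i (N - k) else 1 := by
    intro i hi
    have : Ioc i N = (Icc 1 N).filter (fun j => i < j) := by
      ext j
      simp only [mem_Ioc, mem_filter, mem_Icc]
      omega
    rw [this, prod_filter, prod_Icc_eq_prod_fin N fun j => if i < j then H i j else 1]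
  rw [prod_congr rfl e1, prod_Icc_eq_prod_fin N fun i => ∏ k : Fin N,
    if i < N - k then H i (N - k) else 1, prod_comm]
  refine prod_congr rfl fun k _ => ?_
  have : Ioi k = univ.filter (fun l => k < l) := by ext; simp
  rw [this, prod_filter]
  refine prod_congr rfl fun l _ => ?_
  refine if_congr ?_ rfl rfl
  rw [Fin.lt_def]
  omega

variable {N S T : ℕ} {p s r₁ r₂ : ℂ}

lemma IsShiftedParams.balance {t m : ℤ} {q A B C D E F : ℂ} (hs : s ≠ 0) (hr₁ : r₁ ≠ 0)
    (hr₂ : r₂ ≠ 0) (h : IsShiftedParams N S T t m s r₁ r₂ q A B C D E F) :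
    A * B * C * D * E * F * q ^ (2 * N) = q ^ 3 := by
  have e : s ^ (t + S - 2 * T + 1 - 2 * m) * s ^ (t + S + 2 * T + 1) * s ^ (t - S - 2 * N + 1) *
      s ^ (-t + S - 2 * N + 1) * s ^ (-t - S + 1) * s ^ (-t - S + 1 + 2 * m) * (s ^ 2) ^ (2 * N) =
      (s ^ 2) ^ 3 := by
    rw [← pow_mul, ← pow_mul, ← zpow_natCast, ← zpow_natCast]
    simp only [← zpow_add₀ hs]
    congr 1
    push_cast
    ring
  rw [h.q_eq, ← e, h.A_eq, h.B_eq, h.C_eq, h.D_eq, h.E_eq, h.F_eq, parB, parC, parD, parE]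
  generalize s ^ (t + S - 2 * T + 1 - 2 * m) = u₁
  generalize s ^ (t + S + 2 * T + 1) = u₂
  generalize s ^ (t - S - 2 * N + 1) = u₃
  generalize s ^ (-t + S - 2 * N + 1) = u₄
  generalize s ^ (-t - S + 1) = u₅
  generalize s ^ (-t - S + 1 + 2 * m) = u₆
  field_simp

variable (nd : Nondegenerate N S T p s r₁ r₂)
include nd

lemma phi_sq_symm {t x y : ℤ} : phi p (s ^ 2) (r₁ ^ 2) (r₂ ^ 2) t S x y ^ 2 =
    phi p (s ^ 2) (r₁ ^ 2) (r₂ ^ 2) t S y x ^ 2 := by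
  have hs := nd.s_ne
  have hr₁ := nd.r₁_ne
  have hr₂ := nd.r₂_ne
  rw [phi_eq nd, phi_eq nd, thetaKernel_symm nd.norm_lt (x := sitePos S s r₁ r₂ t x)
    (by rw [sitePos]; positivity) (by rw [sitePos]; positivity)]
  ring

/-- Matches the squared pair factor of the Delta symbol, written with the larger coordinate first
and the origin at m. Shifting the origin costs only a constant. -/
lemma phi_sq_eq_shifted {t m : ℤ} {F : ℂ} (hF : F = s ^ (-t - S + 1 + 2 * m) * (r₁ * r₂)) {a b : ℕ}
    (hab : b ≤ a) : phi p (s ^ 2) (r₁ ^ 2) (r₂ ^ 2) t S (b + m) (a + m) ^ 2 =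
      ((s ^ 2) ^ (-m)) ^ 2 * (((s ^ 2) ^ a)⁻¹ *
        (theta p ((s ^ 2) ^ (a - b)) * theta p ((s ^ 2) ^ (a + b) * F ^ 2))) ^ 2 := by
  have hq : s ^ 2 ≠ 0 := pow_ne_zero 2 nd.s_ne
  have e1 : (s ^ 2) ^ (-((a : ℤ) + m)) = (s ^ 2) ^ (-m) * ((s ^ 2) ^ a)⁻¹ := by
    rw [← zpow_natCast (s ^ 2) a, ← zpow_neg, ← zpow_add₀ hq]
    congr 1
    ring
  have e2 : (s ^ 2) ^ ((a : ℤ) + m - (b + m)) = (s ^ 2) ^ (a - b) := by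
    rw [← zpow_natCast (s ^ 2) (a - b)]
    congr 1
    omega
  have e3 : (s ^ 2) ^ ((a : ℤ) + m + (b + m) + 1 - t - S) * (r₁ ^ 2 * r₂ ^ 2) =
      (s ^ 2) ^ (a + b) * F ^ 2 := by
    have : (s ^ 2) ^ ((a : ℤ) + m + (b + m) + 1 - t - S) =
        (s ^ 2) ^ (a + b) * (s ^ (-t - S + 1 + 2 * m)) ^ 2 := by
      rw [← zpow_natCast, ← zpow_natCast, ← zpow_natCast, ← zpow_mul, ← zpow_mul, ← zpow_mul,
        ← zpow_add₀ nd.s_ne]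
      congr 1
      push_cast
      ring
    rw [this, hF]
    ring
  rw [phi_sq_symm nd, phi, e1, e2, e3]
  ring

lemma isNormalization_selbergDelta (hp : p ≠ 0) (i : Fin (T + 1)) {m : ℕ} {A B C D E F : ℂ}
    (hm : m = 0 ∧ (i : ℕ) + S ≤ T ∨ m = (i : ℕ) + S - T ∧ T ≤ (i : ℕ) + S)
    (h : IsShiftedParams N S T (i : ℕ) m s r₁ r₂ (s ^ 2) A B C D E F)
    (hd : IsNormalization (lineConfigs N S T i)
      (selbergDensity N S i m p (s ^ 2) (r₁ ^ 2) (r₂ ^ 2) A B C D E F)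
      (lineProb N S T p s r₁ r₂ i)) :
    IsNormalization (lineConfigs N S T i) (selbergDelta N m p (s ^ 2) A B C D E F)
      (lineProb N S T p s r₁ r₂ i) := by
  rcases Nat.eq_zero_or_pos N with rfl | hN
  · refine hd.of_eq_mul (c := 1) fun x _ => ?_
    simp [selbergDensity, vandermondeSq, selbergDelta, deltaSymbol, symbolC0, symbolC0Double,
      symbolCMinus, symbolCPlus]
  have hs := nd.s_ne
  have hr₁ := nd.r₁_ne
  have hr₂ := nd.r₂_ne
  have hi := i.isLt
  have hST : S ≤ T := by exact_mod_cast nd.S_le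
  have hb : ∀ b ∈ [A * F, B * F, C * F, D * F, E * F, s ^ 2 * F / A, s ^ 2 * F / B, s ^ 2 * F / C,
      s ^ 2 * F / D, s ^ 2 * F / E], ∀ k, k + 1 < N → theta p ((s ^ 2) ^ k * b) ≠ 0 := by
    simp only [List.forall_mem_cons, List.not_mem_nil, false_imp_iff, implies_true, and_true]
    have key : ∀ {a : ℤ} {y : ℂ}, y ≠ 0 → br p s y a ≠ 0 → s ^ a * y * br p s y a ≠ 0 :=
      fun hy h => mul_ne_zero (mul_ne_zero (zpow_ne_zero _ hs) hy) h
    have hr := mul_ne_zero hr₁ hr₂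
    refine ⟨?_, ?_, ?_, ?_, ?_, ?_, ?_, ?_, ?_, ?_⟩ <;> intro k hk
    · rw [theta_pow_AF nd h]
      exact key hr (nd.c_ne _ (by omega) (by omega))
    · rw [theta_pow_BF nd h]
      exact key hr₂ (nd.b_ne _ (by omega) (by omega))
    · rw [theta_pow_CF nd h]
      exact key one_ne_zero (nd.e_ne' (by omega) (by omega) (by omega))
    · rw [theta_pow_DF nd h]
      exact key one_ne_zero (nd.e_ne' (by omega) (by omega) (by omega))
    · rw [theta_pow_EF nd h]
      exact key hr₁ (nd.a_ne _ (by omega) (by omega))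
    · rw [theta_pow_div_A nd h]
      exact key one_ne_zero (nd.e_ne _ (by omega) (by omega))
    · rw [theta_pow_div_B nd h]
      exact key hr₁ (nd.a_ne _ (by omega) (by omega))
    · rw [theta_pow_div_C nd h]
      exact key hr (nd.c_ne _ (by omega) (by omega))
    · rw [theta_pow_div_D nd h]
      exact key hr (nd.c_ne _ (by omega) (by omega))
    · rw [theta_pow_div_E nd h]
      exact key hr₂ (nd.b_ne _ (by omega) (by omega))
  -- The largest k here corresponds to index 2N - 1, the end of the range in which the v₁v₂ thetas
  -- are assumed nonzero. The bound N + T - 1 below is the analogous end for the powers of q.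
  have hf : ∀ k, k ≤ 2 * N - 2 + i + S - 2 * m → theta p ((s ^ 2) ^ k * F ^ 2) ≠ 0 := by
    intro k hk
    rw [theta_pow_sq nd h]
    exact mul_ne_zero (by positivity) (nd.c_ne _ (by omega) (by omega))
  have he : ∀ k, k < N + T - 1 → theta p ((s ^ 2) ^ k * s ^ 2) ≠ 0 := by
    intro k hk
    rw [theta_pow_q h hs]
    exact mul_ne_zero (mul_ne_zero (zpow_ne_zero _ hs) one_ne_zero) (nd.e_ne _ (by omega) (by omega))
  have hA : A ≠ 0 := by rw [h.A_eq]; exact mul_ne_zero (zpow_ne_zero _ hs) (mul_ne_zero hr₁ hr₂)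
  have hB : B ≠ 0 := by rw [h.B_eq]; exact mul_ne_zero (zpow_ne_zero _ hs) (div_ne_zero hr₂ hr₁)
  have hC : C ≠ 0 := by rw [h.C_eq]; exact mul_ne_zero (zpow_ne_zero _ hs) (one_div_ne_zero (mul_ne_zero hr₁ hr₂))
  have hD : D ≠ 0 := by rw [h.D_eq]; exact mul_ne_zero (zpow_ne_zero _ hs) (one_div_ne_zero (mul_ne_zero hr₁ hr₂))
  have hE : E ≠ 0 := by rw [h.E_eq]; exact mul_ne_zero (zpow_ne_zero _ hs) (div_ne_zero hr₁ hr₂)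
  have hF : F ≠ 0 := by rw [h.F_eq]; exact mul_ne_zero (zpow_ne_zero _ hs) (mul_ne_zero hr₁ hr₂)
  obtain ⟨hκ, hΔ⟩ := deltaSymbol_eq nd.norm_lt hp (pow_ne_zero 2 hs) hA hB hC hD hE hF
    (h.balance hs hr₁ hr₂) hb hf (by omega) he (by omega)
  refine hd.of_eq_mul (c := (deltaConst N p (s ^ 2) A B C D E F)⁻¹ *
    ∏ k : Fin N, ∏ _l ∈ Ioi k, ((s ^ 2) ^ (-(m : ℤ))) ^ 2) fun x hx => ?_
  obtain ⟨hx1, hx2⟩ := mem_lineConfigs.mp hx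
  have hxk : ∀ k : Fin N, m + k ≤ x k ∧ (x k : ℕ) < i + N ∧ (x k : ℕ) < S + N := by
    intro k
    obtain ⟨a1, a2, a3, a4⟩ := hx2 ⟨0, hN⟩
    obtain ⟨b1, b2, b3, b4⟩ := hx2 k
    have := strictMono_add_le hx1 (i := ⟨0, hN⟩) (j := k) (by simp [Fin.le_def])
    simp only [toInt] at *
    omega
  -- The coordinates ξ_j = λ_j + N - j are the particle positions above m, in decreasing order.
  set ξ : ℕ → ℕ := fun j => if hj : 1 ≤ j ∧ j ≤ N then (x ⟨N - j, by omega⟩ : ℕ) - m else 0 with hξ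
  have hξk : ∀ k : Fin N, ξ (N - k) = x k - m := by
    intro k
    have : (⟨N - (N - k), by omega⟩ : Fin N) = k := by ext; simp only; omega
    simp only [hξ, this]
    rw [dif_pos (by omega)]
  have hξ1 : ∀ j (h1 : 1 ≤ j) (h2 : j ≤ N), ξ j = x ⟨N - j, by omega⟩ - m := by
    intro j h1 h2
    simp only [hξ]
    rw [dif_pos ⟨h1, h2⟩]
  have hmono : ∀ {a b : Fin N}, a ≤ b → (x a : ℕ) + (b - a : ℕ) ≤ x b := by
    intro a b hab
    have := strictMono_add_le hx1 hab
    have := Fin.le_def.mp hab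
    simp only [toInt] at *
    omega
  have hlam1 : ∀ j (h1 : 1 ≤ j) (h2 : j ≤ N),
      partitionOf m x j = x ⟨N - j, by omega⟩ - m - (N - j) := by
    intro j h1 h2
    rw [partitionOf, dif_pos ⟨h1, h2⟩]
  have hlam0 : ∀ j, N < j → partitionOf m x j = 0 := fun j h1 => by
    rw [partitionOf, dif_neg (by omega)]
  have alg : ∀ κ W V X : ℂ, κ ≠ 0 → W * V * X = κ⁻¹ * W * (κ * (X * V)) := by
    intro κ W V X h
    field_simp
  rw [selbergDelta, hΔ (partitionOf m x) ξ]
  · rw [prod_Icc_eq_prod_fin, prod_Icc_Ioc_eq_prod_fin N fun a b => (((s ^ 2) ^ ξ a)⁻¹ *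
      (theta p ((s ^ 2) ^ (ξ a - ξ b)) * theta p ((s ^ 2) ^ (ξ a + ξ b) * F ^ 2))) ^ 2,
      selbergDensity]
    simp only [hξk]
    have e : vandermondeSq p (s ^ 2) (r₁ ^ 2) (r₂ ^ 2) (i : ℕ) S x =
        (∏ k : Fin N, ∏ _l ∈ Ioi k, ((s ^ 2) ^ (-(m : ℤ))) ^ 2) *
        ∏ k : Fin N, ∏ l ∈ Ioi k, (((s ^ 2) ^ ((x l : ℕ) - m))⁻¹ *
          (theta p ((s ^ 2) ^ ((x l : ℕ) - m - ((x k : ℕ) - m))) *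
            theta p ((s ^ 2) ^ ((x l : ℕ) - m + ((x k : ℕ) - m)) * F ^ 2))) ^ 2 := by
      simp only [vandermondeSq, ← prod_mul_distrib]
      refine prod_congr rfl fun k _ => prod_congr rfl fun l hl => ?_
      have h1 := hmono (mem_Ioi.mp hl).le
      have h2 := hxk k
      have h3 := hxk l
      rw [← phi_sq_eq_shifted nd h.F_eq (by omega)]
      congr 2 <;> omega
    rw [e]
    exact alg _ _ _ _ hκ
  · intro j h1 h2
    have := hxk ⟨N - j, by omega⟩
    simp only at this
    rw [hξ1 j h1 h2, hlam1 j h1 h2]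
    omega
  · exact hlam0 _ (by omega)
  · intro j k h1 h2 h3
    rcases Nat.lt_or_ge N k with h4 | h4
    · rw [hlam0 k h4]
      exact Nat.zero_le _
    · have := hmono (a := ⟨N - k, by omega⟩) (b := ⟨N - j, by omega⟩)
        (by simp only [Fin.le_def]; omega)
      rw [hlam1 k (by omega) h4, hlam1 j h1 (by omega)]
      simp only at this
      omega
  · intro j h1 h2
    have := hxk ⟨N - j, by omega⟩
    rw [hξ1 j h1 h2]
    omega
  · intro j h1 h2
    have := hxk ⟨N - j, by omega⟩
    rw [hξ1 j h1 h2]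
    omega

end DeltaDensity

end EllipticTilings

end

/-! ### Assembly of the theorem -/

open EllipticTilings in
theorem theorem3p4 (N S T : ℕ) (hST : S ≤ T)
    (p q v₁ v₂ sq r₁ r₂ : ℂ) (hp : ‖p‖ < 1) (hq : q ≠ 0) (hv₁ : v₁ ≠ 0) (hv₂ : v₂ ≠ 0)
    (hsq : sq ^ 2 = q) (hr₁ : r₁ ^ 2 = v₁) (hr₂ : r₂ ^ 2 = v₂)
    (hθq : ∀ k : ℤ, 1 ≤ k → k ≤ N + T - 1 → theta p (q ^ k) ≠ 0)
    (hθv₁ : ∀ k : ℤ, 1 - 2 * T ≤ k → k ≤ N - S - 1 → theta p (q ^ k * v₁) ≠ 0)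
    (hθv₂ : ∀ k : ℤ, 1 ≤ k → k ≤ N + S + T - 1 → theta p (q ^ k * v₂) ≠ 0)
    (hθv₁v₂ : ∀ k : ℤ, 1 - T ≤ k → k ≤ 2 * N - 1 → theta p (q ^ k * (v₁ * v₂)) ≠ 0)
    (hZ : partitionFunction N S T p sq r₁ r₂ ≠ 0)
    (t : Fin (T + 1)) (A B C D E F : ℂ)
    (hA : A = parA S T (t : ℕ) sq r₁ r₂) (hB : B = parB S T (t : ℕ) sq r₁ r₂)
    (hC : C = parC N S (t : ℕ) sq r₁ r₂) (hD : D = parD N S (t : ℕ) sq r₁ r₂)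
    (hE : E = parE S (t : ℕ) sq r₁ r₂) (hF : F = parF S (t : ℕ) sq r₁ r₂) :
    ((t : ℕ) + S ≤ T →
      IsNormalization (lineConfigs N S T t)
        (lineDensity N S T t p q v₁ v₂) (lineProb N S T p sq r₁ r₂ t) ∧
      IsNormalization (lineConfigs N S T t)
        (selbergDensity N S t 0 p q v₁ v₂ A B C D E F) (lineProb N S T p sq r₁ r₂ t) ∧
      (p ≠ 0 → IsNormalization (lineConfigs N S T t)
        (selbergDelta N 0 p q A B C D E F) (lineProb N S T p sq r₁ r₂ t))) ∧
    (T ≤ (t : ℕ) + S →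
      IsNormalization (lineConfigs N S T t)
        (selbergDensity N S t (t + S - T) p q v₁ v₂ F B C D E A)
        (lineProb N S T p sq r₁ r₂ t) ∧
      (p ≠ 0 → IsNormalization (lineConfigs N S T t)
        (selbergDelta N (t + S - T) p q F B C D E A) (lineProb N S T p sq r₁ r₂ t))) := by
  subst hsq hr₁ hr₂ hA hB hC hD hE hF
  have hs : sq ≠ 0 := fun h => hq (by rw [h]; ring)
  have hr₁ : r₁ ≠ 0 := fun h => hv₁ (by rw [h]; ring)
  have hr₂ : r₂ ≠ 0 := fun h => hv₂ (by rw [h]; ring)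
  have ne : ∀ {k : ℤ} {y : ℂ}, y ≠ 0 → theta p ((sq ^ 2) ^ k * y ^ 2) ≠ 0 → br p sq y k ≠ 0 := by
    intro k y hy h
    rw [theta_eq_br hs hy k] at h
    · exact right_ne_zero_of_mul h
    · rw [mul_pow, ← zpow_natCast, ← zpow_natCast (sq ^ k), ← zpow_mul, ← zpow_mul,
        mul_comm (_ : ℤ)]
  have nd : Nondegenerate N S T p sq r₁ r₂ :=
    { norm_lt := hp
      s_ne := hs
      r₁_ne := hr₁
      r₂_ne := hr₂
      S_nonneg := by omega
      S_le := by omega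
      e_ne := fun k h1 h2 => ne one_ne_zero (by simpa using hθq k h1 h2)
      a_ne := fun k h1 h2 => ne hr₁ (hθv₁ k h1 h2)
      b_ne := fun k h1 h2 => ne hr₂ (hθv₂ k h1 h2)
      c_ne := fun k h1 h2 => ne (mul_ne_zero hr₁ hr₂) (by
        rw [mul_pow]
        exact hθv₁v₂ k h1 h2) }
  refine ⟨fun ht => ?_, fun ht => ?_⟩
  · have hm : 0 = 0 ∧ (t : ℕ) + S ≤ T ∨ 0 = (t : ℕ) + S - T ∧ T ≤ (t : ℕ) + S := Or.inl ⟨rfl, ht⟩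
    have h : IsShiftedParams N S T (t : ℕ) (0 : ℕ) sq r₁ r₂ (sq ^ 2) (parA S T (t : ℕ) sq r₁ r₂)
        (parB S T (t : ℕ) sq r₁ r₂) (parC N S (t : ℕ) sq r₁ r₂) (parD N S (t : ℕ) sq r₁ r₂)
        (parE S (t : ℕ) sq r₁ r₂) (parF S (t : ℕ) sq r₁ r₂) :=
      ⟨rfl, by simp [parA], rfl, rfl, rfl, rfl, by simp [parF]⟩
    have h1 := isNormalization_selbergDensity nd hZ t hm h
    exact ⟨by rw [lineDensity_eq hs hr₁ hr₂]; exact h1, h1,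
      fun hp0 => isNormalization_selbergDelta nd hp0 t hm h h1⟩
  · have hm : (t : ℕ) + S - T = 0 ∧ (t : ℕ) + S ≤ T ∨
        (t : ℕ) + S - T = (t : ℕ) + S - T ∧ T ≤ (t : ℕ) + S := Or.inr ⟨rfl, ht⟩
    -- For m = t + S - T the identities F = q^{-m} A and A = q^m F show that exchanging A and F is
    -- the shift by m.
    have h : IsShiftedParams N S T (t : ℕ) ((t : ℕ) + S - T : ℕ) sq r₁ r₂ (sq ^ 2)
        (parF S (t : ℕ) sq r₁ r₂) (parB S T (t : ℕ) sq r₁ r₂) (parC N S (t : ℕ) sq r₁ r₂)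
        (parD N S (t : ℕ) sq r₁ r₂) (parE S (t : ℕ) sq r₁ r₂) (parA S T (t : ℕ) sq r₁ r₂) := by
      refine ⟨rfl, ?_, rfl, rfl, rfl, rfl, ?_⟩
      · rw [parF]
        congr 2
        omega
      · rw [parA]
        congr 2
        omega
    have h1 := isNormalization_selbergDensity nd hZ t hm h
    exact ⟨h1, fun hp0 => isNormalization_selbergDelta nd hp0 t hm h h1⟩
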